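/- Let $n\ge 1$, $d=n+1$, $0<\nu<1$, $f\ge 0$, and $A_\nu=2^{2\nu}\pi^{d/2}\,\Gamma(\nu)/\Gamma(\tfrac d2-\nu)$. For a momentum $p=(\omega,\vec k)\in\mathbb R\times\mathbb R^{n}$ write $-p^2=\omega^2-|\vec k|^2$ and $p\cdot x=-\omega t+\vec k\cdot\vec x$ for $x=(t,\vec x)$; $\theta$ is the Heaviside function. **(1) Analytic continuation.** For Euclidean time $\tau\neq0$ the Schwinger function of the double-trace deformed CFT, $$s(\tau,\vec x)=\int\frac{d^{n}k}{(2\pi)^{n}}\,e^{i\vec k\cdot\vec x}\int_{-\infty}^{\infty}\frac{dk_d}{2\pi}\,e^{ik_d\tau}\,\frac{A_\nu}{(|\vec k|^2+k_d^2)^{\nu}+fA_\nu},$$ is well defined: the inner integral converges as an improper integral for every $\vec k\ne0$, and is then an integrable function of $\vec k$. The integral $$\omega_2(z,\vec x)=2A_\nu\sin(\pi\nu)\int\frac{d^dp}{(2\pi)^d}\,e^{i\vec k\cdot\vec x-i\omega z}\,\frac{(-p^2)^\nu\,\theta(-p^2)\,\theta(\omega)}{(-p^2)^{2\nu}+2fA_\nu\cos(\pi\nu)(-p^2)^\nu+(fA_\nu)^2}$$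 converges absolutely for $\operatorname{Im}z<0$, is holomorphic in $z$ there, and satisfies $\omega_2(-i|\tau|,\vec x)=s(\tau,\vec x)$ for all $\tau\neq0$. So $\omega_2(t-i\varepsilon,\vec x)$ is the Wightman function obtained from $s$ by analytic continuation. **(2) Support.** As $\varepsilon\to0^+$, $\omega_2(t-i\varepsilon,\vec x)$ converges to a tempered distribution. Its Fourier transform is the (locally integrable, tempered) function of $p$ multiplying the exponential above, and the support of that Fourier transform is the closed future light cone $\{\omega\ge|\vec k|\}$. **(3) Map to the bulk.** Let $J_{\pm\nu}$ be Bessel functions, and let the Robin kernel with angle $\gamma$, for a boundary point $x$ and a bulk point $X=(x',Z')$, $Z'>0$, be $$K_R(x|x',Z')=\int\frac{d^dp}{(2\pi)^d}\,e^{ip\cdot(x'-x)}\Big[\cos\gamma\,2^{\nu}\Gamma(1+\nu)(-p^2)^{-\nu/2}Z'^{d/2}J_\nu(\sqrt{-p^2}Z')+\sin\gamma\,2^{-\nu}\Gamma(1-\nu)(-p^2)^{\nu/2}Z'^{d/2}J_{-\nu}(\sqrt{-p^2}Z')\Big].$$ The bracket is entire in $p^2$ and is used for all $p$. The integral is an oscillatory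 integral: multiply the bracket by $\chi(p/\Lambda)$ with $\chi\in C_c^\infty$ real-valued, $\chi(0)=1$, and let $\Lambda\to\infty$ at the end. Let the bulk Wightman function with Robin parameter $\alpha$ be $$G_\alpha^{\varepsilon}(X_1,X_2)=\int\frac{d^{n}k}{(2\pi)^{n}}\int_0^\infty dq\;\frac{V_q(Z_1)V_q(Z_2)}{2\omega}\,e^{i\vec k\cdot(\vec x_1-\vec x_2)-i\omega(t_1-t_2-i\varepsilon)},\qquad \omega=\sqrt{|\vec k|^2+q^2},$$ $$V_q(Z)=Z^{n/2}\sqrt{qZ}\;\frac{\cos\alpha\,J_\nu(qZ)-\sin\alpha\,q^{2\nu}J_{-\nu}(qZ)}{\sqrt{\cos^2\alpha-2\sin\alpha\cos\alpha\cos(\pi\nu)q^{2\nu}+\sin^2\alpha\,q^{4\nu}}}.$$ Suppose $\alpha,\gamma\in(0,\pi)$, $$\cot\alpha=-fA_\nu ,\qquad \cot\gamma=-2^{-2\nu}\,\frac{\Gamma(1-\nu)}{\Gamma(1+\nu)}\,\cot\alpha .$$ Then: * For every $q>0$, $V_q$ is smooth on $(0,\infty)$ and solves the radial Klein-Gordon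 equation $Z^2V''-(d-1)ZV'+(q^2Z^2-\nu^2+\tfrac{d^2}4)V=0$. It obeys the Robin boundary condition $V_q\sim\phi\,(\sin\gamma\,Z^{d/2-\nu}+\cos\gamma\,Z^{d/2+\nu})$ as $Z\to0^+$ with some $\phi\ne0$, in the sense that $Z^{-(d/2-\nu)}V_q\to\phi\sin\gamma$ and $Z^{-(d/2+\nu)}\big(V_q-\phi\sin\gamma\,Z^{d/2-\nu}\big)\to\phi\cos\gamma$. * For every $\varepsilon>0$ and all bulk points $X_1=(x_1',Z_1)$, $X_2=(x_2',Z_2)$ with $Z_1,Z_2>0$, the integral defining $G^\varepsilon_\alpha(X_1,X_2)$ converges absolutely, and so does the double integral below when the two kernels carry cutoffs at finite scales $\Lambda_1,\Lambda_2>0$. As $\Lambda_1,\Lambda_2\to\infty$, with arbitrary cutoff functions $\chi_1,\chi_2$, $$\int d^dx_1\,d^dx_2\,K_R(x_1|X_1)\,K_R(x_2|X_2)\,\omega_2(t_1-t_2-i\varepsilon,\vec x_1-\vec x_2)= \frac{2\pi^{d/2}\,\Gamma(1-\nu)}{\Gamma(\frac d2-\nu)}\,\sin^2\gamma\;\,G_\alpha^{\varepsilon}(X_1,X_2).$$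 * For every smooth compactly supported test function $F$ of pairs of bulk points with $Z_1,Z_2>0$, $\int G^\varepsilon_\alpha F$ converges absolutely for each $\varepsilon>0$ and has a limit as $\varepsilon\to0^+$. -/

import Mathlib

open Real Set Filter Topology MeasureTheory
open scoped SchwartzMap ContDiff RealInnerProductSpace

namespace RobinHolography

/-- Minkowski space (and its momentum space) of dimension `d = n + 1`: pairs (time, position),
respectively (frequency, spatial momentum). -/
abbrev Mink (n : ℕ) : Type := ℝ × EuclideanSpace ℝ (Fin n)

/-- The Poincaré patch of anti-de Sitter space of dimension `d + 1`: pairs (boundary point, `Z`);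
the points of the patch are those with `0 < Z`. -/
abbrev Bulk (n : ℕ) : Type := Mink n × ℝ

/-- The Minkowski product `p · x = -ω t + k · x`. -/
noncomputable def minkProd {n : ℕ} (p x : Mink n) : ℝ := -(p.1 * x.1) + ⟪p.2, x.2⟫

/-- The invariant `-p² = ω² - |k|²`. -/
noncomputable def negSq {n : ℕ} (p : Mink n) : ℝ := p.1 ^ 2 - ‖p.2‖ ^ 2

/-- The constant `A_ν = 2^(2ν) π^(d/2) Γ(ν) / Γ(d/2 - ν)` with `d = n + 1`. -/
noncomputable def Aconst (n : ℕ) (ν : ℝ) : ℝ :=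
  2 ^ (2 * ν) * π ^ (((n : ℝ) + 1) / 2) * Real.Gamma ν / Real.Gamma (((n : ℝ) + 1) / 2 - ν)

/-! ### The boundary theory -/

/-- The inner integral over the Euclidean frequency of the Schwinger function, cut off at `±R`. -/
noncomputable def schwingerCutoff (n : ℕ) (ν f τ : ℝ) (k : EuclideanSpace ℝ (Fin n)) (R : ℝ) : ℂ :=
  ∫ s in (-R)..R, Complex.exp (Complex.I * ((s * τ : ℝ) : ℂ)) *
    ((Aconst n ν / ((‖k‖ ^ 2 + s ^ 2) ^ ν + f * Aconst n ν) / (2 * π) : ℝ) : ℂ)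

/-- The inner integral of the Schwinger function, as an improper integral. -/
noncomputable def schwingerMode (n : ℕ) (ν f τ : ℝ) (k : EuclideanSpace ℝ (Fin n)) : ℂ :=
  limUnder atTop (schwingerCutoff n ν f τ k)

/-- The Schwinger two-point function `s((τ, x); 0)` of the double-trace deformed theory. -/
noncomputable def schwinger (n : ℕ) (ν f τ : ℝ) (x : EuclideanSpace ℝ (Fin n)) : ℂ :=
  ∫ k : EuclideanSpace ℝ (Fin n),
    Complex.exp (Complex.I * ((⟪k, x⟫ : ℝ) : ℂ)) * schwingerMode n ν f τ k / (2 * π) ^ n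

/-- The momentum-space density of the boundary Wightman function, with respect to
`d^d p / (2π)^d`; the condition `‖k‖ < ω` is the factor `θ(-p²) θ(ω)`. -/
noncomputable def wightmanDensity (n : ℕ) (ν f : ℝ) (p : Mink n) : ℝ :=
  if ‖p.2‖ < p.1 then
    2 * Aconst n ν * Real.sin (π * ν) *
      (negSq p ^ ν / (negSq p ^ (2 * ν) + f * Aconst n ν * (2 * Real.cos (π * ν)) * negSq p ^ ν
        + (f * Aconst n ν) ^ 2))
  else 0

/-- The integrand of the boundary Wightman function at complex time `z` (`z = t - iε`). -/
noncomputable def wightmanIntegrand (n : ℕ) (ν f : ℝ) (z : ℂ) (x : EuclideanSpace ℝ (Fin n))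
    (p : Mink n) : ℂ :=
  Complex.exp (Complex.I * ((⟪p.2, x⟫ : ℝ) : ℂ) - Complex.I * (p.1 : ℂ) * z) *
    (wightmanDensity n ν f p : ℂ) / (2 * π) ^ (n + 1)

/-- The boundary Wightman function at complex time `z` (`z = t - iε`). -/
noncomputable def wightman (n : ℕ) (ν f : ℝ) (z : ℂ) (x : EuclideanSpace ℝ (Fin n)) : ℂ :=
  ∫ p : Mink n, wightmanIntegrand n ν f z x p

/-- The boundary Wightman function with its `iε` regulator, at a point of real Minkowski space. -/
noncomputable def wightmanReg (n : ℕ) (ν f ε : ℝ) (x : Mink n) : ℂ :=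
  wightman n ν f ((x.1 : ℂ) - Complex.I * (ε : ℂ)) x.2

/-- The Fourier transform `p ↦ ∫ e^{i p · x} h(x) dx` with the Minkowski product. -/
noncomputable def minkFourier {n : ℕ} (h : Mink n → ℂ) (p : Mink n) : ℂ :=
  ∫ x : Mink n, Complex.exp (Complex.I * (minkProd p x : ℂ)) * h x

/-! ### Bessel functions and the Robin kernel -/

/-- The Bessel function `J_μ(x)` for `x > 0`. -/
noncomputable def besselJ (μ x : ℝ) : ℝ :=
  ∑' m : ℕ, (-1) ^ m / ((m.factorial : ℝ) * Real.Gamma (m + μ + 1)) * (x / 2) ^ (2 * (m : ℝ) + μ)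

/-- The entire function `s ↦ (√s / 2)^(-μ) J_μ(√s)`. -/
noncomputable def besselEntire (μ s : ℝ) : ℝ :=
  ∑' m : ℕ, (-1) ^ m / ((m.factorial : ℝ) * Real.Gamma (m + μ + 1)) * (s / 4) ^ m

theorem besselJ_eq_besselEntire (μ : ℝ) {s Z : ℝ} (hs : 0 < s) (hZ : 0 < Z) :
    s ^ (-μ / 2) * besselJ μ (√s * Z) = (Z / 2) ^ μ * besselEntire μ (s * Z ^ 2) := by
  unfold besselJ besselEntire
  rw [← tsum_mul_left, ← tsum_mul_left]
  refine tsum_congr fun m => ?_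
  have hq : 0 < √s := Real.sqrt_pos.2 hs
  have h0 : (0 : ℝ) < √s * Z / 2 := by positivity
  have h1 : (√s * Z / 2) ^ (2 * (m : ℝ) + μ)
      = (s * Z ^ 2 / 4) ^ m * (s ^ (μ / 2) * (Z / 2) ^ μ) := by
    rw [Real.rpow_add h0]
    congr 1
    · rw [Real.rpow_mul h0.le, Real.rpow_natCast, Real.rpow_two]
      congr 1
      rw [div_pow, mul_pow, Real.sq_sqrt hs.le]
      norm_num
    · rw [mul_div_assoc, Real.mul_rpow hq.le (by positivity), Real.sqrt_eq_rpow,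
        ← Real.rpow_mul hs.le]
      congr 2
      ring
  have h2 : s ^ (-μ / 2) * s ^ (μ / 2) = 1 := by
    rw [← Real.rpow_add hs, neg_div, neg_add_cancel, Real.rpow_zero]
  rw [h1]
  linear_combination
    ((-1) ^ m / ((m.factorial : ℝ) * Real.Gamma (m + μ + 1)) * (s * Z ^ 2 / 4) ^ m * (Z / 2) ^ μ) * h2

/-- The momentum-space Robin kernel as an entire function of `s = -p²`; for `s > 0` it is the
combination of Bessel functions in `robinProfile_eq`. -/
noncomputable def robinProfile (n : ℕ) (ν γ Z s : ℝ) : ℝ :=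
  Z ^ (((n : ℝ) + 1) / 2) *
    (Real.cos γ * (2 ^ ν * Real.Gamma (1 + ν)) * ((Z / 2) ^ ν * besselEntire ν (s * Z ^ 2))
      + Real.sin γ * (2 ^ (-ν) * Real.Gamma (1 - ν)) *
        ((Z / 2) ^ (-ν) * besselEntire (-ν) (s * Z ^ 2)))

theorem robinProfile_eq (n : ℕ) (ν γ : ℝ) {Z s : ℝ} (hZ : 0 < Z) (hs : 0 < s) :
    robinProfile n ν γ Z s =
      Real.cos γ * 2 ^ ν * Real.Gamma (1 + ν) * s ^ (-ν / 2)
          * (Z ^ (((n : ℝ) + 1) / 2) * besselJ ν (√s * Z))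
        + Real.sin γ * 2 ^ (-ν) * Real.Gamma (1 - ν) * s ^ (ν / 2)
          * (Z ^ (((n : ℝ) + 1) / 2) * besselJ (-ν) (√s * Z)) := by
  have h1 := besselJ_eq_besselEntire ν hs hZ
  have h2 := besselJ_eq_besselEntire (-ν) hs hZ
  rw [neg_neg] at h2
  unfold robinProfile
  rw [← h1, ← h2]
  ring

/-- A smooth momentum cutoff: `χ(p / Λ) → 1` as `Λ → ∞`. -/
structure IsCutoff {n : ℕ} (χ : Mink n → ℝ) : Prop where
  smooth : ContDiff ℝ ∞ χ
  compact : HasCompactSupport χ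
  one : χ 0 = 1

/-- The Robin kernel `K_R(x | x', Z')`, with bulk point `X = (x', Z')`: the oscillatory integral
`∫ d^d p / (2π)^d e^{i p · (x' - x)} robinProfile(Z', -p²)` over all momenta, regulated by the
cutoff `χ` at scale `Λ`. -/
noncomputable def robinKernel {n : ℕ} (ν γ : ℝ) (χ : Mink n → ℝ) (Λ : ℝ) (x : Mink n)
    (X : Bulk n) : ℂ :=
  ∫ p : Mink n, Complex.exp (Complex.I * (minkProd p (X.1 - x) : ℂ)) *
    ((χ (Λ⁻¹ • p) * robinProfile n ν γ X.2 (negSq p) : ℝ) : ℂ) / (2 * π) ^ (n + 1)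

/-- The integrand `K_R(x₁ | X₁) K_R(x₂ | X₂) ω₂(x₁, x₂)` with cutoffs in the two kernels. -/
noncomputable def mappedIntegrand {n : ℕ} (ν γ f ε : ℝ) (χ₁ χ₂ : Mink n → ℝ) (Λ₁ Λ₂ : ℝ)
    (X₁ X₂ : Bulk n) (x : Mink n × Mink n) : ℂ :=
  robinKernel ν γ χ₁ Λ₁ x.1 X₁ * robinKernel ν γ χ₂ Λ₂ x.2 X₂ * wightmanReg n ν f ε (x.1 - x.2)

/-! ### The bulk theory -/

/-- The normalized radial mode of "mass" `q` with Robin parameter `α`: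
`Z^(n/2) √(qZ) (cos α J_ν(qZ) - sin α q^(2ν) J_{-ν}(qZ)) / √D`, where
`D = cos² α - 2 sin α cos α cos(πν) q^(2ν) + sin² α q^(4ν)`. -/
noncomputable def robinMode (n : ℕ) (ν α q Z : ℝ) : ℝ :=
  Z ^ ((n : ℝ) / 2) * √(q * Z) *
    (Real.cos α * besselJ ν (q * Z) - Real.sin α * q ^ (2 * ν) * besselJ (-ν) (q * Z)) /
    √(Real.cos α ^ 2 - 2 * Real.sin α * Real.cos α * Real.cos (π * ν) * q ^ (2 * ν)
      + Real.sin α ^ 2 * q ^ (4 * ν))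

/-- The energy `√(|k|² + q²)`. -/
noncomputable def energy {n : ℕ} (k : EuclideanSpace ℝ (Fin n)) (q : ℝ) : ℝ :=
  √(‖k‖ ^ 2 + q ^ 2)

/-- The integrand of the mode expansion of the bulk Wightman function. -/
noncomputable def bulkIntegrand (n : ℕ) (ν α ε : ℝ) (X₁ X₂ : Bulk n)
    (y : EuclideanSpace ℝ (Fin n) × ℝ) : ℂ :=
  Complex.exp (Complex.I * ((⟪y.1, X₁.1.2 - X₂.1.2⟫ : ℝ) : ℂ)
      - Complex.I * (energy y.1 y.2 : ℂ) * (((X₁.1.1 - X₂.1.1 : ℝ) : ℂ) - Complex.I * (ε : ℂ))) *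
    ((robinMode n ν α y.2 X₁.2 * robinMode n ν α y.2 X₂.2 / (2 * energy y.1 y.2) : ℝ) : ℂ)
    / (2 * π) ^ n

/-- The Wightman function of the ground state of the Klein-Gordon field on the Poincaré patch with
Robin boundary conditions, with its `iε` regulator: the sum over the modes with spatial momentum
`k` and radial parameter `q > 0`. -/
noncomputable def bulkWightman (n : ℕ) (ν α ε : ℝ) (X₁ X₂ : Bulk n) : ℂ :=
  ∫ y in (univ : Set (EuclideanSpace ℝ (Fin n))) ×ˢ Ioi (0 : ℝ), bulkIntegrand n ν α ε X₁ X₂ y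

end RobinHolography

open RobinHolography

/-! The boundary statements rest on the Källén–Lehmann formula `kallenLehmann`: the Euclidean
propagator `A / (u^ν + fA)` equals `π⁻¹ ∫ ρ(q²) q / (u + q²) dq` over `q > 0`, where `ρ`
(`spectralDensity`) is its jump across the negative axis. Since `0 < ν < 1` and `f ≥ 0`, the
propagator has no pole in the cut plane, so the formula is Cauchy's theorem, applied in the
coordinate `log u` (`integral_dispersion`). Inserting the formula in the Schwinger function makes
the frequency integral elementary: `1 / (s² + E²)` gives `(π / E) exp(-E|τ|)`. What remains is an
integral over `(k, q)`. The coordinates `(k, q) ↦ (√(|k|² + q²), k)`, with Jacobian `q / E`,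
parametrize the open forward cone and turn it into the Wightman integral at `z = -i|τ|`. All
convergence on the cone comes from one estimate (`integrable_wightmanDensity_mul`): `ρ(s) ≤ C
s^(-ν)` and `q^(1-ν) |k|^ν ≤ E` bound the density times the Jacobian by `C q^(-ν) |k|^(-ν)`, which
is locally integrable in each variable. So the density defines a measure of temperate growth. The
boundary value exists by dominated convergence, and positivity of `ρ` on the open cone determines
the support. In the bulk, the angle relations say that `V_q` is a multiple `c(q)` of the Robin
profile at `-p² = q²` (`robinMode_eq`). The reflection formula for `Γ` gives `ρ(q²) q = M π c(q)²`
with `M` independent of `q` (`spectralDensity_mul_modeCoeff_sq`). In momentum space the two kernels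
multiply the density by two profiles, so the mapped function and `M` times the mode sum are the same
integral in different coordinates. Cutoff kernels are Schwartz, which justifies Fubini; removing the
cutoffs needs a polynomial bound on the Bessel factors for `-p² ≥ 0`, against `exp(-εω)`. To remove
`ε`, integration by parts in one time variable makes smeared plane waves decay faster than any power
of `ω`. -/

namespace RobinHolography

open scoped ENNReal

/-! ### The spectral density -/

theorem Aconst_pos {n : ℕ} (hn : 1 ≤ n) {ν : ℝ} (hν : ν ∈ Ioo (0 : ℝ) 1) : 0 < Aconst n ν := by
  have hn' : (1 : ℝ) ≤ n := by exact_mod_cast hn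
  have h1 : 0 < Real.Gamma ν := Real.Gamma_pos_of_pos hν.1
  have h2 : 0 < Real.Gamma (((n : ℝ) + 1) / 2 - ν) :=
    Real.Gamma_pos_of_pos (by linarith [hν.2])
  unfold Aconst
  positivity

theorem sin_pi_mul_pos {ν : ℝ} (hν : ν ∈ Ioo (0 : ℝ) 1) : 0 < Real.sin (π * ν) :=
  Real.sin_pos_of_pos_of_lt_pi (mul_pos pi_pos hν.1) (by nlinarith [pi_pos, hν.2])

/-- The spectral density of the deformed theory as a function of `s = -p²`. -/
noncomputable def spectralDensity (n : ℕ) (ν f s : ℝ) : ℝ :=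
  2 * Aconst n ν * Real.sin (π * ν) *
    (s ^ ν / (s ^ (2 * ν) + f * Aconst n ν * (2 * Real.cos (π * ν)) * s ^ ν
      + (f * Aconst n ν) ^ 2))

theorem wightmanDensity_eq_ite (n : ℕ) (ν f : ℝ) (p : Mink n) :
    wightmanDensity n ν f p = if ‖p.2‖ < p.1 then spectralDensity n ν f (negSq p) else 0 := rfl

/-- The right side is `|t exp(iθ) + a|²`; the difference of the two sides is `(a + t cos θ)²`. -/
theorem sq_mul_sin_sq_le (t a θ : ℝ) :
    t ^ 2 * Real.sin θ ^ 2 ≤ t ^ 2 + a * (2 * Real.cos θ) * t + a ^ 2 := by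
  nlinarith [sq_nonneg (a + Real.cos θ * t), Real.sin_sq_add_cos_sq θ]

theorem rpow_two_mul {s : ℝ} (hs : 0 ≤ s) (ν : ℝ) : s ^ (2 * ν) = (s ^ ν) ^ 2 := by
  rw [mul_comm, Real.rpow_mul hs, Real.rpow_two]

theorem spectralDenom_ge {ν : ℝ} (a : ℝ) {s : ℝ} (hs : 0 ≤ s) :
    (s ^ ν * Real.sin (π * ν)) ^ 2
      ≤ s ^ (2 * ν) + a * (2 * Real.cos (π * ν)) * s ^ ν + a ^ 2 := by
  rw [rpow_two_mul hs, mul_pow]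
  exact sq_mul_sin_sq_le _ _ _

theorem spectralDenom_pos {ν : ℝ} (hν : ν ∈ Ioo (0 : ℝ) 1) (a : ℝ) {s : ℝ} (hs : 0 < s) :
    0 < s ^ (2 * ν) + a * (2 * Real.cos (π * ν)) * s ^ ν + a ^ 2 :=
  lt_of_lt_of_le (by have := sin_pi_mul_pos hν; positivity) (spectralDenom_ge a hs.le)

theorem spectralDensity_pos {n : ℕ} (hn : 1 ≤ n) {ν : ℝ} (hν : ν ∈ Ioo (0 : ℝ) 1) (f : ℝ)
    {s : ℝ} (hs : 0 < s) : 0 < spectralDensity n ν f s := by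
  have h1 := Aconst_pos hn hν
  have h2 := sin_pi_mul_pos hν
  have h3 := spectralDenom_pos hν (f * Aconst n ν) hs
  have h4 : 0 < s ^ ν := Real.rpow_pos_of_pos hs ν
  unfold spectralDensity
  positivity

/-- The bound is uniform in `f` and serves both near the light cone and at large mass. -/
theorem spectralDensity_le {n : ℕ} (hn : 1 ≤ n) {ν : ℝ} (hν : ν ∈ Ioo (0 : ℝ) 1) (f : ℝ)
    {s : ℝ} (hs : 0 < s) :
    spectralDensity n ν f s ≤ 2 * Aconst n ν / Real.sin (π * ν) * s ^ (-ν) := by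
  have h1 := Aconst_pos hn hν
  have h2 := sin_pi_mul_pos hν
  have h3 := spectralDenom_pos hν (f * Aconst n ν) hs
  have h4 : 0 < s ^ ν := Real.rpow_pos_of_pos hs ν
  have h5 := spectralDenom_ge (ν := ν) (f * Aconst n ν) hs.le
  have h6 : s ^ ν / (s ^ (2 * ν) + f * Aconst n ν * (2 * Real.cos (π * ν)) * s ^ ν
      + (f * Aconst n ν) ^ 2) ≤ s ^ ν / (s ^ ν * Real.sin (π * ν)) ^ 2 := by
    gcongr
  unfold spectralDensity
  calc _ ≤ 2 * Aconst n ν * Real.sin (π * ν) * (s ^ ν / (s ^ ν * Real.sin (π * ν)) ^ 2) := by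
        gcongr
    _ = _ := by
        rw [Real.rpow_neg hs.le]
        field_simp

theorem measurable_spectralDensity (n : ℕ) (ν f : ℝ) : Measurable (spectralDensity n ν f) := by
  unfold spectralDensity
  fun_prop

theorem continuous_negSq {n : ℕ} : Continuous (negSq : Mink n → ℝ) := by
  unfold negSq
  fun_prop

theorem isOpen_cone (n : ℕ) : IsOpen {p : Mink n | ‖p.2‖ < p.1} :=
  isOpen_lt (by fun_prop) (by fun_prop)

theorem measurable_wightmanDensity (n : ℕ) (ν f : ℝ) : Measurable (wightmanDensity n ν f) := by
  have : wightmanDensity n ν f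
      = fun p => if ‖p.2‖ < p.1 then spectralDensity n ν f (negSq p) else 0 := rfl
  rw [this]
  exact Measurable.ite (isOpen_cone n).measurableSet
    ((measurable_spectralDensity n ν f).comp continuous_negSq.measurable) measurable_const

theorem negSq_pos {n : ℕ} {p : Mink n} (hp : ‖p.2‖ < p.1) : 0 < negSq p := by
  unfold negSq
  nlinarith [norm_nonneg p.2]

theorem wightmanDensity_nonneg {n : ℕ} (hn : 1 ≤ n) {ν : ℝ} (hν : ν ∈ Ioo (0 : ℝ) 1) (f : ℝ)
    (p : Mink n) : 0 ≤ wightmanDensity n ν f p := by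
  rw [wightmanDensity_eq_ite]
  split_ifs with h
  · exact (spectralDensity_pos hn hν f (negSq_pos h)).le
  · exact le_rfl

/-! ### Mass-shell coordinates on the forward cone -/

theorem energy_pos {n : ℕ} (k : EuclideanSpace ℝ (Fin n)) {q : ℝ} (hq : 0 < q) :
    0 < energy k q := Real.sqrt_pos.2 (by positivity)

theorem energy_sq {n : ℕ} (k : EuclideanSpace ℝ (Fin n)) (q : ℝ) :
    energy k q ^ 2 = ‖k‖ ^ 2 + q ^ 2 := Real.sq_sqrt (by positivity)

theorem norm_lt_energy {n : ℕ} (k : EuclideanSpace ℝ (Fin n)) {q : ℝ} (hq : 0 < q) :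
    ‖k‖ < energy k q := Real.lt_sqrt_of_sq_lt (by nlinarith)

theorem le_energy {n : ℕ} (k : EuclideanSpace ℝ (Fin n)) (q : ℝ) :
    q ≤ energy k q := Real.le_sqrt_of_sq_le (by nlinarith [sq_nonneg ‖k‖])

theorem negSq_energy {n : ℕ} (k : EuclideanSpace ℝ (Fin n)) (q : ℝ) :
    negSq (energy k q, k) = q ^ 2 := by
  simp only [negSq, energy_sq]
  ring

theorem continuous_energy {n : ℕ} :
    Continuous fun y : EuclideanSpace ℝ (Fin n) × ℝ => energy y.1 y.2 := by
  unfold energy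
  fun_prop

theorem hasDerivAt_energy {n : ℕ} (k : EuclideanSpace ℝ (Fin n)) {q : ℝ} (hq : 0 < q) :
    HasDerivAt (energy k) (q / energy k q) q := by
  have h : HasDerivAt (energy k) ((2 : ℕ) * q ^ (2 - 1) / (2 * energy k q)) q :=
    ((hasDerivAt_pow 2 q).const_add (‖k‖ ^ 2)).sqrt (by positivity)
  convert h using 1
  have := (energy_pos k hq).ne'
  field_simp
  push_cast
  ring

theorem image_energy {n : ℕ} (k : EuclideanSpace ℝ (Fin n)) :
    energy k '' Ioi 0 = Ioi ‖k‖ := by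
  ext w
  constructor
  · rintro ⟨q, hq, rfl⟩
    exact norm_lt_energy k hq
  · intro h
    have h' : ‖k‖ < w := h
    have hw : 0 < w := (norm_nonneg k).trans_lt h'
    refine ⟨√(w ^ 2 - ‖k‖ ^ 2), Real.sqrt_pos.2 (by nlinarith [norm_nonneg k]), ?_⟩
    unfold energy
    rw [Real.sq_sqrt (by nlinarith [norm_nonneg k]), add_sub_cancel, Real.sqrt_sq hw.le]

theorem injOn_energy {n : ℕ} (k : EuclideanSpace ℝ (Fin n)) : InjOn (energy k) (Ioi 0) := by
  intro a ha b hb h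
  have h2 : energy k a ^ 2 = energy k b ^ 2 := by rw [h]
  rw [energy_sq, energy_sq] at h2
  have h3 : a ^ 2 = b ^ 2 := by linarith
  exact (sq_eq_sq₀ (le_of_lt ha) (le_of_lt hb)).1 h3

/-- The map from mass-shell coordinates `(k, q)` to momenta `(√(|k|² + q²), k)`. -/
noncomputable def shell {n : ℕ} (y : EuclideanSpace ℝ (Fin n) × ℝ) : Mink n :=
  (energy y.1 y.2, y.1)

theorem continuous_shell {n : ℕ} : Continuous (shell (n := n)) :=
  continuous_energy.prodMk continuous_fst

/-- The domain `q > 0` of the mass-shell coordinates. -/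
def shellDomain (n : ℕ) : Set (EuclideanSpace ℝ (Fin n) × ℝ) := univ ×ˢ Ioi 0

theorem measurableSet_shellDomain (n : ℕ) : MeasurableSet (shellDomain n) :=
  MeasurableSet.univ.prod measurableSet_Ioi

/-- The Jacobian `q / E` of the mass-shell coordinates. -/
noncomputable def shellJacobian {n : ℕ} (y : EuclideanSpace ℝ (Fin n) × ℝ) : ℝ :=
  y.2 / energy y.1 y.2

theorem measurable_shellJacobian {n : ℕ} : Measurable (shellJacobian (n := n)) :=
  measurable_snd.div continuous_energy.measurable

theorem measurable_ofReal_shellJacobian {n : ℕ} :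
    Measurable fun y : EuclideanSpace ℝ (Fin n) × ℝ => ENNReal.ofReal (shellJacobian y) :=
  ENNReal.measurable_ofReal.comp measurable_shellJacobian

/-- Change of variable `ω = √(|k|² + q²)` in each fibre of fixed `k`. Working with nonnegative
functions yields an identity of measures (`map_shell`), from which both integrability and values of
complex integrals transfer. -/
theorem lintegral_cone {n : ℕ} {F : Mink n → ℝ≥0∞} (hF : Measurable F) :
    ∫⁻ p in {p : Mink n | ‖p.2‖ < p.1}, F p
      = ∫⁻ y in shellDomain n, ENNReal.ofReal (shellJacobian y) * F (shell y) := by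
  have hC := (isOpen_cone n).measurableSet
  rw [← lintegral_indicator hC, ← lintegral_indicator (measurableSet_shellDomain n)]
  rw [Measure.volume_eq_prod, lintegral_prod_symm' _ (hF.indicator hC),
    Measure.volume_eq_prod, lintegral_prod _ (Measurable.aemeasurable ?_)]
  swap
  · exact Measurable.indicator
      (measurable_ofReal_shellJacobian.mul
        (hF.comp continuous_shell.measurable)) (measurableSet_shellDomain n)
  refine lintegral_congr fun k => ?_
  have e1 : ∫⁻ w, {p : Mink n | ‖p.2‖ < p.1}.indicator F (w, k)
      = ∫⁻ w in Ioi ‖k‖, F (w, k) := by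
    rw [← lintegral_indicator measurableSet_Ioi]
    rfl
  have e2 : ∫⁻ q, (shellDomain n).indicator
        (fun y => ENNReal.ofReal (shellJacobian y) * F (shell y)) (k, q)
      = ∫⁻ q in Ioi 0, ENNReal.ofReal (shellJacobian (k, q)) * F (shell (k, q)) := by
    rw [← lintegral_indicator measurableSet_Ioi]
    refine lintegral_congr fun q => ?_
    simp only [indicator, shellDomain, mem_prod, mem_univ, true_and]
  rw [e1, e2, ← image_energy k,
    lintegral_image_eq_lintegral_abs_deriv_mul measurableSet_Ioi
      (fun q hq => (hasDerivAt_energy k hq).hasDerivWithinAt) (injOn_energy k)]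
  refine setLIntegral_congr_fun measurableSet_Ioi fun q hq => ?_
  have : 0 ≤ q / energy k q := div_nonneg (le_of_lt hq) (energy_pos k hq).le
  simp only [abs_of_nonneg this]
  rfl

theorem map_shell (n : ℕ) :
    (((volume : Measure (EuclideanSpace ℝ (Fin n) × ℝ)).restrict (shellDomain n)).withDensity
      fun y => ENNReal.ofReal (shellJacobian y)).map shell
      = (volume : Measure (Mink n)).restrict {p : Mink n | ‖p.2‖ < p.1} := by
  refine Measure.ext_of_lintegral _ fun F hF => ?_
  rw [lintegral_map hF continuous_shell.measurable, lintegral_cone hF,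
    lintegral_withDensity_eq_lintegral_mul _ measurable_ofReal_shellJacobian
      (g := fun y => F (shell y)) (hF.comp continuous_shell.measurable)]
  rfl

theorem shellJacobian_nonneg {n : ℕ} {y : EuclideanSpace ℝ (Fin n) × ℝ}
    (hy : y ∈ shellDomain n) : 0 ≤ shellJacobian y :=
  div_nonneg (le_of_lt hy.2) (Real.sqrt_nonneg _)

theorem integrableOn_cone_iff {n : ℕ} {F : Mink n → ℂ} (hF : Measurable F) :
    IntegrableOn F {p : Mink n | ‖p.2‖ < p.1}
      ↔ IntegrableOn (fun y => (shellJacobian y : ℂ) * F (shell y)) (shellDomain n) := by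
  have hFm : AEStronglyMeasurable F
      ((((volume : Measure (EuclideanSpace ℝ (Fin n) × ℝ)).restrict
        (shellDomain n)).withDensity fun y => ENNReal.ofReal (shellJacobian y)).map shell) :=
    hF.aestronglyMeasurable
  rw [IntegrableOn, ← map_shell,
    integrable_map_measure hFm continuous_shell.measurable.aemeasurable, integrable_withDensity_iff_integrable_smul'
      measurable_ofReal_shellJacobian (by simp), IntegrableOn]
  refine integrable_congr ?_
  filter_upwards [ae_restrict_mem (measurableSet_shellDomain n)] with y hy
  rw [ENNReal.toReal_ofReal (shellJacobian_nonneg hy), Complex.real_smul]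
  rfl

theorem setIntegral_cone {n : ℕ} {F : Mink n → ℂ} (hF : Measurable F) :
    ∫ p in {p : Mink n | ‖p.2‖ < p.1}, F p
      = ∫ y in shellDomain n, (shellJacobian y : ℂ) * F (shell y) := by
  rw [← map_shell, integral_map continuous_shell.measurable.aemeasurable
    hF.aestronglyMeasurable]
  rw [integral_withDensity_eq_integral_toReal_smul
    measurable_ofReal_shellJacobian (by simp)]
  refine setIntegral_congr_fun (measurableSet_shellDomain n) fun y hy => ?_
  simp only [ENNReal.toReal_ofReal (shellJacobian_nonneg hy), Complex.real_smul]

/-- On the shell `-p² = q²`, so in these coordinates the density depends on `q` alone. -/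
theorem integrable_wightmanDensity_mul_iff {n : ℕ} {ν f : ℝ} {G : Mink n → ℂ}
    (hG : Measurable G) :
    Integrable (fun p => (wightmanDensity n ν f p : ℂ) * G p)
      ↔ IntegrableOn (fun y => ((spectralDensity n ν f (y.2 ^ 2) * shellJacobian y : ℝ) : ℂ)
          * G (shell y)) (shellDomain n) := by
  have h0 : (fun p => (wightmanDensity n ν f p : ℂ) * G p)
      = {p : Mink n | ‖p.2‖ < p.1}.indicator
          fun p => (spectralDensity n ν f (negSq p) : ℂ) * G p := by
    ext p
    by_cases h : ‖p.2‖ < p.1 <;> simp [wightmanDensity_eq_ite, indicator, h]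
  have hm : Measurable fun p : Mink n => (spectralDensity n ν f (negSq p) : ℂ) * G p :=
    (Complex.measurable_ofReal.comp
      ((measurable_spectralDensity n ν f).comp continuous_negSq.measurable)).mul hG
  rw [h0, integrable_indicator_iff (isOpen_cone n).measurableSet, integrableOn_cone_iff hm]
  refine integrableOn_congr_fun (fun y hy => ?_) (measurableSet_shellDomain n)
  simp only [shell, negSq_energy]
  push_cast
  ring

theorem integral_wightmanDensity_mul {n : ℕ} {ν f : ℝ} {G : Mink n → ℂ} (hG : Measurable G) :
    ∫ p, (wightmanDensity n ν f p : ℂ) * G p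
      = ∫ y in shellDomain n, ((spectralDensity n ν f (y.2 ^ 2) * shellJacobian y : ℝ) : ℂ)
          * G (shell y) := by
  have h0 : (fun p => (wightmanDensity n ν f p : ℂ) * G p)
      = {p : Mink n | ‖p.2‖ < p.1}.indicator
          fun p => (spectralDensity n ν f (negSq p) : ℂ) * G p := by
    ext p
    by_cases h : ‖p.2‖ < p.1 <;> simp [wightmanDensity_eq_ite, indicator, h]
  have hm : Measurable fun p : Mink n => (spectralDensity n ν f (negSq p) : ℂ) * G p :=
    (Complex.measurable_ofReal.comp
      ((measurable_spectralDensity n ν f).comp continuous_negSq.measurable)).mul hG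
  rw [h0, integral_indicator (isOpen_cone n).measurableSet, setIntegral_cone hm]
  refine setIntegral_congr_fun (measurableSet_shellDomain n) (fun y hy => ?_)
  simp only [shell, negSq_energy]
  push_cast
  ring

/-! ### Integrability against the spectral density -/

theorem integrableOn_rpow_neg_mul {ν : ℝ} (hν : ν ∈ Ioo (0 : ℝ) 1) :
    IntegrableOn (fun y : ℝ => y ^ (-ν) * ((1 + y) ^ 2)⁻¹) (Ioi 0) := by
  rw [← Ioc_union_Ioi_eq_Ioi (zero_le_one' ℝ)]
  have hm : Measurable fun y : ℝ => y ^ (-ν) * ((1 + y) ^ 2)⁻¹ := by fun_prop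
  refine IntegrableOn.union ?_ ?_
  · have h1 : IntegrableOn (fun y : ℝ => y ^ (-ν)) (Ioc 0 1) :=
      (intervalIntegrable_iff_integrableOn_Ioc_of_le zero_le_one).1
        (intervalIntegral.intervalIntegrable_rpow' (by linarith [hν.2]))
    refine Integrable.mono' h1 hm.aestronglyMeasurable ?_
    filter_upwards [ae_restrict_mem measurableSet_Ioc] with y hy
    have hy0 : 0 < y := hy.1
    rw [Real.norm_of_nonneg (by positivity)]
    exact mul_le_of_le_one_right (by positivity) (inv_le_one_of_one_le₀ (by nlinarith))
  · have h1 : IntegrableOn (fun y : ℝ => y ^ (-2 : ℝ)) (Ioi 1) :=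
      integrableOn_Ioi_rpow_of_lt (by norm_num) one_pos
    refine Integrable.mono' h1 hm.aestronglyMeasurable ?_
    filter_upwards [ae_restrict_mem measurableSet_Ioi] with y hy
    have hy1 : 1 < y := hy
    have hy0 : 0 < y := one_pos.trans hy1
    rw [Real.norm_of_nonneg (by positivity), Real.rpow_neg hy0.le (2 : ℝ), Real.rpow_two]
    calc y ^ (-ν) * ((1 + y) ^ 2)⁻¹ ≤ 1 * (y ^ 2)⁻¹ := by
          gcongr
          · exact Real.rpow_le_one_of_one_le_of_nonpos hy1.le (by linarith [hν.1])
          · linarith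
      _ = _ := one_mul _

/-- In polar coordinates the surface factor `y^(n-1)` is absorbed by `n - 1` of the `n + 1` decaying
powers, leaving the one-dimensional integral. -/
theorem integrable_norm_rpow_neg_mul {n : ℕ} (hn : 1 ≤ n) {ν : ℝ} (hν : ν ∈ Ioo (0 : ℝ) 1) :
    Integrable fun k : EuclideanSpace ℝ (Fin n) => ‖k‖ ^ (-ν) * ((1 + ‖k‖) ^ (n + 1))⁻¹ := by
  have : Nonempty (Fin n) := ⟨⟨0, hn⟩⟩
  rw [integrable_fun_norm_addHaar volume (f := fun y : ℝ => y ^ (-ν) * ((1 + y) ^ (n + 1))⁻¹)]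
  refine Integrable.mono' (integrableOn_rpow_neg_mul hν)
    (by fun_prop) ?_
  filter_upwards [ae_restrict_mem measurableSet_Ioi] with y hy
  have hy0 : 0 < y := hy
  rw [finrank_euclideanSpace_fin, smul_eq_mul, Real.norm_of_nonneg (by positivity)]
  obtain ⟨m, rfl⟩ : ∃ m, n = m + 1 := ⟨n - 1, by omega⟩
  rw [Nat.add_sub_cancel]
  calc y ^ m * (y ^ (-ν) * ((1 + y) ^ (m + 1 + 1))⁻¹)
      ≤ (1 + y) ^ m * (y ^ (-ν) * ((1 + y) ^ (m + 1 + 1))⁻¹) := by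
        gcongr
        linarith
    _ = y ^ (-ν) * ((1 + y) ^ 2)⁻¹ := by
        rw [show m + 1 + 1 = m + 2 by ring, pow_add]
        field_simp

/-- A weighted geometric mean of `q` and `|k|`, both at most `E`. -/
theorem rpow_mul_rpow_le_energy {n : ℕ} {ν : ℝ} (hν : ν ∈ Ioo (0 : ℝ) 1)
    (k : EuclideanSpace ℝ (Fin n)) {q : ℝ} (hq : 0 < q) :
    q ^ (1 - ν) * ‖k‖ ^ ν ≤ energy k q := by
  have hE := energy_pos k hq
  calc q ^ (1 - ν) * ‖k‖ ^ ν ≤ energy k q ^ (1 - ν) * energy k q ^ ν := by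
        gcongr
        · linarith [hν.2]
        · exact le_energy k q
        · exact hν.1.le
        · exact (norm_lt_energy k hq).le
    _ = energy k q := by
        rw [← Real.rpow_add hE, sub_add_cancel, Real.rpow_one]

/-- The factor `1 / E` is shared between the variables so that the bound is a product, with the
exponent `-ν > -1` in each; this is locally integrable even for `n = 1`. -/
theorem spectralDensity_mul_shellJacobian_le {n : ℕ} (hn : 1 ≤ n) {ν : ℝ}
    (hν : ν ∈ Ioo (0 : ℝ) 1) (f : ℝ) {k : EuclideanSpace ℝ (Fin n)} (hk : k ≠ 0) {q : ℝ}
    (hq : 0 < q) :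
    spectralDensity n ν f (q ^ 2) * (q / energy k q)
      ≤ 2 * Aconst n ν / Real.sin (π * ν) * (q ^ (-ν) * ‖k‖ ^ (-ν)) := by
  have hE := energy_pos k hq
  have hk0 : 0 < ‖k‖ := norm_pos_iff.2 hk
  have hA := Aconst_pos hn hν
  have hs := sin_pi_mul_pos hν
  have h1 : (q ^ 2) ^ (-ν) * q = q ^ (-ν) * q ^ (1 - ν) := by
    rw [← Real.rpow_add hq, ← Real.rpow_natCast, ← Real.rpow_mul hq.le,
      ← Real.rpow_add_one hq.ne']
    congr 1
    push_cast
    ring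
  calc spectralDensity n ν f (q ^ 2) * (q / energy k q)
      ≤ 2 * Aconst n ν / Real.sin (π * ν) * (q ^ 2) ^ (-ν) * (q / energy k q) := by
        gcongr
        exact spectralDensity_le hn hν f (by positivity)
    _ = 2 * Aconst n ν / Real.sin (π * ν) * (q ^ (-ν) * (q ^ (1 - ν) / energy k q)) := by
        rw [mul_assoc, mul_div_assoc', h1]
        ring
    _ ≤ _ := by
        gcongr
        rw [div_le_iff₀ hE, Real.rpow_neg hk0.le, inv_mul_eq_div, le_div_iff₀ (by positivity)]
        exact rpow_mul_rpow_le_energy hν k hq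

theorem ae_fst_ne_zero {n : ℕ} (hn : 1 ≤ n) :
    ∀ᵐ y : EuclideanSpace ℝ (Fin n) × ℝ, y.1 ≠ 0 := by
  have : Nonempty (Fin n) := ⟨⟨0, hn⟩⟩
  have h : ∀ᵐ k : EuclideanSpace ℝ (Fin n), k ≠ 0 := by simp [ae_iff]
  exact Measure.quasiMeasurePreserving_fst.ae h

/-- The reference majorant for integrals against the spectral density. -/
theorem integrableOn_shell_majorant {n : ℕ} (hn : 1 ≤ n) {ν : ℝ} (hν : ν ∈ Ioo (0 : ℝ) 1) :
    IntegrableOn (fun y : EuclideanSpace ℝ (Fin n) × ℝ =>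
      (‖y.1‖ ^ (-ν) * ((1 + ‖y.1‖) ^ (n + 1))⁻¹) * (y.2 ^ (-ν) * ((1 + y.2) ^ 2)⁻¹))
      (shellDomain n) := by
  have h := Integrable.mul_prod (integrable_norm_rpow_neg_mul hn hν)
    (integrableOn_rpow_neg_mul hν)
  rw [IntegrableOn, shellDomain, Measure.volume_eq_prod, ← Measure.prod_restrict,
    Measure.restrict_univ]
  exact h

/-- The decay exponent is `n + 3 = (n + 1) + 2`: since `E` dominates both `|k|` and `q`, `n + 1`
powers go to the `k` integral and two to the `q` integral. -/
theorem integrable_wightmanDensity_mul {n : ℕ} (hn : 1 ≤ n) {ν : ℝ} (hν : ν ∈ Ioo (0 : ℝ) 1)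
    (f : ℝ) {G : Mink n → ℂ} (hG : Measurable G) (C : ℝ)
    (hb : ∀ p : Mink n, ‖p.2‖ < p.1 → ‖G p‖ ≤ C * ((1 + p.1) ^ (n + 3))⁻¹) :
    Integrable fun p => (wightmanDensity n ν f p : ℂ) * G p := by
  rw [integrable_wightmanDensity_mul_iff hG]
  refine Integrable.mono' (((integrableOn_shell_majorant hn hν).const_mul
    (2 * Aconst n ν / Real.sin (π * ν) * C)))
    (Measurable.aestronglyMeasurable ?_) ?_
  · exact (Complex.measurable_ofReal.comp
      (((measurable_spectralDensity n ν f).comp (measurable_snd.pow_const 2)).mul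
        measurable_shellJacobian)).mul (hG.comp continuous_shell.measurable)
  filter_upwards [ae_restrict_mem (measurableSet_shellDomain n),
    ae_restrict_of_ae (ae_fst_ne_zero hn)] with y hy hk
  have hq : 0 < y.2 := hy.2
  have hE := energy_pos y.1 hq
  have hA := Aconst_pos hn hν
  have hs := sin_pi_mul_pos hν
  have hρ := spectralDensity_pos hn hν f (s := y.2 ^ 2) (by positivity)
  have hG1 := hb (shell y) (norm_lt_energy y.1 hq)
  have hC : 0 ≤ C := by
    have h0 : 0 ≤ C * ((1 + energy y.1 y.2) ^ (n + 3))⁻¹ := (norm_nonneg _).trans hG1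
    exact nonneg_of_mul_nonneg_left h0 (by positivity)
  have hpow : ((1 + energy y.1 y.2) ^ (n + 3))⁻¹
      ≤ ((1 + ‖y.1‖) ^ (n + 1))⁻¹ * ((1 + y.2) ^ 2)⁻¹ := by
    rw [← mul_inv, show n + 3 = (n + 1) + 2 by ring, pow_add]
    gcongr
    · exact (norm_lt_energy y.1 hq).le
    · exact le_energy y.1 y.2
  rw [norm_mul, Complex.norm_real, Real.norm_of_nonneg
    (mul_nonneg hρ.le (shellJacobian_nonneg hy))]
  calc spectralDensity n ν f (y.2 ^ 2) * shellJacobian y * ‖G (shell y)‖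
      ≤ (2 * Aconst n ν / Real.sin (π * ν) * (y.2 ^ (-ν) * ‖y.1‖ ^ (-ν)))
        * (C * (((1 + ‖y.1‖) ^ (n + 1))⁻¹ * ((1 + y.2) ^ 2)⁻¹)) := by
        refine mul_le_mul (spectralDensity_mul_shellJacobian_le hn hν f hk hq)
          (hG1.trans ?_) (norm_nonneg _) (by positivity)
        exact mul_le_mul_of_nonneg_left hpow hC
    _ = _ := by ring

/-! ### The dispersion relation of `1 / (u ^ ν + a)` -/

/-- The function `1 / (z ^ ν + a)` in the logarithmic coordinate `z = exp w`. -/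
noncomputable def logPropagator (ν a : ℝ) (w : ℂ) : ℂ := (Complex.exp (ν * w) + a)⁻¹

/-- A zero would have `sin (im w) = 0`, hence `im w = 0`, and then `exp w > 0` contradicts `a ≥ 0`.
This is the absence of tachyon poles. -/
theorem exp_add_ne_zero {a : ℝ} (ha : 0 ≤ a) {w : ℂ} (hw : |w.im| < π) :
    Complex.exp w + a ≠ 0 := by
  intro h
  have him := congrArg Complex.im h
  have hre := congrArg Complex.re h
  simp only [Complex.add_im, Complex.exp_im, Complex.ofReal_im, add_zero, Complex.zero_im,
    mul_eq_zero, (Real.exp_pos w.re).ne', false_or] at him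
  rw [Real.sin_eq_zero_iff_of_lt_of_lt (abs_lt.1 hw).1 (abs_lt.1 hw).2] at him
  simp only [Complex.add_re, Complex.exp_re, Complex.ofReal_re, him, Real.cos_zero, mul_one,
    Complex.zero_re] at hre
  linarith [Real.exp_pos w.re]

/-- In the closed strip `cos (ν im w) ≥ cos (πν)`, and `a ≥ 0`, so the denominator is smallest on
the edges, where `sq_mul_sin_sq_le` applies. -/
theorem norm_logPropagator_le {ν : ℝ} (hν : ν ∈ Ioo (0 : ℝ) 1) {a : ℝ} (ha : 0 ≤ a) {w : ℂ}
    (hw : |w.im| ≤ π) :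
    ‖logPropagator ν a w‖ ≤ Real.exp (-(ν * w.re)) / Real.sin (π * ν) := by
  have hs := sin_pi_mul_pos hν
  set t := Real.exp (ν * w.re) with ht
  have ht0 : 0 < t := Real.exp_pos _
  have hcos : Real.cos (π * ν) ≤ Real.cos (ν * w.im) := by
    rw [← Real.cos_abs (ν * w.im), abs_mul, abs_of_pos hν.1, mul_comm π]
    refine Real.cos_le_cos_of_nonneg_of_le_pi (mul_nonneg hν.1.le (abs_nonneg _))
      (by nlinarith [pi_pos, hν.2]) (mul_le_mul_of_nonneg_left hw hν.1.le)
  have h1 : (t * Real.sin (π * ν)) ^ 2 ≤ ‖Complex.exp (ν * w) + a‖ ^ 2 := by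
    rw [← Complex.normSq_eq_norm_sq, Complex.normSq_apply]
    simp only [Complex.add_re, Complex.add_im, Complex.exp_re, Complex.exp_im, Complex.ofReal_re,
      Complex.ofReal_im, Complex.re_ofReal_mul, Complex.im_ofReal_mul, add_zero, ← ht]
    have h2 := sq_mul_sin_sq_le t a (π * ν)
    have h3 := mul_le_mul_of_nonneg_left hcos (mul_nonneg ha ht0.le)
    nlinarith [Real.sin_sq_add_cos_sq (ν * w.im)]
  have h2 : t * Real.sin (π * ν) ≤ ‖Complex.exp (ν * w) + a‖ :=
    (sq_le_sq₀ (by positivity) (norm_nonneg _)).1 h1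
  rw [logPropagator, norm_inv, Real.exp_neg, ← ht, div_eq_mul_inv, ← mul_inv]
  exact inv_anti₀ (by positivity) h2

/-- The integrand of the dispersion relation, with the pole at `w₀` removed. -/
noncomputable def dispersionIntegrand (ν a : ℝ) (w₀ w : ℂ) : ℂ :=
  dslope (logPropagator ν a) w₀ w / dslope Complex.exp w₀ w * Complex.exp w

/-- The factors `w - w₀` of the two difference quotients cancel. With `z = exp w` this is `(g(z) -
g(z₀)) dz / (z - z₀)`, where `g` is the propagator: subtracting the value at `z₀` removes the pole.
-/
theorem dispersionIntegrand_of_ne (ν a : ℝ) {w₀ w : ℂ} (hw : w ≠ w₀) :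
    dispersionIntegrand ν a w₀ w = (logPropagator ν a w - logPropagator ν a w₀)
      * (Complex.exp w / (Complex.exp w - Complex.exp w₀)) := by
  have h := sub_ne_zero.2 hw
  rw [dispersionIntegrand, dslope_of_ne _ hw, dslope_of_ne _ hw, slope_def_field, slope_def_field,
    div_div_div_cancel_right₀ h]
  ring

/-- The width `π / ν` keeps the propagator free of poles, and `2π` keeps `exp w = exp x₀` from
having a solution other than `x₀`. Both exceed `π`, so the closed strip `|im w| ≤ π` lies inside. -/
theorem differentiableOn_dispersionIntegrand {ν : ℝ} (hν : ν ∈ Ioo (0 : ℝ) 1) {a : ℝ}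
    (ha : 0 ≤ a) (x₀ : ℝ) :
    DifferentiableOn ℂ (dispersionIntegrand ν a x₀) {w : ℂ | |w.im| < min (π / ν) (2 * π)} := by
  have hpos : 0 < min (π / ν) (2 * π) := lt_min (div_pos pi_pos hν.1) (by positivity)
  have hU : {w : ℂ | |w.im| < min (π / ν) (2 * π)} ∈ 𝓝 (x₀ : ℂ) := by
    refine (isOpen_lt (by fun_prop) continuous_const).mem_nhds ?_
    simpa using hpos
  have hg : DifferentiableOn ℂ (logPropagator ν a) {w : ℂ | |w.im| < min (π / ν) (2 * π)} := by
    intro w hw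
    refine DifferentiableAt.differentiableWithinAt (DifferentiableAt.inv (by fun_prop) ?_)
    refine exp_add_ne_zero ha ?_
    rw [Complex.im_ofReal_mul, abs_mul, abs_of_pos hν.1]
    have := (lt_div_iff₀ hν.1).1 (lt_of_lt_of_le hw (min_le_left _ _))
    linarith
  have hE : DifferentiableOn ℂ Complex.exp {w : ℂ | |w.im| < min (π / ν) (2 * π)} :=
    Complex.differentiable_exp.differentiableOn
  refine DifferentiableOn.mul (DifferentiableOn.div
    ((Complex.differentiableOn_dslope hU).2 hg) ((Complex.differentiableOn_dslope hU).2 hE) ?_) hE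
  intro w hw
  by_cases h : w = x₀
  · rw [h, dslope_same, Complex.deriv_exp]
    exact Complex.exp_ne_zero _
  · rw [dslope_of_ne _ h, slope_def_field]
    refine div_ne_zero (sub_ne_zero.2 fun he => h ?_) (sub_ne_zero.2 h)
    obtain ⟨m, hm⟩ := Complex.exp_eq_exp_iff_exists_int.1 he
    have him := congrArg Complex.im hm
    have hmv : w.im = m * (2 * π) := by simpa using him
    have hlt : |w.im| < 2 * π := lt_of_lt_of_le hw (min_le_right _ _)
    rw [hmv, abs_mul, abs_of_pos (by positivity : (0 : ℝ) < 2 * π)] at hlt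
    have h1 : |(m : ℝ)| < 1 := by
      by_contra hc
      nlinarith [pi_pos]
    have h2 : m = 0 := by
      have : |m| < 1 := by exact_mod_cast h1
      exact Int.abs_lt_one_iff.1 this
    rw [hm, h2]
    simp

theorem exp_add_pi_mul_I (x : ℝ) : Complex.exp (x + π * Complex.I) = -(Real.exp x : ℂ) := by
  rw [Complex.exp_add, Complex.exp_pi_mul_I]
  push_cast
  ring

theorem exp_add_neg_pi_mul_I (x : ℝ) :
    Complex.exp (x + (-π : ℝ) * Complex.I) = -(Real.exp x : ℂ) := by
  rw [Complex.exp_add, Complex.ofReal_neg, neg_mul, Complex.exp_neg_pi_mul_I]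
  push_cast
  ring

/-- With `t = exp(νx)` the two values are `1 / (t exp(∓iπν) + a)`. Their denominators are conjugate,
so the difference is `2i t sin(πν)` over a squared modulus. -/
theorem logPropagator_jump {ν : ℝ} (hν : ν ∈ Ioo (0 : ℝ) 1) {a : ℝ} (ha : 0 ≤ a) (x : ℝ) :
    logPropagator ν a (x + (-π : ℝ) * Complex.I) - logPropagator ν a (x + π * Complex.I)
      = 2 * Complex.I * Real.sin (π * ν) * ((Real.exp (ν * x) / (Real.exp (ν * x) ^ 2
        + a * (2 * Real.cos (π * ν)) * Real.exp (ν * x) + a ^ 2) : ℝ) : ℂ) := by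
  have hb : π * ν < π := by nlinarith [pi_pos, hν.2]
  have hp : 0 < π * ν := mul_pos pi_pos hν.1
  have e1 : Complex.exp (ν * (x + (-π : ℝ) * Complex.I))
      = Real.exp (ν * x) * (Real.cos (π * ν) - Real.sin (π * ν) * Complex.I) := by
    rw [show (ν : ℂ) * (x + (-π : ℝ) * Complex.I)
        = ((ν * x : ℝ) : ℂ) + ((-(π * ν) : ℝ) : ℂ) * Complex.I by push_cast; ring,
      Complex.exp_add, Complex.exp_mul_I, ← Complex.ofReal_cos, ← Complex.ofReal_sin,
      Real.cos_neg, Real.sin_neg]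
    push_cast
    ring
  have e2 : Complex.exp (ν * (x + π * Complex.I))
      = Real.exp (ν * x) * (Real.cos (π * ν) + Real.sin (π * ν) * Complex.I) := by
    rw [show (ν : ℂ) * (x + π * Complex.I)
        = ((ν * x : ℝ) : ℂ) + ((π * ν : ℝ) : ℂ) * Complex.I by push_cast; ring,
      Complex.exp_add, Complex.exp_mul_I, ← Complex.ofReal_cos, ← Complex.ofReal_sin]
    push_cast
    ring
  have n1 : Complex.exp (ν * (x + (-π : ℝ) * Complex.I)) + a ≠ 0 := by
    refine exp_add_ne_zero ha ?_
    simp only [Complex.im_ofReal_mul, Complex.add_im, Complex.ofReal_im, zero_add,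
      Complex.I_im, mul_one]
    rw [show ν * -π = -(π * ν) by ring, abs_neg, abs_of_pos hp]
    exact hb
  have n2 : Complex.exp (ν * (x + π * Complex.I)) + a ≠ 0 := by
    refine exp_add_ne_zero ha ?_
    simp only [Complex.im_ofReal_mul, Complex.add_im, Complex.ofReal_im, zero_add,
      Complex.I_im, mul_one]
    rw [mul_comm, abs_of_pos hp]
    exact hb
  have n3 : Real.exp (ν * x) ^ 2 + a * (2 * Real.cos (π * ν)) * Real.exp (ν * x) + a ^ 2 ≠ 0 := by
    have h1 := sq_mul_sin_sq_le (Real.exp (ν * x)) a (π * ν)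
    have h2 := sin_pi_mul_pos hν
    have h3 : 0 < Real.exp (ν * x) ^ 2 * Real.sin (π * ν) ^ 2 := by positivity
    exact (h3.trans_le h1).ne'
  unfold logPropagator
  rw [inv_sub_inv n1 n2, Complex.ofReal_div, mul_div_assoc',
    div_eq_div_iff (mul_ne_zero n1 n2) (by exact_mod_cast n3), e1, e2]
  have hsc : (Real.sin (π * ν) : ℂ) ^ 2 = 1 - (Real.cos (π * ν) : ℂ) ^ 2 := by
    rw [eq_sub_iff_add_eq]
    exact_mod_cast Real.sin_sq_add_cos_sq (π * ν)
  generalize (Real.sin (π * ν)) = S at *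
  generalize (Real.cos (π * ν)) = C at *
  generalize Real.exp (ν * x) = t at *
  push_cast
  have hI : Complex.I ^ 2 = -1 := Complex.I_sq
  linear_combination (-(2 * Complex.I * S * t ^ 3)) * hsc
    + 2 * Complex.I * t ^ 3 * S ^ 3 * hI

/-- Cauchy's theorem on `[-L, L] × [-π, π]`. On both horizontal edges `exp w` takes the same value
`-exp x`, so the subtracted constant cancels and only the jump remains. The right edge contributes
the value at `u`, the left edge nothing. -/
theorem integral_dispersion {ν : ℝ} (hν : ν ∈ Ioo (0 : ℝ) 1) {a : ℝ} (ha : 0 ≤ a) {u : ℝ}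
    (hu : 0 < u)
    (hint : Integrable fun x : ℝ => Real.exp (ν * x) / (Real.exp (ν * x) ^ 2
        + a * (2 * Real.cos (π * ν)) * Real.exp (ν * x) + a ^ 2)
          * (Real.exp x / (Real.exp x + u))) :
    Real.sin (π * ν) * ∫ x : ℝ, Real.exp (ν * x) / (Real.exp (ν * x) ^ 2
        + a * (2 * Real.cos (π * ν)) * Real.exp (ν * x) + a ^ 2)
          * (Real.exp x / (Real.exp x + u)) = π * (u ^ ν + a)⁻¹ := by
  set h : ℝ → ℝ := fun x : ℝ => Real.exp (ν * x) / (Real.exp (ν * x) ^ 2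
        + a * (2 * Real.cos (π * ν)) * Real.exp (ν * x) + a ^ 2)
          * (Real.exp x / (Real.exp x + u)) with hh
  set x₀ : ℝ := Real.log u with hx₀
  have hex₀ : Complex.exp (x₀ : ℂ) = u := by
    rw [← Complex.ofReal_exp, hx₀, Real.exp_log hu]
  set F := dispersionIntegrand ν a x₀ with hF
  set g₀ := logPropagator ν a x₀ with hg₀
  have hg₀v : g₀ = (((u ^ ν + a)⁻¹ : ℝ) : ℂ) := by
    rw [hg₀, logPropagator, show (ν : ℂ) * x₀ = ((x₀ * ν : ℝ) : ℂ) by push_cast; ring,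
      ← Complex.ofReal_exp, hx₀, ← Real.rpow_def_of_pos hu]
    push_cast
    rfl
  have hs := sin_pi_mul_pos hν
  have hstrip : π < min (π / ν) (2 * π) := by
    refine lt_min ?_ (by linarith [pi_pos])
    rw [lt_div_iff₀ hν.1]
    nlinarith [pi_pos, hν.2]
  have hrect : ∀ L : ℝ, (∫ x : ℝ in (-L)..L, F (x + (-π : ℝ) * Complex.I))
      - (∫ x : ℝ in (-L)..L, F (x + π * Complex.I))
      + Complex.I * (∫ y : ℝ in (-π)..π, F (L + y * Complex.I))
      - Complex.I * (∫ y : ℝ in (-π)..π, F ((-L : ℝ) + y * Complex.I)) = 0 := by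
    intro L
    have := Complex.integral_boundary_rect_eq_zero_of_differentiableOn F
      (⟨-L, -π⟩ : ℂ) (⟨L, π⟩ : ℂ) ((differentiableOn_dispersionIntegrand hν ha x₀).mono ?_)
    · simpa only [smul_eq_mul] using this
    · intro w hw
      have h2 : w.im ∈ uIcc (-π) π := hw.2
      rw [uIcc_of_le (by linarith [pi_pos])] at h2
      exact (abs_le.2 h2).trans_lt hstrip
  have hjump : ∀ x : ℝ, F (x + (-π : ℝ) * Complex.I) - F (x + π * Complex.I)
      = (2 * Complex.I * Real.sin (π * ν)) * (h x : ℂ) := by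
    intro x
    have m1 : (x : ℂ) + (-π : ℝ) * Complex.I ≠ x₀ := fun hc => by
      have := congrArg Complex.im hc
      simp [pi_ne_zero] at this
    have m2 : (x : ℂ) + π * Complex.I ≠ x₀ := fun hc => by
      have := congrArg Complex.im hc
      simp [pi_ne_zero] at this
    rw [hF, dispersionIntegrand_of_ne ν a m1, dispersionIntegrand_of_ne ν a m2,
      exp_add_pi_mul_I, exp_add_neg_pi_mul_I, hex₀, ← sub_mul, sub_sub_sub_cancel_right,
      logPropagator_jump hν ha, hh]
    have : -(Real.exp x : ℂ) / (-(Real.exp x : ℂ) - u)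
        = ((Real.exp x / (Real.exp x + u) : ℝ) : ℂ) := by
      rw [← neg_add', neg_div_neg_eq]
      push_cast
      rfl
    rw [this]
    push_cast
    ring
  have hcont : ∀ c : ℝ, |c| ≤ π → Continuous fun x : ℝ => F (x + c * Complex.I) := by
    intro c hc
    rw [continuous_iff_continuousAt]
    intro x
    have hmem : {w : ℂ | |w.im| < min (π / ν) (2 * π)} ∈ 𝓝 ((x : ℂ) + c * Complex.I) := by
      refine (isOpen_lt (by fun_prop) continuous_const).mem_nhds ?_
      simpa using hc.trans_lt hstrip
    have := ((differentiableOn_dispersionIntegrand hν ha x₀).differentiableAt hmem).continuousAt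
    exact ContinuousAt.comp (f := fun x : ℝ => (x : ℂ) + c * Complex.I) this (by fun_prop)
  have hhor : ∀ L : ℝ, (∫ x : ℝ in (-L)..L, F (x + (-π : ℝ) * Complex.I))
      - (∫ x : ℝ in (-L)..L, F (x + π * Complex.I))
      = (2 * Complex.I * Real.sin (π * ν)) * ((∫ x in (-L)..L, h x : ℝ) : ℂ) := by
    intro L
    rw [← intervalIntegral.integral_sub
      ((hcont (-π) (by rw [abs_neg, abs_of_pos pi_pos])).intervalIntegrable _ _)
      ((hcont π (by rw [abs_of_pos pi_pos])).intervalIntegrable _ _)]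
    simp only [hjump, intervalIntegral.integral_const_mul, intervalIntegral.integral_ofReal]
  have hlim1 : Tendsto (fun L : ℝ => (2 * Complex.I * Real.sin (π * ν))
      * ((∫ x in (-L)..L, h x : ℝ) : ℂ)) atTop
      (𝓝 ((2 * Complex.I * Real.sin (π * ν)) * ((∫ x, h x : ℝ) : ℂ))) :=
    ((Complex.continuous_ofReal.tendsto _).comp
      (intervalIntegral_tendsto_integral hint tendsto_neg_atTop_atBot tendsto_id)).const_mul _
  have hexp0 : ∀ c : ℝ, 0 < c → Tendsto (fun L : ℝ => Real.exp (-(c * L))) atTop (𝓝 0) :=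
    fun c hc => Real.tendsto_exp_neg_atTop_nhds_zero.comp (tendsto_id.const_mul_atTop hc)
  have hbounds : ∀ x y : ℝ, y ∈ Icc (-π) π →
      ‖logPropagator ν a (x + y * Complex.I)‖ ≤ Real.exp (-(ν * x)) / Real.sin (π * ν)
      ∧ ‖Complex.exp (x + y * Complex.I)‖ = Real.exp x
      ∧ |Real.exp x - u| ≤ ‖Complex.exp (x + y * Complex.I) - u‖ := by
    intro x y hy
    have e1 : ‖Complex.exp (x + y * Complex.I)‖ = Real.exp x := by
      rw [Complex.norm_exp]
      simp
    refine ⟨?_, e1, ?_⟩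
    · have := norm_logPropagator_le hν ha (w := x + y * Complex.I) (by simpa using abs_le.2 hy)
      simpa using this
    · have := abs_norm_sub_norm_le (Complex.exp (x + y * Complex.I)) (u : ℂ)
      rwa [e1, Complex.norm_real, Real.norm_of_nonneg hu.le] at this
  have hvert : ∀ c : ℝ, IntervalIntegrable (fun y : ℝ => F (c + y * Complex.I)) volume (-π) π := by
    intro c
    refine ContinuousOn.intervalIntegrable fun y hy => ?_
    rw [uIcc_of_le (by linarith [pi_pos])] at hy
    have hmem : {w : ℂ | |w.im| < min (π / ν) (2 * π)} ∈ 𝓝 ((c : ℂ) + y * Complex.I) := by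
      refine (isOpen_lt (by fun_prop) continuous_const).mem_nhds ?_
      simpa using (abs_le.2 hy).trans_lt hstrip
    have := ((differentiableOn_dispersionIntegrand hν ha x₀).differentiableAt hmem).continuousAt
    exact (ContinuousAt.comp (f := fun y : ℝ => (c : ℂ) + y * Complex.I) this
      (by fun_prop)).continuousWithinAt
  -- The propagator decays and `exp w / (exp w - u) → 1`, so `F → -g₀` uniformly on an edge of
  -- length `2π`.
  have hlim3 : Tendsto (fun L : ℝ => ∫ y : ℝ in (-π)..π, F (L + y * Complex.I)) atTop
      (𝓝 (-(2 * π * g₀))) := by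
    have hB : Tendsto (fun L : ℝ => (Real.exp (-(ν * L)) / Real.sin (π * ν)
        + ‖g₀‖ * u * Real.exp (-(1 * L))) / (1 - u * Real.exp (-(1 * L))) * |π - (-π)|) atTop
        (𝓝 0) := by
      have := (((((hexp0 ν hν.1).div_const (Real.sin (π * ν))).add
        ((hexp0 1 one_pos).const_mul (‖g₀‖ * u))).div
        ((tendsto_const_nhds (x := (1 : ℝ))).sub ((hexp0 1 one_pos).const_mul u))
        (by norm_num)).mul_const |π - (-π)|)
      simpa using this
    rw [tendsto_iff_norm_sub_tendsto_zero]
    refine squeeze_zero' (.of_forall fun L => norm_nonneg _) ?_ hB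
    filter_upwards [eventually_gt_atTop x₀] with L hL
    have hLu : u < Real.exp L := by
      rw [← Real.exp_log hu]
      exact Real.exp_lt_exp.2 hL
    have hci : ∀ y ∈ uIoc (-π) π, ‖F (L + y * Complex.I) + g₀‖ ≤
        (Real.exp (-(ν * L)) / Real.sin (π * ν)
        + ‖g₀‖ * u * Real.exp (-(1 * L))) / (1 - u * Real.exp (-(1 * L))) := by
      intro y hy
      rw [uIoc_of_le (by linarith [pi_pos])] at hy
      have hne : (L : ℂ) + y * Complex.I ≠ x₀ := fun hc => by
        have := congrArg Complex.re hc
        simp at this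
        exact hL.ne' this
      obtain ⟨b1, b2, b3⟩ := hbounds L y ⟨hy.1.le, hy.2⟩
      rw [abs_of_pos (sub_pos.2 hLu)] at b3
      set w : ℂ := (L : ℂ) + y * Complex.I
      have hd : Complex.exp w - u ≠ 0 := norm_pos_iff.1 ((sub_pos.2 hLu).trans_le b3)
      have e1 : F w + g₀ = (logPropagator ν a w * Complex.exp w - g₀ * u)
          / (Complex.exp w - u) := by
        rw [hF, dispersionIntegrand_of_ne ν a hne, hex₀, ← hg₀]
        field_simp
        ring
      have e2 : (Real.exp (-(ν * L)) / Real.sin (π * ν)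
          + ‖g₀‖ * u * Real.exp (-(1 * L))) / (1 - u * Real.exp (-(1 * L)))
          = (Real.exp (-(ν * L)) / Real.sin (π * ν) * Real.exp L + ‖g₀‖ * u)
            / (Real.exp L - u) := by
        rw [← mul_div_mul_right _ _ (Real.exp_pos L).ne']
        have : Real.exp (-(1 * L)) * Real.exp L = 1 := by
          rw [one_mul, ← Real.exp_add, neg_add_cancel, Real.exp_zero]
        congr 1
        · linear_combination (‖g₀‖ * u) * this
        · linear_combination (-u) * this
      rw [e1, e2, norm_div]
      refine div_le_div₀ (by positivity) ((norm_sub_le _ _).trans ?_) (sub_pos.2 hLu) b3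
      rw [norm_mul, norm_mul, b2, Complex.norm_real, Real.norm_of_nonneg hu.le]
      gcongr
    have e3 : (∫ y : ℝ in (-π)..π, F (L + y * Complex.I)) - -(2 * π * g₀)
        = ∫ y : ℝ in (-π)..π, (F (L + y * Complex.I) + g₀) := by
      rw [intervalIntegral.integral_add (hvert L) (intervalIntegrable_const),
        intervalIntegral.integral_const, Complex.real_smul]
      push_cast
      ring
    rw [e3]
    exact intervalIntegral.norm_integral_le_of_norm_le_const hci
  -- On the left the propagator bound grows like `exp(νL)` when `a` may vanish, but `exp w` has
  -- modulus `exp(-L)` and `ν < 1`.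
  have hlim4 : Tendsto (fun L : ℝ => ∫ y : ℝ in (-π)..π, F ((-L : ℝ) + y * Complex.I)) atTop
      (𝓝 0) := by
    have hB : Tendsto (fun L : ℝ => (Real.exp (-((1 - ν) * L)) / Real.sin (π * ν)
        + ‖g₀‖ * Real.exp (-(1 * L))) / (u - Real.exp (-(1 * L))) * |π - (-π)|) atTop
        (𝓝 0) := by
      have := (((((hexp0 (1 - ν) (sub_pos.2 hν.2)).div_const (Real.sin (π * ν))).add
        ((hexp0 1 one_pos).const_mul ‖g₀‖)).div
        ((tendsto_const_nhds (x := u)).sub (hexp0 1 one_pos))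
        (by simpa using hu.ne')).mul_const |π - (-π)|)
      simpa using this
    refine squeeze_zero_norm' ?_ hB
    filter_upwards [eventually_gt_atTop (-x₀)] with L hL
    have hLu : Real.exp (-L) < u := by
      rw [← Real.exp_log hu]
      exact Real.exp_lt_exp.2 (by linarith)
    refine intervalIntegral.norm_integral_le_of_norm_le_const fun y hy => ?_
    rw [uIoc_of_le (by linarith [pi_pos])] at hy
    have hne : ((-L : ℝ) : ℂ) + y * Complex.I ≠ x₀ := fun hc => by
      have := congrArg Complex.re hc
      simp at this
      linarith
    obtain ⟨b1, b2, b3⟩ := hbounds (-L) y ⟨hy.1.le, hy.2⟩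
    rw [abs_sub_comm, abs_of_pos (sub_pos.2 hLu)] at b3
    rw [hF, dispersionIntegrand_of_ne ν a hne, hex₀, ← hg₀, mul_div_assoc', norm_div, one_mul]
    refine div_le_div₀ ?_ ?_ (sub_pos.2 hLu) b3
    · positivity
    · rw [norm_mul, b2]
      calc _ ≤ (Real.exp (-(ν * -L)) / Real.sin (π * ν) + ‖g₀‖) * Real.exp (-L) := by
            gcongr
            exact (norm_sub_le _ _).trans (by gcongr)
        _ = _ := by
            rw [add_mul, div_mul_eq_mul_div, ← Real.exp_add]
            congr 3
            ring
  have hlim := (hlim1.add (hlim3.const_mul Complex.I)).sub (hlim4.const_mul Complex.I)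
  have hz : (2 * Complex.I * Real.sin (π * ν)) * ((∫ x, h x : ℝ) : ℂ)
      + Complex.I * (-(2 * π * g₀)) - Complex.I * 0 = 0 := by
    refine tendsto_nhds_unique hlim (tendsto_const_nhds.congr fun L => ?_)
    rw [← hhor, hrect]
  have hz2 : (Real.sin (π * ν) : ℂ) * ((∫ x, h x : ℝ) : ℂ) = π * g₀ := by
    have h2 : (2 * Complex.I) ≠ 0 := by simp
    refine mul_left_cancel₀ h2 ?_
    linear_combination hz
  rw [hg₀v] at hz2
  exact_mod_cast hz2

/-! ### The Källén–Lehmann representation and the Schwinger modes -/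

/-- The integrand is at most a constant times `q^(1-2ν)` near `0`, integrable as `ν < 1`, and
`q^(-1-2ν)` at infinity, integrable as `ν > 0`. -/
theorem integrableOn_spectral_resolvent {n : ℕ} (hn : 1 ≤ n) {ν : ℝ} (hν : ν ∈ Ioo (0 : ℝ) 1)
    (f : ℝ) {u : ℝ} (hu : 0 < u) :
    IntegrableOn (fun q : ℝ => spectralDensity n ν f (q ^ 2) * (q / (u + q ^ 2))) (Ioi 0) := by
  have hA := Aconst_pos hn hν
  have hs := sin_pi_mul_pos hν
  set C : ℝ := 2 * Aconst n ν / Real.sin (π * ν)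
  have hm : Measurable fun q : ℝ => spectralDensity n ν f (q ^ 2) * (q / (u + q ^ 2)) :=
    ((measurable_spectralDensity n ν f).comp (measurable_id.pow_const 2)).mul (by fun_prop)
  have key : ∀ q : ℝ, 0 < q → ‖spectralDensity n ν f (q ^ 2) * (q / (u + q ^ 2))‖
      ≤ C * (q ^ (1 - 2 * ν) / (u + q ^ 2)) := by
    intro q hq
    have hρ := spectralDensity_pos hn hν f (s := q ^ 2) (by positivity)
    have h1 : (q ^ 2) ^ (-ν) * q = q ^ (1 - 2 * ν) := by
      rw [← Real.rpow_natCast, ← Real.rpow_mul hq.le, ← Real.rpow_add_one hq.ne']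
      congr 1
      push_cast
      ring
    rw [Real.norm_of_nonneg (by positivity), ← h1]
    calc _ ≤ (C * (q ^ 2) ^ (-ν)) * (q / (u + q ^ 2)) := by
          gcongr
          exact spectralDensity_le hn hν f (by positivity)
      _ = _ := by ring
  rw [← Ioc_union_Ioi_eq_Ioi (zero_le_one' ℝ)]
  refine IntegrableOn.union ?_ ?_
  · have h1 : IntegrableOn (fun q : ℝ => q ^ (1 - 2 * ν)) (Ioc 0 1) :=
      (intervalIntegrable_iff_integrableOn_Ioc_of_le zero_le_one).1
        (intervalIntegral.intervalIntegrable_rpow' (by linarith [hν.2]))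
    refine Integrable.mono' (h1.const_mul (C * u⁻¹)) hm.aestronglyMeasurable ?_
    filter_upwards [ae_restrict_mem measurableSet_Ioc] with q hq
    have hq0 : 0 < q := hq.1
    refine (key q hq0).trans ?_
    rw [mul_assoc, inv_mul_eq_div]
    have : u ≤ u + q ^ 2 := by nlinarith
    gcongr
  · have h1 : IntegrableOn (fun q : ℝ => q ^ (-1 - 2 * ν)) (Ioi 1) :=
      integrableOn_Ioi_rpow_of_lt (by linarith [hν.1]) one_pos
    refine Integrable.mono' (h1.const_mul C) hm.aestronglyMeasurable ?_
    filter_upwards [ae_restrict_mem measurableSet_Ioi] with q hq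
    have hq0 : 0 < q := one_pos.trans hq
    refine (key q hq0).trans ?_
    have h2 : q ^ (-1 - 2 * ν) = q ^ (1 - 2 * ν) / q ^ 2 := by
      rw [← Real.rpow_two, ← Real.rpow_sub hq0]
      congr 1
      ring
    rw [h2]
    have : q ^ 2 ≤ u + q ^ 2 := by linarith
    gcongr

theorem image_exp_half : (fun x : ℝ => Real.exp (x / 2)) '' univ = Ioi 0 := by
  ext q
  constructor
  · rintro ⟨x, -, rfl⟩
    exact Real.exp_pos _
  · intro hq
    exact ⟨2 * Real.log q, mem_univ _, by simp [Real.exp_log hq]⟩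

/-- The substitution `q = exp(x / 2)`, under which `q² = exp x`, turns this into
`integral_dispersion` with `a = f A`. -/
theorem kallenLehmann {n : ℕ} (hn : 1 ≤ n) {ν : ℝ} (hν : ν ∈ Ioo (0 : ℝ) 1)
    {f : ℝ} (hf : 0 ≤ f) {u : ℝ} (hu : 0 < u) :
    ∫ q in Ioi (0 : ℝ), spectralDensity n ν f (q ^ 2) * (q / (u + q ^ 2))
      = π * (Aconst n ν / (u ^ ν + f * Aconst n ν)) := by
  have hA := Aconst_pos hn hν
  have hs := sin_pi_mul_pos hν
  have hd : ∀ x ∈ (univ : Set ℝ), HasDerivWithinAt (fun x : ℝ => Real.exp (x / 2))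
      (Real.exp (x / 2) * (1 / 2)) univ x := fun x _ =>
    (((hasDerivAt_id x).div_const 2).exp).hasDerivWithinAt
  have hinj : InjOn (fun x : ℝ => Real.exp (x / 2)) univ := fun x _ y _ h => by
    have := Real.exp_injective h
    linarith
  have hpt : ∀ x : ℝ, |Real.exp (x / 2) * (1 / 2)| • (spectralDensity n ν f (Real.exp (x / 2) ^ 2)
      * (Real.exp (x / 2) / (u + Real.exp (x / 2) ^ 2)))
      = (Aconst n ν * Real.sin (π * ν)) * (Real.exp (ν * x) / (Real.exp (ν * x) ^ 2
        + f * Aconst n ν * (2 * Real.cos (π * ν)) * Real.exp (ν * x) + (f * Aconst n ν) ^ 2)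
          * (Real.exp x / (Real.exp x + u))) := by
    intro x
    have e1 : Real.exp (x / 2) ^ 2 = Real.exp x := by
      rw [← Real.exp_nat_mul]
      congr 1
      push_cast
      ring
    have e2 : Real.exp x ^ ν = Real.exp (ν * x) := by rw [← Real.exp_mul, mul_comm]
    rw [abs_of_pos (by positivity), e1, spectralDensity, rpow_two_mul (Real.exp_pos x).le, e2,
      smul_eq_mul, add_comm u]
    linear_combination (Aconst n ν * Real.sin (π * ν) * (Real.exp (ν * x) / (Real.exp (ν * x) ^ 2
        + f * Aconst n ν * (2 * Real.cos (π * ν)) * Real.exp (ν * x) + (f * Aconst n ν) ^ 2)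
          * (1 / (Real.exp x + u)))) * e1
  have hi := integrableOn_spectral_resolvent hn hν f hu
  rw [← image_exp_half, integrableOn_image_iff_integrableOn_abs_deriv_smul MeasurableSet.univ hd
    hinj, integrableOn_univ] at hi
  rw [← image_exp_half, integral_image_eq_integral_abs_deriv_smul MeasurableSet.univ hd hinj,
    Measure.restrict_univ]
  simp only [hpt] at hi ⊢
  have hc : Aconst n ν * Real.sin (π * ν) ≠ 0 := by positivity
  have hi' := (integrable_const_mul_iff (isUnit_iff_ne_zero.2 hc) _).1 hi
  rw [integral_const_mul, mul_assoc,
    integral_dispersion hν (mul_nonneg hf hA.le) hu hi']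
  ring

/-! ### Fourier integrals of the resolvent `1 / (s² + E²)` -/

theorem integrable_inv_sq_add_sq {E : ℝ} (hE : 0 < E) :
    Integrable fun s : ℝ => (s ^ 2 + E ^ 2)⁻¹ := by
  have h := (integrable_inv_one_add_sq.comp_div hE.ne').const_mul (E ^ 2)⁻¹
  refine h.congr (.of_forall fun s => ?_)
  simp only
  rw [← mul_inv]
  congr 1
  field_simp
  ring

open FourierTransform in
theorem fourier_exp_neg_abs {E : ℝ} (hE : 0 < E) (ξ : ℝ) :
    Integrable (fun x : ℝ => (Real.exp (-(E * |x|)) : ℂ)) ∧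
    𝓕 (fun x : ℝ => (Real.exp (-(E * |x|)) : ℂ)) ξ
      = 2 * E * ((((2 * π * ξ) ^ 2 + E ^ 2)⁻¹ : ℝ) : ℂ) := by
  have main : ∀ η : ℝ, Integrable (fun x : ℝ => Complex.exp ((-2 * π * x * η : ℝ) * Complex.I) •
        (Real.exp (-(E * |x|)) : ℂ)) ∧
      ∫ x : ℝ, Complex.exp ((-2 * π * x * η : ℝ) * Complex.I) • (Real.exp (-(E * |x|)) : ℂ)
        = 2 * E * ((((2 * π * η) ^ 2 + E ^ 2)⁻¹ : ℝ) : ℂ) := by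
    intro η
    set a : ℂ := E - 2 * π * η * Complex.I with ha
    set b : ℂ := -E - 2 * π * η * Complex.I with hb
    have hare : 0 < a.re := by simpa [ha] using hE
    have hbre : b.re < 0 := by simpa [hb] using hE
    have e1 : EqOn (fun x : ℝ => Complex.exp ((-2 * π * x * η : ℝ) * Complex.I) •
        (Real.exp (-(E * |x|)) : ℂ)) (fun x : ℝ => Complex.exp (a * x)) (Iic 0) := by
      intro x hx
      have hx' : x ≤ 0 := hx
      simp only [smul_eq_mul, Complex.ofReal_exp, ← Complex.exp_add, abs_of_nonpos hx', ha]
      congr 1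
      push_cast
      ring
    have e2 : EqOn (fun x : ℝ => Complex.exp ((-2 * π * x * η : ℝ) * Complex.I) •
        (Real.exp (-(E * |x|)) : ℂ)) (fun x : ℝ => Complex.exp (b * x)) (Ioi 0) := by
      intro x hx
      have hx' : 0 < x := hx
      simp only [smul_eq_mul, Complex.ofReal_exp, ← Complex.exp_add, abs_of_pos hx', hb]
      congr 1
      push_cast
      ring
    have i1 := (integrableOn_congr_fun e1 measurableSet_Iic).2
      (integrableOn_exp_mul_complex_Iic hare 0)
    have i2 := (integrableOn_congr_fun e2 measurableSet_Ioi).2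
      (integrableOn_exp_mul_complex_Ioi hbre 0)
    have i3 := i1.union i2
    rw [Iic_union_Ioi, integrableOn_univ] at i3
    refine ⟨i3, ?_⟩
    rw [← setIntegral_univ, ← Iic_union_Ioi (a := (0 : ℝ)),
      setIntegral_union (Iic_disjoint_Ioi le_rfl) measurableSet_Ioi i1 i2,
      setIntegral_congr_fun measurableSet_Iic e1, setIntegral_congr_fun measurableSet_Ioi e2,
      integral_exp_mul_complex_Iic hare, integral_exp_mul_complex_Ioi hbre]
    have ha0 : a ≠ 0 := fun h => by simp [h] at hare
    have hb0 : b ≠ 0 := fun h => by simp [h] at hbre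
    have hab : a * b = -((((2 * π * η) ^ 2 + E ^ 2 : ℝ)) : ℂ) := by
      rw [ha, hb]
      push_cast
      linear_combination (2 * π * η) ^ 2 * Complex.I_sq
    have hne : ((((2 * π * η) ^ 2 + E ^ 2 : ℝ)) : ℂ) ≠ 0 := by
      exact_mod_cast (by positivity : (2 * π * η) ^ 2 + E ^ 2 ≠ 0)
    rw [Complex.ofReal_inv]
    simp only [Complex.ofReal_zero, mul_zero, Complex.exp_zero]
    rw [neg_div, ← sub_eq_add_neg, div_sub_div _ _ ha0 hb0, hab, div_eq_iff (neg_ne_zero.2 hne),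
      mul_neg, mul_assoc (2 * (E : ℂ)), inv_mul_cancel₀ hne, ha, hb]
    ring
  refine ⟨?_, ?_⟩
  · simpa using (main 0).1
  · rw [Real.fourier_real_eq_integral_exp_smul]
    exact (main ξ).2

-- Fourier inversion for `exp(-E|x|)`, whose transform is the resolvent after the rescaling `s =
-- 2πξ`.
open FourierTransform in
theorem integral_exp_mul_inv_sq_add_sq {E : ℝ} (hE : 0 < E) (τ : ℝ) :
    ∫ s : ℝ, Complex.exp (Complex.I * ((s * τ : ℝ) : ℂ)) * (((s ^ 2 + E ^ 2)⁻¹ : ℝ) : ℂ)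
      = ((π / E * Real.exp (-(E * |τ|)) : ℝ) : ℂ) := by
  set φ : ℝ → ℂ := fun x : ℝ => (Real.exp (-(E * |x|)) : ℂ) with hφ
  have h𝓕 : 𝓕 φ = fun ξ : ℝ => 2 * E * ((((2 * π * ξ) ^ 2 + E ^ 2)⁻¹ : ℝ) : ℂ) :=
    funext fun ξ => (fourier_exp_neg_abs hE ξ).2
  have hi : Integrable (𝓕 φ) := by
    rw [h𝓕]
    exact (((integrable_inv_sq_add_sq hE).comp_mul_left'
      (by positivity : 2 * π ≠ 0)).ofReal).const_mul _
  have hc : Continuous φ := by fun_prop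
  have hinv := congrFun (hc.fourierInv_fourier_eq (fourier_exp_neg_abs hE 0).1 hi) τ
  rw [fourierInv_eq_fourier_neg, Real.fourier_real_eq_integral_exp_smul, h𝓕] at hinv
  have hg : ∀ ξ : ℝ, Complex.exp ((-2 * π * ξ * -τ : ℝ) * Complex.I) •
      (2 * E * ((((2 * π * ξ) ^ 2 + E ^ 2)⁻¹ : ℝ) : ℂ))
      = (fun s : ℝ => 2 * E * (Complex.exp (Complex.I * ((s * τ : ℝ) : ℂ))
        * (((s ^ 2 + E ^ 2)⁻¹ : ℝ) : ℂ))) (2 * π * ξ) := by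
    intro ξ
    simp only [smul_eq_mul]
    rw [show ((-2 * π * ξ * -τ : ℝ) : ℂ) * Complex.I
      = Complex.I * ((2 * π * ξ * τ : ℝ) : ℂ) by push_cast; ring]
    ring
  simp only [hg] at hinv
  rw [Measure.integral_comp_mul_left
    (fun s : ℝ => 2 * E * (Complex.exp (Complex.I * ((s * τ : ℝ) : ℂ))
        * (((s ^ 2 + E ^ 2)⁻¹ : ℝ) : ℂ))) (2 * π), integral_const_mul,
    abs_of_pos (by positivity : 0 < (2 * π)⁻¹), Complex.real_smul] at hinv
  have hE' : (E : ℂ) ≠ 0 := by exact_mod_cast hE.ne'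
  have hπ' : (π : ℂ) ≠ 0 := by exact_mod_cast pi_ne_zero
  rw [hφ] at hinv
  simp only at hinv
  rw [Complex.ofReal_mul, ← hinv]
  generalize (∫ s : ℝ, Complex.exp (Complex.I * ((s * τ : ℝ) : ℂ))
    * (((s ^ 2 + E ^ 2)⁻¹ : ℝ) : ℂ)) = J
  push_cast
  field_simp

theorem integrable_exp_mul_inv_sq_add_sq {E : ℝ} (hE : 0 < E) (τ : ℝ) :
    Integrable fun s : ℝ =>
      Complex.exp (Complex.I * ((s * τ : ℝ) : ℂ)) * (((s ^ 2 + E ^ 2)⁻¹ : ℝ) : ℂ) := by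
  refine (integrable_inv_sq_add_sq hE).ofReal.bdd_mul (c := 1) (by fun_prop)
    (.of_forall fun s => ?_)
  rw [mul_comm, Complex.norm_exp_ofReal_mul_I]

/-- The truncated Fourier integrals of `1 / (s² + E²)`. -/
noncomputable def resolventCutoff (E τ R : ℝ) : ℂ :=
  ∫ s in (-R)..R, Complex.exp (Complex.I * ((s * τ : ℝ) : ℂ)) * (((s ^ 2 + E ^ 2)⁻¹ : ℝ) : ℂ)

theorem tendsto_resolventCutoff {E : ℝ} (hE : 0 < E) (τ : ℝ) :
    Tendsto (resolventCutoff E τ) atTop (𝓝 ((π / E * Real.exp (-(E * |τ|)) : ℝ) : ℂ)) := by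
  rw [← integral_exp_mul_inv_sq_add_sq hE τ]
  exact intervalIntegral_tendsto_integral (integrable_exp_mul_inv_sq_add_sq hE τ)
    tendsto_neg_atTop_atBot tendsto_id

theorem integral_inv_sq_add_sq {E : ℝ} (hE : 0 < E) :
    ∫ s : ℝ, (s ^ 2 + E ^ 2)⁻¹ = π / E := by
  have h := integral_exp_mul_inv_sq_add_sq hE 0
  simp only [mul_zero, Complex.ofReal_zero, Complex.exp_zero, one_mul, abs_zero, neg_zero,
    Real.exp_zero, mul_one] at h
  exact Complex.ofReal_injective (integral_complex_ofReal.symm.trans h)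

/-- One integration by parts against the oscillation improves the trivial `π / E` to `E⁻²`,
uniformly in `R`. The gain is needed: against `ρ(q²) q`, of order `q^(1-2ν)` at infinity, `E⁻¹` is
not integrable when `ν ≤ 1/2`, while `E⁻²` always is. -/
theorem norm_resolventCutoff_le {E : ℝ} (hE : 0 < E) {τ : ℝ} (hτ : τ ≠ 0) {R : ℝ} (hR : 0 ≤ R) :
    ‖resolventCutoff E τ R‖ ≤ (2 + π) / |τ| * (E ^ 2)⁻¹ := by
  have hIτ : Complex.I * (τ : ℂ) ≠ 0 := mul_ne_zero Complex.I_ne_zero (by exact_mod_cast hτ)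
  set v : ℝ → ℂ := fun s => Complex.exp (Complex.I * ((s * τ : ℝ) : ℂ)) / (Complex.I * τ) with hv
  set u : ℝ → ℂ := fun s => (((s ^ 2 + E ^ 2)⁻¹ : ℝ) : ℂ) with hu
  set u' : ℝ → ℂ := fun s => ((-(2 * s) / (s ^ 2 + E ^ 2) ^ 2 : ℝ) : ℂ) with hu'
  have hpos : ∀ s : ℝ, 0 < s ^ 2 + E ^ 2 := fun s => by positivity
  have hvn : ∀ s, ‖v s‖ = |τ|⁻¹ := by
    intro s
    rw [hv, norm_div, mul_comm, Complex.norm_exp_ofReal_mul_I, norm_mul, Complex.norm_I, one_mul,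
      Complex.norm_real, Real.norm_eq_abs, one_div]
  have hdu : ∀ s, HasDerivAt u (u' s) s := by
    intro s
    have h1 : HasDerivAt (fun s : ℝ => (s ^ 2 + E ^ 2)⁻¹) (-(2 * s) / (s ^ 2 + E ^ 2) ^ 2) s := by
      have := ((hasDerivAt_pow 2 s).add_const (E ^ 2)).fun_inv (hpos s).ne'
      simpa using this
    exact h1.ofReal_comp
  have hdv : ∀ s, HasDerivAt v (Complex.exp (Complex.I * ((s * τ : ℝ) : ℂ))) s := by
    intro s
    have h1 : HasDerivAt (fun s : ℝ => Complex.I * ((s * τ : ℝ) : ℂ)) (Complex.I * τ) s := by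
      have := (((hasDerivAt_id s).mul_const τ).ofReal_comp).const_mul Complex.I
      simpa using this
    have := h1.cexp.div_const (Complex.I * τ)
    rwa [mul_div_cancel_right₀ _ hIτ] at this
  have hu'c : Continuous u' := by
    rw [hu']
    refine Complex.continuous_ofReal.comp (Continuous.div (by fun_prop) (by fun_prop) fun s => ?_)
    exact (pow_pos (hpos s) 2).ne'
  have hparts := intervalIntegral.integral_mul_deriv_eq_deriv_mul (a := -R) (b := R)
    (fun s _ => hdu s) (fun s _ => hdv s) (hu'c.intervalIntegrable _ _)
    (Continuous.intervalIntegrable (by fun_prop) _ _)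
  have hun : ∀ s, ‖u s‖ ≤ (E ^ 2)⁻¹ := by
    intro s
    rw [hu, Complex.norm_real, Real.norm_of_nonneg (inv_nonneg.2 (hpos s).le)]
    exact inv_anti₀ (by positivity) (by nlinarith)
  have hu'n : ∀ s, ‖u' s * v s‖ ≤ E⁻¹ * |τ|⁻¹ * (s ^ 2 + E ^ 2)⁻¹ := by
    intro s
    rw [norm_mul, hvn, hu', Complex.norm_real, norm_div, norm_neg, Real.norm_eq_abs,
      Real.norm_of_nonneg (pow_pos (hpos s) 2).le, mul_right_comm]
    gcongr
    rw [div_le_iff₀ (pow_pos (hpos s) 2), abs_mul, abs_two]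
    -- This inequality trades one power of the denominator of `u'` for `1 / E`, leaving the
    -- integrable `(s² + E²)⁻¹` of mass `π / E`.
    have h1 : 2 * |s| * E ≤ s ^ 2 + E ^ 2 := by
      nlinarith [sq_nonneg (|s| - E), sq_abs s]
    have h2 : E⁻¹ * (s ^ 2 + E ^ 2)⁻¹ * (s ^ 2 + E ^ 2) ^ 2 = (s ^ 2 + E ^ 2) / E := by
      have := (hpos s).ne'
      field_simp
    rw [h2, le_div_iff₀ hE]
    exact h1
  have hint : ‖∫ s in (-R)..R, u' s * v s‖ ≤ E⁻¹ * |τ|⁻¹ * (π / E) := by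
    rw [← integral_inv_sq_add_sq hE, ← integral_const_mul]
    have hi := (integrable_inv_sq_add_sq hE).const_mul (E⁻¹ * |τ|⁻¹)
    refine (intervalIntegral.norm_integral_le_of_norm_le (by linarith)
      (.of_forall fun s _ => hu'n s) hi.intervalIntegrable).trans ?_
    rw [intervalIntegral.integral_of_le (by linarith)]
    exact setIntegral_le_integral hi (.of_forall fun s => by positivity)
  have heq : resolventCutoff E τ R
      = u R * v R - u (-R) * v (-R) - ∫ s in (-R)..R, u' s * v s := by
    rw [← hparts, resolventCutoff]
    exact intervalIntegral.integral_congr fun s _ => mul_comm _ _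
  rw [heq]
  have hb : ∀ s, ‖u s * v s‖ ≤ (E ^ 2)⁻¹ * |τ|⁻¹ := fun s => by
    rw [norm_mul, hvn]
    exact mul_le_mul_of_nonneg_right (hun s) (by positivity)
  calc _ ≤ (E ^ 2)⁻¹ * |τ|⁻¹ + (E ^ 2)⁻¹ * |τ|⁻¹ + E⁻¹ * |τ|⁻¹ * (π / E) :=
        (norm_sub_le _ _).trans (add_le_add ((norm_sub_le _ _).trans
          (add_le_add (hb _) (hb _))) hint)
    _ = _ := by
        have : |τ| ≠ 0 := abs_ne_zero.2 hτ
        field_simp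
        ring

/-! ### Schwinger modes as spectral integrals -/

theorem measurable_spectral_resolvent (n : ℕ) (ν f τ : ℝ)
    (k : EuclideanSpace ℝ (Fin n)) :
    Measurable fun y : ℝ × ℝ => Complex.exp (Complex.I * ((y.1 * τ : ℝ) : ℂ)) *
      ((spectralDensity n ν f (y.2 ^ 2) * (y.2 / (‖k‖ ^ 2 + y.1 ^ 2 + y.2 ^ 2)) : ℝ) : ℂ) := by
  refine Measurable.mul (by fun_prop) (Complex.measurable_ofReal.comp (Measurable.mul ?_ ?_))
  · exact (measurable_spectralDensity n ν f).comp (measurable_snd.pow_const 2)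
  · fun_prop

/-- Fubini is used at finite `R`, where absolute convergence is available: the `s²` in the
denominator is dropped, leaving the resolvent integral at `u = |k|² > 0` on a bounded interval. -/
theorem schwingerCutoff_eq {n : ℕ} (hn : 1 ≤ n) {ν : ℝ} (hν : ν ∈ Ioo (0 : ℝ) 1)
    {f : ℝ} (hf : 0 ≤ f) (τ : ℝ) {k : EuclideanSpace ℝ (Fin n)} (hk : k ≠ 0) {R : ℝ}
    (hR : 0 ≤ R) :
    schwingerCutoff n ν f τ k R = (2 * π ^ 2 : ℂ)⁻¹ * ∫ q in Ioi (0 : ℝ),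
      ((spectralDensity n ν f (q ^ 2) * q : ℝ) : ℂ) * resolventCutoff (energy k q) τ R := by
  have hk0 : 0 < ‖k‖ := norm_pos_iff.2 hk
  have hπ : (π : ℂ) ≠ 0 := by exact_mod_cast pi_ne_zero
  have h1 : schwingerCutoff n ν f τ k R = ∫ s in Ioc (-R) R, ∫ q in Ioi (0 : ℝ),
      (2 * π ^ 2 : ℂ)⁻¹ * (Complex.exp (Complex.I * ((s * τ : ℝ) : ℂ)) *
      ((spectralDensity n ν f (q ^ 2) * (q / (‖k‖ ^ 2 + s ^ 2 + q ^ 2)) : ℝ) : ℂ)) := by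
    rw [schwingerCutoff, intervalIntegral.integral_of_le (by linarith)]
    refine setIntegral_congr_fun measurableSet_Ioc fun s _ => ?_
    rw [integral_const_mul, integral_const_mul, integral_complex_ofReal,
      kallenLehmann hn hν hf (by positivity)]
    generalize Aconst n ν / ((‖k‖ ^ 2 + s ^ 2) ^ ν + f * Aconst n ν) = B
    push_cast
    field_simp
  have hint : Integrable (Function.uncurry fun (s q : ℝ) =>
      (2 * π ^ 2 : ℂ)⁻¹ * (Complex.exp (Complex.I * ((s * τ : ℝ) : ℂ)) *
      ((spectralDensity n ν f (q ^ 2) * (q / (‖k‖ ^ 2 + s ^ 2 + q ^ 2)) : ℝ) : ℂ)))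
      ((volume.restrict (Ioc (-R) R)).prod (volume.restrict (Ioi 0))) := by
    refine Integrable.const_mul ?_ _
    have hb : Integrable (fun y : ℝ × ℝ => (1 : ℝ) *
        (spectralDensity n ν f (y.2 ^ 2) * (y.2 / (‖k‖ ^ 2 + y.2 ^ 2))))
        ((volume.restrict (Ioc (-R) R)).prod (volume.restrict (Ioi 0))) :=
      Integrable.mul_prod (f := fun _ : ℝ => (1 : ℝ)) (by simp)
        (integrableOn_spectral_resolvent hn hν f (by positivity : 0 < ‖k‖ ^ 2))
    refine hb.mono' (measurable_spectral_resolvent n ν f τ k).aestronglyMeasurable ?_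
    rw [Measure.prod_restrict]
    filter_upwards [ae_restrict_mem (measurableSet_Ioc.prod measurableSet_Ioi)] with y hy
    have hq : 0 < y.2 := hy.2
    have hρ := spectralDensity_pos hn hν f (s := y.2 ^ 2) (by positivity)
    rw [norm_mul, mul_comm Complex.I, Complex.norm_exp_ofReal_mul_I, Complex.norm_real,
      Real.norm_of_nonneg (by positivity)]
    have : ‖k‖ ^ 2 + y.2 ^ 2 ≤ ‖k‖ ^ 2 + y.1 ^ 2 + y.2 ^ 2 := by nlinarith [sq_nonneg y.1]
    gcongr
  rw [h1, integral_integral_swap hint, ← integral_const_mul]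
  refine setIntegral_congr_fun measurableSet_Ioi fun q _ => ?_
  rw [resolventCutoff, intervalIntegral.integral_of_le (by linarith),
    ← integral_const_mul, ← integral_const_mul]
  refine setIntegral_congr_fun measurableSet_Ioc fun s _ => ?_
  simp only [energy_sq]
  rw [show s ^ 2 + (‖k‖ ^ 2 + q ^ 2) = ‖k‖ ^ 2 + s ^ 2 + q ^ 2 by ring]
  push_cast
  ring

/-- Dominated convergence in `q`, with the `R`-uniform bound `norm_resolventCutoff_le`. -/
theorem tendsto_schwingerCutoff {n : ℕ} (hn : 1 ≤ n) {ν : ℝ} (hν : ν ∈ Ioo (0 : ℝ) 1)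
    {f : ℝ} (hf : 0 ≤ f) {τ : ℝ} (hτ : τ ≠ 0) {k : EuclideanSpace ℝ (Fin n)} (hk : k ≠ 0) :
    Tendsto (schwingerCutoff n ν f τ k) atTop (𝓝 ((2 * π : ℂ)⁻¹ * ∫ q in Ioi (0 : ℝ),
      ((spectralDensity n ν f (q ^ 2) * (q / energy k q)
        * Real.exp (-(energy k q * |τ|)) : ℝ) : ℂ))) := by
  have hk0 : 0 < ‖k‖ := norm_pos_iff.2 hk
  have hπ : (π : ℂ) ≠ 0 := by exact_mod_cast pi_ne_zero
  have hE : ∀ q, 0 < energy k q := fun q => Real.sqrt_pos.2 (by positivity)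
  have hlim : Tendsto (fun R => (2 * π ^ 2 : ℂ)⁻¹ * ∫ q in Ioi (0 : ℝ),
      ((spectralDensity n ν f (q ^ 2) * q : ℝ) : ℂ) * resolventCutoff (energy k q) τ R) atTop
      (𝓝 ((2 * π ^ 2 : ℂ)⁻¹ * ∫ q in Ioi (0 : ℝ),
        ((spectralDensity n ν f (q ^ 2) * q : ℝ) : ℂ)
        * ((π / energy k q * Real.exp (-(energy k q * |τ|)) : ℝ) : ℂ))) := by
    refine Tendsto.const_mul _ (tendsto_integral_filter_of_dominated_convergence
      (fun q => (2 + π) / |τ| * (spectralDensity n ν f (q ^ 2) * (q / (‖k‖ ^ 2 + q ^ 2))))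
      ?_ ?_ ((integrableOn_spectral_resolvent hn hν f (by positivity)).const_mul _) ?_)
    · refine .of_forall fun R => ?_
      have hm : StronglyMeasurable fun y : ℝ × ℝ =>
          Complex.exp (Complex.I * ((y.2 * τ : ℝ) : ℂ))
            * (((y.2 ^ 2 + energy k y.1 ^ 2)⁻¹ : ℝ) : ℂ) := by
        simp only [energy_sq]
        exact Measurable.stronglyMeasurable (by fun_prop)
      have hm2 : Measurable fun q : ℝ => resolventCutoff (energy k q) τ R := by
        unfold resolventCutoff
        simp only [intervalIntegral]
        exact (hm.integral_prod_right'.sub hm.integral_prod_right').measurable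
      exact ((Complex.measurable_ofReal.comp
        (((measurable_spectralDensity n ν f).comp (measurable_id.pow_const 2)).mul
          measurable_id)).mul hm2).aestronglyMeasurable
    · filter_upwards [eventually_ge_atTop 0] with R hR
      filter_upwards [ae_restrict_mem measurableSet_Ioi] with q hq
      have hq0 : 0 < q := hq
      have hρ := spectralDensity_pos hn hν f (s := q ^ 2) (by positivity)
      rw [norm_mul, Complex.norm_real, Real.norm_of_nonneg (by positivity)]
      calc _ ≤ spectralDensity n ν f (q ^ 2) * q * ((2 + π) / |τ| * (energy k q ^ 2)⁻¹) :=
            mul_le_mul_of_nonneg_left (norm_resolventCutoff_le (hE q) hτ hR) (by positivity)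
        _ = _ := by
            rw [energy_sq]
            ring
    · exact .of_forall fun q => (tendsto_resolventCutoff (hE q) τ).const_mul _
  have heq : (2 * π ^ 2 : ℂ)⁻¹ * ∫ q in Ioi (0 : ℝ),
        ((spectralDensity n ν f (q ^ 2) * q : ℝ) : ℂ)
        * ((π / energy k q * Real.exp (-(energy k q * |τ|)) : ℝ) : ℂ)
      = (2 * π : ℂ)⁻¹ * ∫ q in Ioi (0 : ℝ), ((spectralDensity n ν f (q ^ 2) * (q / energy k q)
        * Real.exp (-(energy k q * |τ|)) : ℝ) : ℂ) := by
    rw [← integral_const_mul, ← integral_const_mul]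
    congr 1
    ext q
    have : (energy k q : ℂ) ≠ 0 := by exact_mod_cast (hE q).ne'
    push_cast
    field_simp
  rw [← heq]
  refine hlim.congr' ?_
  filter_upwards [eventually_ge_atTop 0] with R hR
  rw [schwingerCutoff_eq hn hν hf τ hk hR]

theorem schwingerMode_eq {n : ℕ} (hn : 1 ≤ n) {ν : ℝ} (hν : ν ∈ Ioo (0 : ℝ) 1)
    {f : ℝ} (hf : 0 ≤ f) {τ : ℝ} (hτ : τ ≠ 0) {k : EuclideanSpace ℝ (Fin n)} (hk : k ≠ 0) :
    schwingerMode n ν f τ k = (2 * π : ℂ)⁻¹ * ∫ q in Ioi (0 : ℝ),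
      ((spectralDensity n ν f (q ^ 2) * (q / energy k q)
        * Real.exp (-(energy k q * |τ|)) : ℝ) : ℂ) :=
  (tendsto_schwingerCutoff hn hν hf hτ hk).limUnder_eq

/-! ### The Wightman function at complex times -/

theorem exp_neg_mul_le_inv_pow {ε : ℝ} (hε : 0 < ε) (N : ℕ) {x : ℝ} (hx : 0 ≤ x) :
    Real.exp (-(ε * x)) ≤ (N.factorial * Real.exp ε / ε ^ N) * ((1 + x) ^ N)⁻¹ := by
  have h := Real.pow_div_factorial_le_exp (ε * (1 + x)) (by positivity) N
  have hN : (0 : ℝ) < N.factorial := by exact_mod_cast N.factorial_pos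
  have h2 : Real.exp (ε * (1 + x)) = Real.exp ε * Real.exp (ε * x) := by
    rw [← Real.exp_add]
    congr 1
    ring
  rw [h2, mul_pow, div_le_iff₀ hN] at h
  rw [Real.exp_neg, ← div_eq_mul_inv, div_div, le_div_iff₀ (by positivity),
    inv_mul_le_iff₀ (Real.exp_pos _)]
  linarith

/-- Exponential damping pays for any polynomial: `N` powers compensate the growth and `n + 3` remain
for `integrable_wightmanDensity_mul`. -/
theorem integrable_wightmanDensity_mul_exp {n : ℕ} (hn : 1 ≤ n) {ν : ℝ}
    (hν : ν ∈ Ioo (0 : ℝ) 1) (f : ℝ) {G : Mink n → ℂ} (hG : Measurable G) {ε : ℝ} (hε : 0 < ε)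
    (N : ℕ) {C : ℝ} (hC : 0 ≤ C)
    (hb : ∀ p : Mink n, ‖p.2‖ < p.1 → ‖G p‖ ≤ C * (1 + p.1) ^ N * Real.exp (-(ε * p.1))) :
    Integrable fun p => (wightmanDensity n ν f p : ℂ) * G p := by
  refine integrable_wightmanDensity_mul hn hν f hG
    (C * ((N + (n + 3)).factorial * Real.exp ε / ε ^ (N + (n + 3)))) fun p hp => ?_
  have hp0 : 0 ≤ p.1 := (norm_nonneg _).trans hp.le
  refine (hb p hp).trans ?_
  calc _ ≤ C * (1 + p.1) ^ N * (((N + (n + 3)).factorial * Real.exp ε / ε ^ (N + (n + 3)))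
        * ((1 + p.1) ^ (N + (n + 3)))⁻¹) := by
        gcongr
        exact exp_neg_mul_le_inv_pow hε _ hp0
    _ = _ := by
        rw [pow_add (1 + p.1) N]
        have : (1 + p.1) ^ N ≠ 0 := by positivity
        field_simp

theorem wightmanIntegrand_eq (n : ℕ) (ν f : ℝ) (z : ℂ) (x : EuclideanSpace ℝ (Fin n)) :
    wightmanIntegrand n ν f z x = fun p => (wightmanDensity n ν f p : ℂ) *
      (Complex.exp (Complex.I * ((⟪p.2, x⟫ : ℝ) : ℂ) - Complex.I * (p.1 : ℂ) * z)
        / (2 * π) ^ (n + 1)) := by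
  ext p
  unfold wightmanIntegrand
  ring

theorem norm_wightman_phase {n : ℕ} (z : ℂ) (x : EuclideanSpace ℝ (Fin n)) (p : Mink n) :
    ‖Complex.exp (Complex.I * ((⟪p.2, x⟫ : ℝ) : ℂ) - Complex.I * (p.1 : ℂ) * z)‖
      = Real.exp (p.1 * z.im) := by
  rw [Complex.norm_exp]
  congr 1
  simp

theorem norm_two_pi_pow (m : ℕ) : ‖((2 * π : ℂ)) ^ m‖ = (2 * π) ^ m := by
  rw [norm_pow, norm_mul, Complex.norm_real, Complex.norm_two, Real.norm_of_nonneg pi_pos.le]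

theorem one_le_two_pi_pow (m : ℕ) : 1 ≤ (2 * π) ^ m :=
  one_le_pow₀ (by nlinarith [pi_gt_three])

theorem norm_div_two_pi_pow_le (c : ℂ) (m : ℕ) : ‖c / (2 * π) ^ m‖ ≤ ‖c‖ := by
  rw [norm_div, norm_two_pi_pow]
  exact div_le_self (norm_nonneg _) (one_le_two_pi_pow m)

theorem integrable_wightmanIntegrand {n : ℕ} (hn : 1 ≤ n) {ν : ℝ} (hν : ν ∈ Ioo (0 : ℝ) 1)
    (f : ℝ) {z : ℂ} (hz : z.im < 0) (x : EuclideanSpace ℝ (Fin n)) :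
    Integrable (wightmanIntegrand n ν f z x) := by
  rw [wightmanIntegrand_eq]
  refine integrable_wightmanDensity_mul_exp hn hν f (Continuous.measurable (by fun_prop))
    (neg_pos.2 hz) 0 zero_le_one fun p _ => ?_
  refine (norm_div_two_pi_pow_le _ _).trans (le_of_eq ?_)
  rw [norm_wightman_phase]
  ring_nf

theorem differentiableOn_wightman {n : ℕ} (hn : 1 ≤ n) {ν : ℝ} (hν : ν ∈ Ioo (0 : ℝ) 1)
    (f : ℝ) (x : EuclideanSpace ℝ (Fin n)) :
    DifferentiableOn ℂ (fun z => wightman n ν f z x) {z : ℂ | z.im < 0} := by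
  intro z₀ hz₀
  have hz₀' : z₀.im < 0 := hz₀
  -- Half the distance to the real axis: throughout the ball of radius `δ` the damping is at least
  -- `exp(-δω)`, which dominates the derivative.
  set δ : ℝ := -z₀.im / 2 with hδ
  have hδ0 : 0 < δ := by linarith
  have hball : ∀ z ∈ Metric.ball z₀ δ, z.im < -δ := by
    intro z hz
    have h1 : |(z - z₀).im| < δ :=
      (Complex.abs_im_le_norm _).trans_lt (mem_ball_iff_norm.1 hz)
    have h2 := (abs_lt.1 h1).2
    rw [Complex.sub_im] at h2
    linarith
  have hbound : Integrable fun p : Mink n => ‖(wightmanDensity n ν f p : ℂ) *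
      ((p.1 * Real.exp (-(δ * p.1)) : ℝ) : ℂ)‖ := by
    refine (integrable_wightmanDensity_mul_exp hn hν f (Continuous.measurable (by fun_prop))
      hδ0 1 zero_le_one fun p hp => ?_).norm
    have hp0 : 0 ≤ p.1 := (norm_nonneg _).trans hp.le
    rw [Complex.norm_real, Real.norm_of_nonneg (by positivity), one_mul, pow_one]
    gcongr
    linarith
  have hderiv := hasDerivAt_integral_of_dominated_loc_of_deriv_le
    (μ := (volume : Measure (Mink n))) (F := fun z p => wightmanIntegrand n ν f z x p)
    (F' := fun z p => wightmanIntegrand n ν f z x p * (-(Complex.I * p.1)))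
    (x₀ := z₀) (Metric.ball_mem_nhds z₀ hδ0) (bound := fun p : Mink n =>
      ‖(wightmanDensity n ν f p : ℂ) * ((p.1 * Real.exp (-(δ * p.1)) : ℝ) : ℂ)‖)
    ?_ (integrable_wightmanIntegrand hn hν f hz₀ x) ?_ ?_ hbound ?_
  · exact hderiv.2.differentiableAt.differentiableWithinAt
  · filter_upwards [(isOpen_lt Complex.continuous_im continuous_const).mem_nhds hz₀] with z hz
    exact (integrable_wightmanIntegrand hn hν f hz x).aestronglyMeasurable
  · exact (integrable_wightmanIntegrand hn hν f hz₀ x).aestronglyMeasurable.mul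
      (Continuous.aestronglyMeasurable (by fun_prop))
  · refine .of_forall fun p z hz => ?_
    rw [wightmanIntegrand_eq]
    by_cases hp : ‖p.2‖ < p.1
    · have hp0 : 0 < p.1 := (norm_nonneg _).trans_lt hp
      rw [mul_assoc, norm_mul (wightmanDensity n ν f p : ℂ), norm_mul (wightmanDensity n ν f p : ℂ)]
      refine mul_le_mul_of_nonneg_left ?_ (norm_nonneg _)
      rw [norm_mul, Complex.norm_real, Real.norm_of_nonneg (by positivity), norm_neg, norm_mul,
        Complex.norm_I, one_mul, Complex.norm_real, Real.norm_of_nonneg hp0.le, mul_comm]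
      refine mul_le_mul_of_nonneg_left ((norm_div_two_pi_pow_le _ _).trans ?_) hp0.le
      rw [norm_wightman_phase, Real.exp_le_exp]
      nlinarith [hball z hz]
    · simp [wightmanDensity_eq_ite, hp]
  · refine .of_forall fun p z _ => ?_
    have h1 : HasDerivAt (fun z : ℂ => Complex.I * ((⟪p.2, x⟫ : ℝ) : ℂ) - Complex.I * (p.1 : ℂ) * z)
        (-(Complex.I * p.1)) z := by
      simpa using ((hasDerivAt_id z).const_mul (Complex.I * (p.1 : ℂ))).const_sub
        (Complex.I * ((⟪p.2, x⟫ : ℝ) : ℂ))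
    have h2 := (h1.cexp.mul_const (wightmanDensity n ν f p : ℂ)).div_const ((2 * π : ℂ) ^ (n + 1))
    refine h2.congr_deriv ?_
    unfold wightmanIntegrand
    ring

/-- The integrand of the Wightman function at Euclidean time, in mass-shell coordinates. -/
theorem euclidean_shell_fubini {n : ℕ} (hn : 1 ≤ n) {ν : ℝ} (hν : ν ∈ Ioo (0 : ℝ) 1)
    {f : ℝ} (hf : 0 ≤ f) {τ : ℝ} (hτ : τ ≠ 0) (x : EuclideanSpace ℝ (Fin n)) :
    Integrable (fun k : EuclideanSpace ℝ (Fin n) =>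
      Complex.exp (Complex.I * ((⟪k, x⟫ : ℝ) : ℂ)) * schwingerMode n ν f τ k / (2 * π) ^ n) ∧
    schwinger n ν f τ x = wightman n ν f (-(Complex.I * ((|τ| : ℝ) : ℂ))) x := by
  have hτ' : 0 < |τ| := abs_pos.2 hτ
  have him : (-(Complex.I * ((|τ| : ℝ) : ℂ))).im < 0 := by simpa using hτ
  set G : Mink n → ℂ := fun p => Complex.exp (Complex.I * ((⟪p.2, x⟫ : ℝ) : ℂ)
    - Complex.I * (p.1 : ℂ) * (-(Complex.I * ((|τ| : ℝ) : ℂ)))) / (2 * π) ^ (n + 1) with hG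
  have hGm : Measurable G := Continuous.measurable (by fun_prop)
  have hi := integrable_wightmanIntegrand hn hν f him x
  rw [wightmanIntegrand_eq, integrable_wightmanDensity_mul_iff hGm, IntegrableOn, shellDomain,
    Measure.volume_eq_prod, ← Measure.prod_restrict, Measure.restrict_univ] at hi
  -- At `z = -i|τ|` the phase on the shell is `exp(-E|τ|)`, so the fibre integral over `q` is the
  -- spectral form of the Schwinger mode.
  have hfib : ∀ᵐ k : EuclideanSpace ℝ (Fin n), (∫ q in Ioi (0 : ℝ),
      ((spectralDensity n ν f (q ^ 2) * shellJacobian (k, q) : ℝ) : ℂ) * G (shell (k, q)))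
      = Complex.exp (Complex.I * ((⟪k, x⟫ : ℝ) : ℂ)) * schwingerMode n ν f τ k / (2 * π) ^ n := by
    have : Nonempty (Fin n) := ⟨⟨0, hn⟩⟩
    have h : ∀ᵐ k : EuclideanSpace ℝ (Fin n), k ≠ 0 := by simp [ae_iff]
    filter_upwards [h] with k hk
    have hπ : (π : ℂ) ≠ 0 := by exact_mod_cast pi_ne_zero
    rw [schwingerMode_eq hn hν hf hτ hk, ← integral_const_mul, ← integral_const_mul,
      ← integral_div]
    congr 1
    ext q
    have hph : Complex.exp (Complex.I * ((⟪k, x⟫ : ℝ) : ℂ)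
        - Complex.I * (energy k q : ℂ) * (-(Complex.I * ((|τ| : ℝ) : ℂ))))
        = Complex.exp (Complex.I * ((⟪k, x⟫ : ℝ) : ℂ)) * (Real.exp (-(energy k q * |τ|)) : ℂ) := by
      rw [Complex.ofReal_exp, ← Complex.exp_add]
      congr 1
      push_cast
      linear_combination (energy k q : ℂ) * ((|τ| : ℝ) : ℂ) * Complex.I_sq
    simp only [hG, shell, hph, shellJacobian]
    push_cast
    field_simp
    rw [pow_succ]
    ring
  refine ⟨hi.integral_prod_left.congr hfib, ?_⟩
  rw [schwinger, wightman, wightmanIntegrand_eq, integral_wightmanDensity_mul hGm, shellDomain,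
    Measure.volume_eq_prod, ← Measure.prod_restrict, Measure.restrict_univ, integral_prod _ hi]
  exact (integral_congr_ae hfib).symm

theorem integrable_schwingerMode {n : ℕ} (hn : 1 ≤ n) {ν : ℝ} (hν : ν ∈ Ioo (0 : ℝ) 1)
    {f : ℝ} (hf : 0 ≤ f) {τ : ℝ} (hτ : τ ≠ 0) : Integrable (schwingerMode n ν f τ) := by
  have h := ((euclidean_shell_fubini hn hν hf hτ 0).1).mul_const ((2 * π : ℂ) ^ n)
  refine h.congr (.of_forall fun k => ?_)
  have hπ : (2 * π : ℂ) ^ n ≠ 0 := pow_ne_zero _ (mul_ne_zero two_ne_zero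
    (by exact_mod_cast pi_ne_zero))
  simp [div_mul_cancel₀ _ hπ]

/-! ### The Minkowski Fourier transform on Schwartz functions -/

instance instIsAddHaarMeasureMink (n : ℕ) : (volume : Measure (Mink n)).IsAddHaarMeasure :=
  Measure.prod.instIsAddHaarMeasure volume volume

theorem continuous_minkProd {n : ℕ} :
    Continuous fun y : Mink n × Mink n => minkProd y.1 y.2 := by
  unfold minkProd
  fun_prop

theorem norm_exp_I_mul (r : ℝ) : ‖Complex.exp (Complex.I * (r : ℂ))‖ = 1 := by
  rw [mul_comm, Complex.norm_exp_ofReal_mul_I]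

/-- Minkowski space with its Euclidean inner product. -/
abbrev EMink (n : ℕ) : Type := WithLp 2 (ℝ × EuclideanSpace ℝ (Fin n))

/-- The identification of Minkowski space with a Euclidean space. -/
noncomputable def toEMink (n : ℕ) : Mink n ≃L[ℝ] EMink n :=
  (WithLp.prodContinuousLinearEquiv 2 ℝ ℝ (EuclideanSpace ℝ (Fin n))).symm

/-- Reflection of the spatial momentum. -/
noncomputable def reflectMink (n : ℕ) : Mink n ≃L[ℝ] Mink n :=
  (ContinuousLinearEquiv.refl ℝ ℝ).prodCongr (ContinuousLinearEquiv.neg ℝ)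

/-- The Euclidean frequency `(ω, -k) / 2π` of a momentum `(ω, k)`. -/
noncomputable def toFrequency (n : ℕ) : Mink n ≃L[ℝ] EMink n :=
  ((reflectMink n).trans (ContinuousLinearEquiv.smulLeft
    (Units.mk0 ((2 * π)⁻¹ : ℝ) (inv_ne_zero (by positivity))))).trans (toEMink n)

/-- The spatial reflection in `toFrequency` turns the Euclidean phase `-2π⟨x, ξ⟩` into `-ωt + k·x`,
so properties of the Euclidean Fourier transform carry over. -/
theorem two_pi_inner_toFrequency {n : ℕ} (x p : Mink n) :
    -2 * π * ⟪toEMink n x, toFrequency n p⟫ = minkProd p x := by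
  have h : ⟪toEMink n x, toFrequency n p⟫
      = ⟪x.1, (2 * π)⁻¹ • p.1⟫ + ⟪x.2, (2 * π)⁻¹ • -p.2⟫ := rfl
  rw [h, inner_smul_right, inner_smul_right, inner_neg_right, minkProd, real_inner_comm p.2]
  simp only [RCLike.inner_apply, conj_trivial]
  have := pi_ne_zero
  field_simp
  ring

theorem measurePreserving_toEMink (n : ℕ) :
    MeasurePreserving (toEMink n) volume volume :=
  WithLp.volume_preserving_toLp ℝ (EuclideanSpace ℝ (Fin n))

theorem measurePreserving_reflectMink (n : ℕ) :
    MeasurePreserving (reflectMink n) volume volume :=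
  (MeasurePreserving.id (volume : Measure ℝ)).prod
    (Measure.measurePreserving_neg (volume : Measure (EuclideanSpace ℝ (Fin n))))

theorem measurableEmbedding_toEMink (n : ℕ) : MeasurableEmbedding (toEMink n) :=
  (toEMink n).toHomeomorph.measurableEmbedding

theorem measurableEmbedding_reflectMink (n : ℕ) : MeasurableEmbedding (reflectMink n) :=
  (reflectMink n).toHomeomorph.measurableEmbedding

theorem finrank_mink (n : ℕ) : Module.finrank ℝ (Mink n) = n + 1 := by
  rw [Module.finrank_prod, Module.finrank_self, finrank_euclideanSpace_fin, add_comm]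

theorem integral_eMink {n : ℕ} (g : EMink n → ℂ) :
    ∫ v, g v = (∫ p, g (toFrequency n p)) / (2 * π) ^ (n + 1) := by
  have h1 : ∫ p, g (toFrequency n p) = ∫ p : Mink n, g (toEMink n ((2 * π)⁻¹ • p)) :=
    (measurePreserving_reflectMink n).integral_comp (measurableEmbedding_reflectMink n)
      (fun p => g (toEMink n ((2 * π)⁻¹ • p)))
  rw [h1, Measure.integral_comp_smul volume (fun p : Mink n => g (toEMink n p)), finrank_mink,
    (measurePreserving_toEMink n).integral_comp (measurableEmbedding_toEMink n),
    inv_pow, inv_inv, abs_of_pos (by positivity), Complex.real_smul]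
  have : (2 * π : ℂ) ^ (n + 1) ≠ 0 := pow_ne_zero _ (mul_ne_zero two_ne_zero
    (by exact_mod_cast pi_ne_zero))
  push_cast
  field_simp

open FourierTransform

/-- The Minkowski Fourier transform on Schwartz functions. -/
noncomputable def minkFourierCLM (n : ℕ) : 𝓢(Mink n, ℂ) →L[ℂ] 𝓢(Mink n, ℂ) :=
  (SchwartzMap.compCLMOfContinuousLinearEquiv ℂ (toFrequency n)).comp
    ((SchwartzMap.fourierTransformCLM ℂ).comp
      (SchwartzMap.compCLMOfContinuousLinearEquiv ℂ (toEMink n).symm))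

theorem minkFourierCLM_apply {n : ℕ} (h : 𝓢(Mink n, ℂ)) (p : Mink n) :
    minkFourierCLM n h p = minkFourier h p := by
  have h1 : minkFourierCLM n h p = 𝓕 (fun v => h ((toEMink n).symm v)) (toFrequency n p) := rfl
  rw [h1, Real.fourier_eq', minkFourier,
    ← (measurePreserving_toEMink n).integral_comp (measurableEmbedding_toEMink n)]
  simp only [two_pi_inner_toFrequency, ContinuousLinearEquiv.symm_apply_apply, smul_eq_mul,
    mul_comm Complex.I]

/-- The inverse of the Minkowski Fourier transform on Schwartz functions. -/
noncomputable def minkFourierInvCLM (n : ℕ) : 𝓢(Mink n, ℂ) →L[ℂ] 𝓢(Mink n, ℂ) :=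
  (SchwartzMap.compCLMOfContinuousLinearEquiv ℂ (toEMink n)).comp
    ((FourierTransform.fourierInvCLM ℂ 𝓢(EMink n, ℂ)).comp
      (SchwartzMap.compCLMOfContinuousLinearEquiv ℂ (toFrequency n).symm))

theorem minkFourierInvCLM_apply {n : ℕ} (Φ : 𝓢(Mink n, ℂ)) (x : Mink n) :
    minkFourierInvCLM n Φ x
      = (∫ p, Complex.exp (-(Complex.I * (minkProd p x : ℂ))) * Φ p) / (2 * π) ^ (n + 1) := by
  have h1 : minkFourierInvCLM n Φ x
      = (𝓕⁻ (SchwartzMap.compCLMOfContinuousLinearEquiv ℂ (toFrequency n).symm Φ) :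
          𝓢(EMink n, ℂ)) (toEMink n x) := rfl
  rw [h1, SchwartzMap.fourierInv_coe, Real.fourierInv_eq', integral_eMink]
  congr 2
  ext p
  simp only [SchwartzMap.compCLMOfContinuousLinearEquiv_apply, Function.comp_apply,
    ContinuousLinearEquiv.symm_apply_apply, smul_eq_mul]
  rw [real_inner_comm, show 2 * π * ⟪toEMink n x, toFrequency n p⟫ = -minkProd p x by
    rw [← two_pi_inner_toFrequency]; ring]
  congr 2
  push_cast
  ring

theorem minkFourier_minkFourierInvCLM {n : ℕ} (Φ : 𝓢(Mink n, ℂ)) (p : Mink n) :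
    minkFourier (minkFourierInvCLM n Φ) p = Φ p := by
  have h1 : minkFourierCLM n (minkFourierInvCLM n Φ) p
      = (𝓕 (SchwartzMap.compCLMOfContinuousLinearEquiv ℂ (toEMink n).symm
          (minkFourierInvCLM n Φ)) : 𝓢(EMink n, ℂ)) (toFrequency n p) := rfl
  have h2 : SchwartzMap.compCLMOfContinuousLinearEquiv ℂ (toEMink n).symm
      (minkFourierInvCLM n Φ)
      = (𝓕⁻ (SchwartzMap.compCLMOfContinuousLinearEquiv ℂ (toFrequency n).symm Φ) :
          𝓢(EMink n, ℂ)) := by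
    ext v
    simp only [SchwartzMap.compCLMOfContinuousLinearEquiv_apply, Function.comp_apply]
    change (𝓕⁻ (SchwartzMap.compCLMOfContinuousLinearEquiv ℂ (toFrequency n).symm Φ) :
          𝓢(EMink n, ℂ)) (toEMink n ((toEMink n).symm v)) = _
    rw [ContinuousLinearEquiv.apply_symm_apply]
  rw [← minkFourierCLM_apply, h1, h2, fourier_fourierInv_eq,
    SchwartzMap.compCLMOfContinuousLinearEquiv_apply, Function.comp_apply,
    ContinuousLinearEquiv.symm_apply_apply]

/-! ### The boundary Wightman distribution -/

theorem wightmanReg_eq (n : ℕ) (ν f ε : ℝ) (x : Mink n) :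
    wightmanReg n ν f ε x = ∫ p : Mink n, Complex.exp (Complex.I * (minkProd p x : ℂ)) *
      ((wightmanDensity n ν f p : ℂ) * ((Real.exp (-(ε * p.1)) : ℂ) / (2 * π) ^ (n + 1))) := by
  unfold wightmanReg wightman wightmanIntegrand
  congr 1
  ext p
  have : Complex.exp (Complex.I * ((⟪p.2, x.2⟫ : ℝ) : ℂ)
      - Complex.I * (p.1 : ℂ) * ((x.1 : ℂ) - Complex.I * (ε : ℂ)))
      = Complex.exp (Complex.I * (minkProd p x : ℂ)) * (Real.exp (-(ε * p.1)) : ℂ) := by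
    rw [Complex.ofReal_exp, ← Complex.exp_add, minkProd]
    congr 1
    push_cast
    linear_combination (p.1 : ℂ) * ε * Complex.I_sq
  rw [this]
  ring

theorem integrable_wightmanDensity_damped {n : ℕ} (hn : 1 ≤ n) {ν : ℝ} (hν : ν ∈ Ioo (0 : ℝ) 1)
    (f : ℝ) {ε : ℝ} (hε : 0 < ε) :
    Integrable fun p : Mink n => (wightmanDensity n ν f p : ℂ) *
      ((Real.exp (-(ε * p.1)) : ℂ) / (2 * π) ^ (n + 1)) := by
  refine integrable_wightmanDensity_mul_exp hn hν f (Continuous.measurable (by fun_prop)) hε 0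
    zero_le_one fun p _ => (norm_div_two_pi_pow_le _ _).trans (le_of_eq ?_)
  rw [Complex.norm_real, Real.norm_of_nonneg (Real.exp_pos _).le, pow_zero, one_mul, one_mul]

/-- The measure on momentum space with density the Fourier transform of the Wightman function. -/
noncomputable def wightmanMeasure (n : ℕ) (ν f : ℝ) : Measure (Mink n) :=
  volume.withDensity fun p => ENNReal.ofReal (wightmanDensity n ν f p)

theorem integrable_wightmanMeasure_iff {n : ℕ} (hn : 1 ≤ n) {ν : ℝ} (hν : ν ∈ Ioo (0 : ℝ) 1)
    (f : ℝ) (g : Mink n → ℂ) :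
    Integrable g (wightmanMeasure n ν f)
      ↔ Integrable fun p => (wightmanDensity n ν f p : ℂ) * g p := by
  rw [wightmanMeasure, integrable_withDensity_iff_integrable_smul'
    (measurable_wightmanDensity n ν f).ennreal_ofReal (by simp)]
  simp only [ENNReal.toReal_ofReal (wightmanDensity_nonneg hn hν f _), Complex.real_smul]

theorem integral_wightmanMeasure {n : ℕ} (hn : 1 ≤ n) {ν : ℝ} (hν : ν ∈ Ioo (0 : ℝ) 1)
    (f : ℝ) (g : Mink n → ℂ) :
    ∫ p, g p ∂(wightmanMeasure n ν f) = ∫ p, (wightmanDensity n ν f p : ℂ) * g p := by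
  rw [wightmanMeasure, integral_withDensity_eq_integral_toReal_smul
    (measurable_wightmanDensity n ν f).ennreal_ofReal (by simp)]
  simp only [ENNReal.toReal_ofReal (wightmanDensity_nonneg hn hν f _), Complex.real_smul]

/-- The norm of a product is the maximum, so on the cone decay in `ω` is decay in `p`. -/
theorem norm_eq_of_mem_cone {n : ℕ} {p : Mink n} (hp : ‖p.2‖ < p.1) : ‖p‖ = p.1 := by
  have h0 : 0 ≤ p.1 := (norm_nonneg _).trans hp.le
  rw [Prod.norm_def, Real.norm_of_nonneg h0, max_eq_left hp.le]

theorem hasTemperateGrowth_wightmanMeasure {n : ℕ} (hn : 1 ≤ n) {ν : ℝ}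
    (hν : ν ∈ Ioo (0 : ℝ) 1) (f : ℝ) : (wightmanMeasure n ν f).HasTemperateGrowth := by
  refine ⟨n + 3, ?_⟩
  have h : Integrable (fun p : Mink n => (((1 + ‖p‖) ^ (-((n + 3 : ℕ) : ℝ)) : ℝ) : ℂ))
      (wightmanMeasure n ν f) := by
    rw [integrable_wightmanMeasure_iff hn hν]
    refine integrable_wightmanDensity_mul hn hν f (by fun_prop) 1 fun p hp => ?_
    have h0 : 0 ≤ p.1 := (norm_nonneg _).trans hp.le
    rw [norm_eq_of_mem_cone hp, Complex.norm_real, Real.norm_of_nonneg (by positivity), one_mul,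
      Real.rpow_neg (by positivity), Real.rpow_natCast]
  have h2 := h.re
  simpa using h2

theorem integrable_wightmanDensity_mul_schwartz {n : ℕ} (hn : 1 ≤ n) {ν : ℝ}
    (hν : ν ∈ Ioo (0 : ℝ) 1) (f : ℝ) (g : 𝓢(Mink n, ℂ)) :
    Integrable fun p : Mink n => (wightmanDensity n ν f p : ℂ) * g p := by
  have := hasTemperateGrowth_wightmanMeasure hn hν f
  exact (integrable_wightmanMeasure_iff hn hν f g).1 g.integrable

/-- The Fourier transform of the boundary Wightman distribution. -/
noncomputable def wightmanCLM (n : ℕ) (ν f : ℝ) [(wightmanMeasure n ν f).HasTemperateGrowth] :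
    𝓢(Mink n, ℂ) →L[ℂ] ℂ :=
  ((2 * π : ℂ) ^ (n + 1))⁻¹ • SchwartzMap.integralCLM ℂ (wightmanMeasure n ν f)

theorem wightmanCLM_apply {n : ℕ} (hn : 1 ≤ n) {ν : ℝ} (hν : ν ∈ Ioo (0 : ℝ) 1) (f : ℝ)
    [(wightmanMeasure n ν f).HasTemperateGrowth] (g : 𝓢(Mink n, ℂ)) :
    wightmanCLM n ν f g
      = ∫ p, (wightmanDensity n ν f p : ℂ) * g p / (2 * π) ^ (n + 1) := by
  have h : wightmanCLM n ν f g
      = ((2 * π : ℂ) ^ (n + 1))⁻¹ • ∫ p, g p ∂(wightmanMeasure n ν f) := rfl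
  rw [h, integral_wightmanMeasure hn hν, integral_div, smul_eq_mul, div_eq_inv_mul]

theorem integral_wightmanReg_mul {n : ℕ} (hn : 1 ≤ n) {ν : ℝ} (hν : ν ∈ Ioo (0 : ℝ) 1) (f : ℝ)
    {ε : ℝ} (hε : 0 < ε) {h : Mink n → ℂ} (hh : Integrable h) :
    ∫ x, wightmanReg n ν f ε x * h x = ∫ p, (wightmanDensity n ν f p : ℂ) *
      ((Real.exp (-(ε * p.1)) : ℂ) / (2 * π) ^ (n + 1)) * minkFourier h p := by
  have hint : Integrable (Function.uncurry fun x p : Mink n =>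
      Complex.exp (Complex.I * (minkProd p x : ℂ)) *
      (h x * ((wightmanDensity n ν f p : ℂ) *
        ((Real.exp (-(ε * p.1)) : ℂ) / (2 * π) ^ (n + 1))))) (volume.prod volume) := by
    refine (hh.mul_prod (integrable_wightmanDensity_damped hn hν f hε)).bdd_mul (c := 1)
      ?_ (.of_forall fun y => (norm_exp_I_mul _).le)
    refine Continuous.aestronglyMeasurable (Complex.continuous_exp.comp
      (continuous_const.mul (Complex.continuous_ofReal.comp ?_)))
    exact continuous_minkProd.comp continuous_swap
  calc _ = ∫ x, ∫ p, Complex.exp (Complex.I * (minkProd p x : ℂ)) *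
      (h x * ((wightmanDensity n ν f p : ℂ) *
        ((Real.exp (-(ε * p.1)) : ℂ) / (2 * π) ^ (n + 1)))) := by
        congr 1
        ext x
        rw [wightmanReg_eq, ← integral_mul_const]
        congr 1
        ext p
        ring
    _ = _ := by
        rw [integral_integral_swap hint]
        congr 1
        ext p
        rw [minkFourier, ← integral_const_mul]
        congr 1
        ext x
        ring

/-- On the support of the density `ω ≥ 0`, so the damping factor is at most `1` and the integrand at
`ε = 0` dominates. -/
theorem tendsto_integral_wightmanReg {n : ℕ} (hn : 1 ≤ n) {ν : ℝ} (hν : ν ∈ Ioo (0 : ℝ) 1)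
    (f : ℝ) {h : Mink n → ℂ} (hh : Integrable h)
    (hi : Integrable fun p => (wightmanDensity n ν f p : ℂ) * minkFourier h p) :
    Tendsto (fun ε : ℝ => ∫ x : Mink n, wightmanReg n ν f ε x * h x) (𝓝[>] 0)
      (𝓝 (∫ p, (wightmanDensity n ν f p : ℂ) * minkFourier h p / (2 * π) ^ (n + 1))) := by
  have key : Tendsto (fun ε : ℝ => ∫ p, (Real.exp (-(ε * p.1)) : ℂ) *
      ((wightmanDensity n ν f p : ℂ) * minkFourier h p / (2 * π) ^ (n + 1))) (𝓝[>] 0)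
      (𝓝 (∫ p, (wightmanDensity n ν f p : ℂ) * minkFourier h p / (2 * π) ^ (n + 1))) := by
    refine tendsto_integral_filter_of_dominated_convergence
      (fun p => ‖(wightmanDensity n ν f p : ℂ) * minkFourier h p / (2 * π) ^ (n + 1)‖)
      ?_ ?_ (hi.div_const _).norm ?_
    · exact .of_forall fun ε => Continuous.aestronglyMeasurable (by fun_prop) |>.mul
        (hi.div_const _).aestronglyMeasurable
    · filter_upwards [self_mem_nhdsWithin] with ε hε
      have hε' : 0 < ε := hε
      refine .of_forall fun p => ?_
      by_cases hp : ‖p.2‖ < p.1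
      · have h0 : 0 ≤ p.1 := (norm_nonneg _).trans hp.le
        rw [norm_mul, Complex.norm_real, Real.norm_of_nonneg (Real.exp_pos _).le]
        refine mul_le_of_le_one_left (norm_nonneg _) (Real.exp_le_one_iff.2 ?_)
        nlinarith
      · simp [wightmanDensity_eq_ite, hp]
    · refine .of_forall fun p => ?_
      have : Tendsto (fun ε : ℝ => (Real.exp (-(ε * p.1)) : ℂ)) (𝓝[>] 0) (𝓝 1) := by
        have hc : Continuous fun ε : ℝ => (Real.exp (-(ε * p.1)) : ℂ) := by fun_prop
        simpa using (hc.tendsto 0).mono_left nhdsWithin_le_nhds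
      simpa using this.mul_const _
  refine key.congr' ?_
  filter_upwards [self_mem_nhdsWithin] with ε hε
  rw [integral_wightmanReg_mul hn hν f hε hh]
  congr 1
  ext p
  ring

theorem isClosed_closedCone (n : ℕ) : IsClosed {p : Mink n | ‖p.2‖ ≤ p.1} :=
  isClosed_le (by fun_prop) (by fun_prop)

/-- The density vanishes off the closed cone and is strictly positive on the open one, which is
dense in it; a nonnegative bump inside the open cone therefore pairs to a nonzero number. -/
theorem dsupport_eq_closedCone {n : ℕ} (hn : 1 ≤ n) {ν : ℝ} (hν : ν ∈ Ioo (0 : ℝ) 1) (f : ℝ)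
    {That : 𝓢'(Mink n, ℂ)} (hT : ∀ g : 𝓢(Mink n, ℂ), That g
      = ∫ p : Mink n, (wightmanDensity n ν f p : ℂ) * g p / (2 * π) ^ (n + 1)) :
    Distribution.dsupport That = {p : Mink n | ‖p.2‖ ≤ p.1} := by
  refine Subset.antisymm (fun p hp => ?_) fun p hp => ?_
  · rw [Distribution.mem_dsupport_iff] at hp
    refine hp _ (fun g hg => ?_) (isClosed_closedCone n)
    rw [hT]
    refine integral_eq_zero_of_ae (.of_forall fun p => ?_)
    by_cases h : ‖p.2‖ < p.1
    · have : g p = 0 := by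
        by_contra hc
        exact hg (subset_tsupport _ hc) h.le
      simp [this]
    · simp [wightmanDensity_eq_ite, h]
  · rw [Distribution.mem_dsupport_iff_forall_exists_ne]
    intro s hps hs
    have hp' : ‖p.2‖ ≤ p.1 := hp
    -- Raising the frequency slightly moves a boundary point of the cone into its interior without
    -- leaving `s`.
    obtain ⟨δ, hδ, hδs⟩ : ∃ δ : ℝ, 0 < δ ∧ ((p.1 + δ, p.2) : Mink n) ∈ s := by
      have hc : Tendsto (fun δ : ℝ => ((p.1 + δ, p.2) : Mink n)) (𝓝[>] 0) (𝓝 p) := by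
        have : Continuous fun δ : ℝ => ((p.1 + δ, p.2) : Mink n) := by fun_prop
        have h2 := this.tendsto 0
        rw [add_zero] at h2
        exact h2.mono_left nhdsWithin_le_nhds
      obtain ⟨δ, h1, h2⟩ := ((hc.eventually (hs.mem_nhds hps)).and self_mem_nhdsWithin).exists
      exact ⟨δ, h2, h1⟩
    set p₀ : Mink n := (p.1 + δ, p.2)
    have hU : IsOpen (s ∩ {p : Mink n | ‖p.2‖ < p.1}) := hs.inter (isOpen_cone n)
    have hp₀ : p₀ ∈ s ∩ {p : Mink n | ‖p.2‖ < p.1} :=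
      ⟨hδs, show ‖p.2‖ < p.1 + δ by linarith⟩
    obtain ⟨r, hr, hball⟩ := Metric.isOpen_iff.1 hU p₀ hp₀
    let b : ContDiffBump p₀ := ⟨r / 3, r / 2, by positivity, by linarith⟩
    have hbs : tsupport (fun p => ((b p : ℝ) : ℂ)) ⊆ s ∩ {p : Mink n | ‖p.2‖ < p.1} := by
      have h1 : tsupport (fun p => ((b p : ℝ) : ℂ)) ⊆ tsupport b :=
        closure_mono fun p hp hc => hp (by simp [hc])
      refine (h1.trans ?_).trans hball
      rw [b.tsupport_eq]
      exact Metric.closedBall_subset_ball (show r / 2 < r by linarith)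
    have hbc : HasCompactSupport fun p => ((b p : ℝ) : ℂ) :=
      b.hasCompactSupport.comp_left Complex.ofReal_zero
    have hbd : ContDiff ℝ ∞ fun p => ((b p : ℝ) : ℂ) :=
      Complex.ofRealCLM.contDiff.comp b.contDiff
    refine ⟨hbc.toSchwartzMap hbd, fun p hp => (hbs hp).1, ?_⟩
    rw [hT]
    have hi := integrable_wightmanDensity_mul_schwartz hn hν f (hbc.toSchwartzMap hbd)
    have hir : Integrable fun p : Mink n => wightmanDensity n ν f p * b p := by
      have := hi.re
      refine this.congr (.of_forall fun p => ?_)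
      change ((wightmanDensity n ν f p : ℂ) * ((b p : ℝ) : ℂ)).re = _
      rw [← Complex.ofReal_mul, Complex.ofReal_re]
    have hpos : 0 < ∫ p, wightmanDensity n ν f p * b p := by
      rw [integral_pos_iff_support_of_nonneg
        (fun p => mul_nonneg (wightmanDensity_nonneg hn hν f p) b.nonneg) hir]
      refine (Metric.measure_ball_pos volume p₀ (show 0 < r / 2 by positivity)).trans_le
        (measure_mono fun p hp => ?_)
      have hcone : ‖p.2‖ < p.1 := (hball (Metric.ball_subset_ball (by linarith) hp)).2
      refine mul_ne_zero ?_ (b.pos_of_mem_ball hp).ne'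
      rw [wightmanDensity_eq_ite, if_pos hcone]
      exact (spectralDensity_pos hn hν f (negSq_pos hcone)).ne'
    have heq : ∫ p : Mink n, (wightmanDensity n ν f p : ℂ) * (hbc.toSchwartzMap hbd) p
        / (2 * π) ^ (n + 1) = ((∫ p, wightmanDensity n ν f p * b p : ℝ) : ℂ)
          / (2 * π) ^ (n + 1) := by
      rw [integral_div, ← integral_complex_ofReal]
      congr 2
      ext p
      rw [Complex.ofReal_mul]
      rfl
    rw [heq]
    refine div_ne_zero (by exact_mod_cast hpos.ne') (pow_ne_zero _ (mul_ne_zero two_ne_zero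
      (by exact_mod_cast pi_ne_zero)))

theorem exists_wightman_distribution {n : ℕ} (hn : 1 ≤ n) {ν : ℝ} (hν : ν ∈ Ioo (0 : ℝ) 1)
    (f : ℝ) :
    ∃ T That : 𝓢'(Mink n, ℂ),
      (∀ h : 𝓢(Mink n, ℂ),
        Tendsto (fun ε : ℝ => ∫ x : Mink n, wightmanReg n ν f ε x * h x) (𝓝[>] 0) (𝓝 (T h))) ∧
      (∀ h : 𝓢(Mink n, ℂ),
        Integrable (fun p : Mink n => (wightmanDensity n ν f p : ℂ) * minkFourier h p) ∧
        T h = ∫ p : Mink n,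
          (wightmanDensity n ν f p : ℂ) * minkFourier h p / (2 * π) ^ (n + 1)) ∧
      (∀ g : 𝓢(Mink n, ℂ),
        Integrable (fun p : Mink n => (wightmanDensity n ν f p : ℂ) * g p) ∧
        That g = ∫ p : Mink n, (wightmanDensity n ν f p : ℂ) * g p / (2 * π) ^ (n + 1)) ∧
      Distribution.dsupport That = {p : Mink n | ‖p.2‖ ≤ p.1} := by
  have := hasTemperateGrowth_wightmanMeasure hn hν f
  let T : 𝓢'(Mink n, ℂ) := ContinuousLinearMap.toPointwiseConvergenceCLM ℂ (RingHom.id ℂ) _ _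
    ((wightmanCLM n ν f).comp (minkFourierCLM n))
  let That : 𝓢'(Mink n, ℂ) := ContinuousLinearMap.toPointwiseConvergenceCLM ℂ (RingHom.id ℂ) _ _
    (wightmanCLM n ν f)
  have hT : ∀ h : 𝓢(Mink n, ℂ), T h = ∫ p : Mink n,
      (wightmanDensity n ν f p : ℂ) * minkFourier h p / (2 * π) ^ (n + 1) := by
    intro h
    have h1 : T h = wightmanCLM n ν f (minkFourierCLM n h) := rfl
    rw [h1, wightmanCLM_apply hn hν]
    simp only [minkFourierCLM_apply]
  have hThat : ∀ g : 𝓢(Mink n, ℂ), That g = ∫ p : Mink n,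
      (wightmanDensity n ν f p : ℂ) * g p / (2 * π) ^ (n + 1) :=
    fun g => wightmanCLM_apply hn hν f g
  have hi : ∀ h : 𝓢(Mink n, ℂ),
      Integrable (fun p : Mink n => (wightmanDensity n ν f p : ℂ) * minkFourier h p) := by
    intro h
    have := integrable_wightmanDensity_mul_schwartz hn hν f (minkFourierCLM n h)
    simpa only [minkFourierCLM_apply] using this
  have := instIsAddHaarMeasureMink n
  refine ⟨T, That, fun h => ?_, fun h => ⟨hi h, hT h⟩, fun g =>
    ⟨integrable_wightmanDensity_mul_schwartz hn hν f g, hThat g⟩,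
    dsupport_eq_closedCone hn hν f hThat⟩
  rw [hT]
  exact tendsto_integral_wightmanReg hn hν f h.integrable (hi h)

/-! ### Bessel functions -/

/-- The Taylor coefficients of `besselEntire` in powers of `s / 4`. -/
noncomputable def besselCoeff (μ : ℝ) (m : ℕ) : ℝ :=
  (-1) ^ m / ((m.factorial : ℝ) * Real.Gamma (m + μ + 1))

theorem besselEntire_eq_tsum (μ s : ℝ) :
    besselEntire μ s = ∑' m : ℕ, besselCoeff μ m * (s / 4) ^ m := rfl

theorem Gamma_nat_add_pos {μ : ℝ} (hμ : -1 < μ) (m : ℕ) : 0 < Real.Gamma (m + μ + 1) := by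
  have : (0 : ℝ) ≤ m := Nat.cast_nonneg m
  exact Real.Gamma_pos_of_pos (by linarith)

/-- `Γ(m + μ + 1)` is nondecreasing in `m` from `m = 1` on. The step from `m = 0` multiplies by `μ +
1`, which is below `1` for `μ = -ν`, so the reciprocals at `m = 0` and `m = 1` are both put in `B`.
-/
theorem exists_besselCoeff_bound {μ : ℝ} (hμ : -1 < μ) :
    ∃ B : ℝ, 0 ≤ B ∧ ∀ m : ℕ, |besselCoeff μ m| ≤ B / m.factorial := by
  have h0 := Gamma_nat_add_pos hμ 0
  have h1 := Gamma_nat_add_pos hμ 1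
  refine ⟨(Real.Gamma ((0 : ℕ) + μ + 1))⁻¹ + (Real.Gamma ((1 : ℕ) + μ + 1))⁻¹, by positivity,
    fun m => ?_⟩
  have hstep : ∀ m : ℕ, Real.Gamma ((1 : ℕ) + μ + 1) ≤ Real.Gamma ((m + 1 : ℕ) + μ + 1) := by
    intro m
    induction m with
    | zero => simp
    | succ m ih =>
      refine ih.trans ?_
      have hp : (0 : ℝ) ≤ m := Nat.cast_nonneg m
      have hrec : Real.Gamma ((m + 1 + 1 : ℕ) + μ + 1)
          = ((m + 1 : ℕ) + μ + 1) * Real.Gamma ((m + 1 : ℕ) + μ + 1) := by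
        rw [← Real.Gamma_add_one (by push_cast; linarith)]
        congr 1
        push_cast
        ring
      rw [hrec]
      refine le_mul_of_one_le_left (Gamma_nat_add_pos hμ (m + 1)).le ?_
      push_cast
      linarith
  have hG := Gamma_nat_add_pos hμ m
  have hf : (0 : ℝ) < m.factorial := by exact_mod_cast m.factorial_pos
  rw [besselCoeff, abs_div, abs_pow, abs_neg, abs_one, one_pow, abs_of_pos (mul_pos hf hG),
    one_div, mul_inv, div_eq_mul_inv, mul_comm]
  gcongr
  cases m with
  | zero => exact le_add_of_nonneg_right (inv_nonneg.2 h1.le)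
  | succ m =>
    exact (inv_anti₀ h1 (hstep m)).trans (le_add_of_nonneg_left (inv_nonneg.2 h0.le))

theorem summable_besselEntire {μ : ℝ} (hμ : -1 < μ) (s : ℝ) :
    Summable fun m : ℕ => besselCoeff μ m * (s / 4) ^ m := by
  obtain ⟨B, -, hB⟩ := exists_besselCoeff_bound hμ
  refine Summable.of_norm_bounded ((Real.summable_pow_div_factorial |s / 4|).mul_left B) fun m => ?_
  rw [norm_mul, norm_pow, Real.norm_eq_abs, Real.norm_eq_abs]
  calc _ ≤ B / m.factorial * |s / 4| ^ m := by
        gcongr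
        exact hB m
    _ = _ := by ring

theorem besselCoeff_succ (μ : ℝ) (m : ℕ) :
    besselCoeff μ (m + 1) * (m + 1) = -besselCoeff (μ + 1) m := by
  have h1 : (m : ℝ) + 1 ≠ 0 := by positivity
  have h2 : ((m + 1 : ℕ) : ℝ) + μ + 1 = m + (μ + 1) + 1 := by
    push_cast
    ring
  rw [besselCoeff, besselCoeff, h2, Nat.factorial_succ, pow_succ]
  push_cast
  field_simp

theorem hasDerivAt_besselEntire {μ : ℝ} (hμ : -1 < μ) (s : ℝ) :
    HasDerivAt (besselEntire μ) (-(besselEntire (μ + 1) s / 4)) s := by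
  obtain ⟨B, hB0, hB⟩ := exists_besselCoeff_bound hμ
  set r : ℝ := |s| + 1 with hr
  have hr0 : 0 < r := by positivity
  set g : ℕ → ℝ → ℝ := fun m s => besselCoeff μ m * (s / 4) ^ m
  set g' : ℕ → ℝ → ℝ := fun m s => besselCoeff μ m * (m * (s / 4) ^ (m - 1) * (1 / 4))
  set u : ℕ → ℝ := fun m => B / m.factorial * (m * (r / 4) ^ (m - 1) * (1 / 4))
  have hu : Summable u := by
    rw [← summable_nat_add_iff 1]
    refine ((Real.summable_pow_div_factorial (r / 4)).mul_left (B / 4)).congr fun m => ?_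
    have h1 : (m : ℝ) + 1 ≠ 0 := by positivity
    have h2 : (m.factorial : ℝ) ≠ 0 := by positivity
    simp only [u, Nat.factorial_succ, Nat.add_sub_cancel]
    push_cast
    field_simp
  have hd : HasDerivAt (fun z => ∑' m, g m z) (∑' m, g' m s) s := by
    refine hasDerivAt_tsum_of_isPreconnected (t := Ioo (-r) r) hu isOpen_Ioo isPreconnected_Ioo
      (fun m y _ => ?_) (fun m y hy => ?_) (y₀ := s) ?_ (summable_besselEntire hμ s) ?_
    · exact (((hasDerivAt_id y).div_const 4).pow m).const_mul _
    · have hy' : |y| ≤ r := (abs_lt.2 hy).le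
      simp only [g', u, norm_mul, norm_pow, Real.norm_eq_abs, abs_div, Nat.abs_cast,
        abs_one, abs_of_pos (show (0 : ℝ) < 4 by norm_num)]
      gcongr
      exact hB m
    · exact abs_lt.1 (by linarith [hr])
    · exact abs_lt.1 (by linarith [hr])
  refine hd.congr_deriv ?_
  have hs' : Summable fun m => g' m s := by
    refine Summable.of_norm_bounded hu fun m => ?_
    simp only [g', u, norm_mul, norm_pow, Real.norm_eq_abs, abs_div, Nat.abs_cast,
      abs_one, abs_of_pos (show (0 : ℝ) < 4 by norm_num)]
    gcongr
    · exact hB m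
    · linarith [hr]
  rw [hs'.tsum_eq_zero_add, besselEntire_eq_tsum, ← neg_div, ← tsum_neg, ← tsum_div_const]
  simp only [g', Nat.cast_zero, zero_mul, mul_zero, zero_add, Nat.add_sub_cancel]
  refine tsum_congr fun m => ?_
  have := besselCoeff_succ μ m
  push_cast
  linear_combination ((s / 4) ^ m / 4) * this

theorem contDiff_besselEntire {μ : ℝ} (hμ : -1 < μ) : ContDiff ℝ ∞ (besselEntire μ) := by
  rw [contDiff_infty]
  intro m
  induction m generalizing μ with
  | zero =>
    exact contDiff_zero.2 (continuous_iff_continuousAt.2 fun s =>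
      (hasDerivAt_besselEntire hμ s).continuousAt)
  | succ m ih =>
    have hd : deriv (besselEntire μ) = fun s => -(besselEntire (μ + 1) s / 4) :=
      funext fun s => (hasDerivAt_besselEntire hμ s).deriv
    have h := contDiff_succ_iff_deriv (𝕜 := ℝ) (n := (m : WithTop ℕ∞)) (f := besselEntire μ)
    push_cast
    rw [h]
    refine ⟨fun s => (hasDerivAt_besselEntire hμ s).differentiableAt, by simp, ?_⟩
    rw [hd]
    exact ((ih (by linarith)).div_const 4).neg

/-- Since differentiation sends index `μ` to `μ + 1` with factor `-1/4`, this is Bessel's equation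
`s y'' + (μ + 1) y' + y / 4 = 0`. It is proved by comparing coefficients; the constant terms on the
right cancel. -/
theorem besselEntire_recurrence {μ : ℝ} (hμ : -1 < μ) (s : ℝ) :
    s / 4 * besselEntire (μ + 2) s = (μ + 1) * besselEntire (μ + 1) s - besselEntire μ s := by
  have hμ1 : -1 < μ + 1 := by linarith
  have hμ2 : -1 < μ + 2 := by linarith
  have h0 := summable_besselEntire hμ s
  have h1 := (summable_besselEntire hμ1 s).mul_left (μ + 1)
  rw [besselEntire_eq_tsum μ, besselEntire_eq_tsum (μ + 1), besselEntire_eq_tsum (μ + 2),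
    ← tsum_mul_left, ← tsum_mul_left, ← h1.tsum_sub h0, (h1.sub h0).tsum_eq_zero_add]
  have hrec : ∀ m : ℕ, Real.Gamma (m + (μ + 1) + 1)
      = (m + μ + 1) * Real.Gamma (m + μ + 1) := by
    intro m
    have : (0 : ℝ) ≤ m := Nat.cast_nonneg m
    rw [← Real.Gamma_add_one (by linarith)]
    congr 1
    ring
  have key : ∀ m : ℕ, besselCoeff μ m = (m + μ + 1) * besselCoeff (μ + 1) m := by
    intro m
    have hm : (0 : ℝ) ≤ m := Nat.cast_nonneg m
    have h1 : (m : ℝ) + μ + 1 ≠ 0 := by linarith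
    have h2 := (Gamma_nat_add_pos hμ m).ne'
    rw [besselCoeff, besselCoeff, hrec]
    field_simp
  have hz : (μ + 1) * (besselCoeff (μ + 1) 0 * (s / 4) ^ 0)
      - besselCoeff μ 0 * (s / 4) ^ 0 = 0 := by
    rw [key 0]
    simp
  rw [hz, zero_add]
  refine tsum_congr fun m => ?_
  have h3 := besselCoeff_succ (μ + 1) m
  rw [show μ + 1 + 1 = μ + 2 by ring] at h3
  rw [key (m + 1), pow_succ]
  push_cast
  linear_combination ((s / 4) ^ m * (s / 4)) * h3

theorem besselEntire_zero (μ : ℝ) : besselEntire μ 0 = (Real.Gamma (1 + μ))⁻¹ := by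
  rw [besselEntire_eq_tsum, tsum_eq_single 0 fun m hm => by simp [hm]]
  simp [besselCoeff, add_comm]

/-- Bessel functions are polynomially bounded: a decreasing energy controls them. -/
theorem exists_besselEntire_bound {μ : ℝ} (hμ : -1 < μ) :
    ∃ C : ℝ, 0 ≤ C ∧ ∀ s : ℝ, 0 ≤ s → |besselEntire μ s| ≤ C * (1 + s) := by
  have hμ1 : -1 < μ + 1 := by linarith
  -- With `y = besselEntire μ`, this is `y'² + y² / (4s)`. By Bessel's equation the `y y'` terms of
  -- its derivative cancel, leaving `-2(μ + 1) y'² / s - y² / (4s²) ≤ 0`.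
  set H : ℝ → ℝ := fun s => besselEntire (μ + 1) s ^ 2 / 16 + besselEntire μ s ^ 2 / (4 * s)
    with hH
  have hder : ∀ s : ℝ, 0 < s → HasDerivAt H (-((μ + 1) * besselEntire (μ + 1) s ^ 2 / (8 * s))
      - besselEntire μ s ^ 2 / (4 * s ^ 2)) s := by
    intro s hs
    have h1 := ((hasDerivAt_besselEntire hμ1 s).pow 2).div_const 16
    have h2 := ((hasDerivAt_besselEntire hμ s).pow 2).div
      ((hasDerivAt_id s).const_mul 4) (by simpa using hs.ne')
    refine (h1.add h2).congr_deriv ?_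
    have hr := besselEntire_recurrence hμ s
    rw [show μ + 1 + 1 = μ + 2 by ring]
    have hr' : besselEntire (μ + 2) s
        = ((μ + 1) * besselEntire (μ + 1) s - besselEntire μ s) * 4 / s := by
      rw [← hr]
      field_simp
    rw [hr']
    simp only [id, Pi.pow_apply]
    field_simp
    ring
  have hanti : AntitoneOn H (Ici 1) := by
    refine antitoneOn_of_deriv_nonpos (convex_Ici 1) ?_ ?_ ?_
    · intro s hs
      exact (hder s (one_pos.trans_le hs)).continuousAt.continuousWithinAt
    · intro s hs
      rw [interior_Ici] at hs
      exact (hder s (one_pos.trans hs)).differentiableAt.differentiableWithinAt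
    · intro s hs
      rw [interior_Ici] at hs
      have hs0 : 0 < s := one_pos.trans hs
      rw [(hder s hs0).deriv]
      have h1 : 0 ≤ (μ + 1) * besselEntire (μ + 1) s ^ 2 / (8 * s) := by
        have : 0 ≤ μ + 1 := by linarith
        positivity
      have h2 : 0 ≤ besselEntire μ s ^ 2 / (4 * s ^ 2) := by positivity
      linarith
  have hH1 : 0 ≤ H 1 := by positivity
  obtain ⟨C, hC⟩ := isCompact_Icc.exists_bound_of_continuousOn (s := Icc (0 : ℝ) 1)
    (contDiff_besselEntire hμ).continuous.continuousOn
  have hC0 : 0 ≤ C := (norm_nonneg _).trans (hC 0 ⟨le_rfl, zero_le_one⟩)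
  refine ⟨C + 2 * √(H 1), by positivity, fun s hs => ?_⟩
  rcases le_total s 1 with h | h
  · have := hC s ⟨hs, h⟩
    rw [Real.norm_eq_abs] at this
    have h2 : 0 ≤ √(H 1) := Real.sqrt_nonneg _
    nlinarith
  · have h1 : H s ≤ H 1 := hanti (mem_Ici.2 le_rfl) h h
    have hs0 : 0 < s := one_pos.trans_le h
    have h2 : besselEntire μ s ^ 2 / (4 * s) ≤ H 1 :=
      (le_add_of_nonneg_left (by positivity)).trans h1
    rw [div_le_iff₀ (by positivity)] at h2
    have h3 : |besselEntire μ s| ≤ 2 * √(H 1) * s := by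
      refine abs_le_of_sq_le_sq ?_ (by positivity)
      rw [mul_pow, mul_pow, Real.sq_sqrt hH1]
      nlinarith [mul_nonneg hH1 hs0.le]
    have h4 : 0 ≤ √(H 1) := Real.sqrt_nonneg _
    nlinarith

/-! ### The Robin profile and the radial modes -/

/-- The radial solution `Z ^ β · besselEntire μ (q² Z²)`. -/
noncomputable def radialSol (β μ q Z : ℝ) : ℝ := Z ^ β * besselEntire μ (q ^ 2 * Z ^ 2)

/-- The first derivative of `radialSol`. -/
noncomputable def radialSolDeriv (β μ q Z : ℝ) : ℝ :=
  β * radialSol (β - 1) μ q Z - q ^ 2 / 2 * radialSol (β + 1) (μ + 1) q Z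

theorem hasDerivAt_radialSol (β : ℝ) {μ : ℝ} (hμ : -1 < μ) (q : ℝ) {Z : ℝ} (hZ : 0 < Z) :
    HasDerivAt (radialSol β μ q) (radialSolDeriv β μ q Z) Z := by
  have h1 : HasDerivAt (fun Z : ℝ => Z ^ β) (β * Z ^ (β - 1)) Z :=
    Real.hasDerivAt_rpow_const (Or.inl hZ.ne')
  have h2 : HasDerivAt (fun Z : ℝ => q ^ 2 * Z ^ 2) (q ^ 2 * (2 * Z)) Z := by
    simpa using (hasDerivAt_pow 2 Z).const_mul (q ^ 2)
  have h3 := (hasDerivAt_besselEntire hμ (q ^ 2 * Z ^ 2)).comp Z h2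
  refine (h1.mul h3).congr_deriv ?_
  simp only [radialSolDeriv, radialSol, Function.comp_apply]
  rw [Real.rpow_add_one hZ.ne']
  ring

theorem contDiffOn_radialSol (β : ℝ) {μ : ℝ} (hμ : -1 < μ) (q : ℝ) :
    ContDiffOn ℝ ∞ (radialSol β μ q) (Ioi 0) := by
  refine ContDiffOn.mul (fun Z hZ => ?_) ?_
  · exact (Real.contDiffAt_rpow_const_of_ne (ne_of_gt hZ)).contDiffWithinAt
  · exact ((contDiff_besselEntire hμ).comp (by fun_prop)).contDiffOn

/-- After removing powers of `Z` the equation is `besselEntire_recurrence` at `s = q² Z²`. Allowing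
`μ = ±ν` covers both branches at once, as only `μ²` enters. -/
theorem radialSol_equation (d : ℝ) {μ : ℝ} (hμ : -1 < μ) (q : ℝ) {Z : ℝ} (hZ : 0 < Z) :
    ∃ D : ℝ, HasDerivAt (radialSolDeriv (d / 2 + μ) μ q) D Z ∧
      Z ^ 2 * D - (d - 1) * Z * radialSolDeriv (d / 2 + μ) μ q Z
        + (q ^ 2 * Z ^ 2 - (μ ^ 2 - (d / 2) ^ 2)) * radialSol (d / 2 + μ) μ q Z = 0 := by
  have hμ1 : -1 < μ + 1 := by linarith
  refine ⟨_, ((hasDerivAt_radialSol _ hμ q hZ).const_mul _).sub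
    ((hasDerivAt_radialSol _ hμ1 q hZ).const_mul _), ?_⟩
  set β := d / 2 + μ with hβ
  have hr := besselEntire_recurrence hμ (q ^ 2 * Z ^ 2)
  simp only [radialSolDeriv, radialSol]
  have e1 : Z ^ (β - 1) = Z ^ β / Z := Real.rpow_sub_one hZ.ne' β
  have e2 : Z ^ (β - 1 - 1) = Z ^ β / Z / Z := by rw [Real.rpow_sub_one hZ.ne', e1]
  have e4 : Z ^ (β + 1) = Z ^ β * Z := Real.rpow_add_one hZ.ne' β
  have e6 : Z ^ (β + 1 + 1) = Z ^ β * Z * Z := by rw [Real.rpow_add_one hZ.ne', e4]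
  rw [add_sub_cancel_right, sub_add_cancel, show μ + 1 + 1 = μ + 2 by ring, e1, e2, e4, e6]
  have hd : d = 2 * (β - μ) := by
    rw [hβ]
    ring
  rw [hd]
  generalize besselEntire μ (q ^ 2 * Z ^ 2) = y₀ at hr ⊢
  generalize besselEntire (μ + 1) (q ^ 2 * Z ^ 2) = y₁ at hr ⊢
  generalize besselEntire (μ + 2) (q ^ 2 * Z ^ 2) = y₂ at hr ⊢
  field_simp
  field_simp at hr
  linear_combination (Z ^ β * q ^ 2 * Z ^ 2) * hr

theorem robinProfile_eq_radialSol (n : ℕ) (ν γ q : ℝ) {Z : ℝ}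
    (hZ : 0 < Z) :
    robinProfile n ν γ Z (q ^ 2)
      = Real.cos γ * Real.Gamma (1 + ν) * radialSol (((n : ℝ) + 1) / 2 + ν) ν q Z
        + Real.sin γ * Real.Gamma (1 - ν) * radialSol (((n : ℝ) + 1) / 2 + -ν) (-ν) q Z := by
  unfold robinProfile radialSol
  rw [Real.div_rpow hZ.le zero_le_two, Real.div_rpow hZ.le zero_le_two, Real.rpow_add hZ,
    Real.rpow_add hZ]
  have h1 : (2 : ℝ) ^ ν ≠ 0 := by positivity
  have h2 : (2 : ℝ) ^ (-ν) ≠ 0 := by positivity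
  field_simp

/-- The normalization relating the radial modes to the momentum-space Robin kernel. -/
noncomputable def modeCoeff (n : ℕ) (ν f γ q : ℝ) : ℝ :=
  -(q ^ ν * √q / (√((q ^ 2) ^ (2 * ν) + f * Aconst n ν * (2 * Real.cos (π * ν)) * (q ^ 2) ^ ν
    + (f * Aconst n ν) ^ 2) * (Real.sin γ * 2 ^ (-ν) * Real.Gamma (1 - ν))))

theorem Gamma_one_sub_pos {ν : ℝ} (hν : ν ∈ Ioo (0 : ℝ) 1) : 0 < Real.Gamma (1 - ν) :=
  Real.Gamma_pos_of_pos (by linarith [hν.2])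

theorem Gamma_one_add_pos {ν : ℝ} (hν : ν ∈ Ioo (0 : ℝ) 1) : 0 < Real.Gamma (1 + ν) :=
  Real.Gamma_pos_of_pos (by linarith [hν.1])

/-- The sign comes from the `J_{-ν}` terms: coefficient `-sin α` in the mode, `+sin γ` in the
profile. Later only nonvanishing and the square matter. -/
theorem modeCoeff_neg (n : ℕ) {ν : ℝ} (hν : ν ∈ Ioo (0 : ℝ) 1) (f : ℝ) {γ : ℝ}
    (hγ : γ ∈ Ioo 0 π) {q : ℝ} (hq : 0 < q) : modeCoeff n ν f γ q < 0 := by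
  have h1 := spectralDenom_pos hν (f * Aconst n ν) (s := q ^ 2) (by positivity)
  have h2 := Real.sin_pos_of_pos_of_lt_pi hγ.1 hγ.2
  have h3 := Gamma_one_sub_pos hν
  unfold modeCoeff
  rw [neg_lt_zero]
  have := Real.sqrt_pos.2 h1
  have := Real.sqrt_pos.2 hq
  positivity

theorem cos_of_cot {x c : ℝ} (hx : 0 < Real.sin x) (h : Real.cot x = c) :
    Real.cos x = c * Real.sin x := by
  rw [Real.cot_eq_cos_div_sin, div_eq_iff hx.ne'] at h
  exact h

/-- The relation for `α` turns the normalization of the mode into `sin² α` times the denominator of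
the spectral density; the relation for `γ` makes the ratio of the `J_ν` and `J_{-ν}` coefficients
agree. -/
theorem robinMode_eq (n : ℕ) {ν : ℝ} (hν : ν ∈ Ioo (0 : ℝ) 1) {f α γ : ℝ} (hα : α ∈ Ioo 0 π)
    (hγ : γ ∈ Ioo 0 π) (hcα : Real.cot α = -(f * Aconst n ν))
    (hcγ : Real.cot γ =
        -(2 ^ (-(2 * ν)) * Real.Gamma (1 - ν) / Real.Gamma (1 + ν) * Real.cot α))
    {q : ℝ} (hq : 0 < q) {Z : ℝ} (hZ : 0 < Z) :
    robinMode n ν α q Z = modeCoeff n ν f γ q * robinProfile n ν γ Z (q ^ 2) := by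
  have hsα := Real.sin_pos_of_pos_of_lt_pi hα.1 hα.2
  have hsγ := Real.sin_pos_of_pos_of_lt_pi hγ.1 hγ.2
  have hΓ1 := Gamma_one_sub_pos hν
  have hΓ2 := Gamma_one_add_pos hν
  have hcosα := cos_of_cot hsα hcα
  rw [hcα] at hcγ
  have hcosγ := cos_of_cot hsγ hcγ
  have hD := spectralDenom_pos hν (f * Aconst n ν) (s := q ^ 2) (by positivity)
  have e0 : (q ^ 2) ^ ν = q ^ (2 * ν) := by
    rw [← Real.rpow_two, ← Real.rpow_mul hq.le]
  have e1 : (q ^ 2) ^ (2 * ν) = q ^ (4 * ν) := by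
    rw [← Real.rpow_two, ← Real.rpow_mul hq.le]
    ring_nf
  have e2 : (q ^ 2) ^ (-ν / 2) = (q ^ ν)⁻¹ := by
    rw [← Real.rpow_two, ← Real.rpow_mul hq.le, ← Real.rpow_neg hq.le]
    ring_nf
  have e3 : (q ^ 2) ^ (ν / 2) = q ^ ν := by
    rw [← Real.rpow_two, ← Real.rpow_mul hq.le]
    ring_nf
  have e4 : q ^ (2 * ν) = q ^ ν * q ^ ν := by
    rw [← Real.rpow_add hq]
    ring_nf
  have e5 : Z ^ (((n : ℝ) + 1) / 2) = Z ^ ((n : ℝ) / 2) * √Z := by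
    rw [Real.sqrt_eq_rpow, ← Real.rpow_add hZ]
    ring_nf
  have e6 : (2 : ℝ) ^ (-(2 * ν)) * 2 ^ ν = 2 ^ (-ν) := by
    rw [← Real.rpow_add two_pos]
    ring_nf
  have hDeq : Real.cos α ^ 2 - 2 * Real.sin α * Real.cos α * Real.cos (π * ν) * q ^ (2 * ν)
      + Real.sin α ^ 2 * q ^ (4 * ν) = Real.sin α ^ 2 * ((q ^ 2) ^ (2 * ν)
        + f * Aconst n ν * (2 * Real.cos (π * ν)) * (q ^ 2) ^ ν + (f * Aconst n ν) ^ 2) := by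
    rw [hcosα, e0, e1]
    ring
  rw [robinProfile_eq n ν γ hZ (by positivity : 0 < q ^ 2), Real.sqrt_sq hq.le, e2, e3,
    robinMode, hDeq, Real.sqrt_mul (sq_nonneg _), Real.sqrt_sq hsα.le, modeCoeff,
    Real.sqrt_mul hq.le, e5, hcosα]
  have hsD := (Real.sqrt_pos.2 hD).ne'
  set S := √((q ^ 2) ^ (2 * ν) + f * Aconst n ν * (2 * Real.cos (π * ν)) * (q ^ 2) ^ ν
    + (f * Aconst n ν) ^ 2)
  have hqν : q ^ ν ≠ 0 := (Real.rpow_pos_of_pos hq ν).ne'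
  have h2ν : (2 : ℝ) ^ (-ν) ≠ 0 := by positivity
  have hγcoef : Real.cos γ * 2 ^ ν * Real.Gamma (1 + ν)
      = f * Aconst n ν * (Real.sin γ * 2 ^ (-ν) * Real.Gamma (1 - ν)) := by
    rw [hcosγ, ← e6]
    field_simp
  rw [hγcoef, e4]
  field_simp
  ring

theorem exists_robinProfile_bound (n : ℕ) {ν : ℝ} (hν : ν ∈ Ioo (0 : ℝ) 1) (γ : ℝ) {a b : ℝ}
    (ha : 0 < a) :
    ∃ C : ℝ, 0 ≤ C ∧ ∀ Z ∈ Icc a b, ∀ s : ℝ, 0 ≤ s →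
      |robinProfile n ν γ Z s| ≤ C * (1 + s) := by
  obtain ⟨C₁, hC₁, h₁⟩ := exists_besselEntire_bound (μ := ν) (by linarith [hν.1])
  obtain ⟨C₂, hC₂, h₂⟩ := exists_besselEntire_bound (μ := -ν) (by linarith [hν.2])
  have hc : ∀ r : ℝ, ContinuousOn (fun Z : ℝ => (Z / 2) ^ r) (Icc a b) := fun r =>
    ContinuousOn.rpow_const (by fun_prop) fun Z hZ =>
      Or.inl (by linarith [hZ.1] : (0 : ℝ) < Z / 2).ne'
  have hd : ContinuousOn (fun Z : ℝ => Z ^ (((n : ℝ) + 1) / 2)) (Icc a b) :=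
    ContinuousOn.rpow_const (by fun_prop) fun Z hZ => Or.inl (by linarith [hZ.1] : (0 : ℝ) < Z).ne'
  obtain ⟨K₁, hK₁⟩ := isCompact_Icc.exists_bound_of_continuousOn (hd.mul
    ((hc ν).const_mul (Real.cos γ * (2 ^ ν * Real.Gamma (1 + ν)))))
  obtain ⟨K₂, hK₂⟩ := isCompact_Icc.exists_bound_of_continuousOn (hd.mul
    ((hc (-ν)).const_mul (Real.sin γ * (2 ^ (-ν) * Real.Gamma (1 - ν)))))
  refine ⟨(|K₁| * C₁ + |K₂| * C₂) * (1 + b ^ 2), by positivity, fun Z hZ s hs => ?_⟩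
  have hZ0 : 0 < Z := ha.trans_le hZ.1
  have hs' : 1 + s * Z ^ 2 ≤ (1 + b ^ 2) * (1 + s) := by
    have : Z ^ 2 ≤ b ^ 2 := pow_le_pow_left₀ hZ0.le hZ.2 2
    nlinarith [mul_le_mul_of_nonneg_left this hs, sq_nonneg b]
  have k₁ := hK₁ Z hZ
  have k₂ := hK₂ Z hZ
  rw [Real.norm_eq_abs] at k₁ k₂
  have b₁ := h₁ (s * Z ^ 2) (by positivity)
  have b₂ := h₂ (s * Z ^ 2) (by positivity)
  have heq : robinProfile n ν γ Z s
      = Z ^ (((n : ℝ) + 1) / 2) * (Real.cos γ * (2 ^ ν * Real.Gamma (1 + ν)) * (Z / 2) ^ ν)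
          * besselEntire ν (s * Z ^ 2)
        + Z ^ (((n : ℝ) + 1) / 2) * (Real.sin γ * (2 ^ (-ν) * Real.Gamma (1 - ν)) * (Z / 2) ^ (-ν))
          * besselEntire (-ν) (s * Z ^ 2) := by
    unfold robinProfile
    ring
  rw [heq]
  refine (abs_add_le _ _).trans ?_
  rw [abs_mul, abs_mul _ (besselEntire (-ν) _)]
  calc _ ≤ |K₁| * (C₁ * (1 + s * Z ^ 2)) + |K₂| * (C₂ * (1 + s * Z ^ 2)) := by
        exact add_le_add
          (mul_le_mul (k₁.trans (le_abs_self _)) b₁ (abs_nonneg _) (abs_nonneg _))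
          (mul_le_mul (k₂.trans (le_abs_self _)) b₂ (abs_nonneg _) (abs_nonneg _))
    _ = (|K₁| * C₁ + |K₂| * C₂) * (1 + s * Z ^ 2) := by ring
    _ ≤ (|K₁| * C₁ + |K₂| * C₂) * ((1 + b ^ 2) * (1 + s)) := by gcongr
    _ = _ := by ring

theorem measurable_robinProfile (n : ℕ) {ν : ℝ} (hν : ν ∈ Ioo (0 : ℝ) 1) (γ : ℝ) :
    Measurable fun y : ℝ × ℝ => robinProfile n ν γ y.1 y.2 := by
  have h₁ := (contDiff_besselEntire (μ := ν) (by linarith [hν.1])).continuous.measurable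
  have h₂ := (contDiff_besselEntire (μ := -ν) (by linarith [hν.2])).continuous.measurable
  have hm : Measurable fun y : ℝ × ℝ => y.2 * y.1 ^ 2 := by fun_prop
  have h₃ := h₁.comp hm
  have h₄ := h₂.comp hm
  simp only [Function.comp_def] at h₃ h₄
  unfold robinProfile
  fun_prop

theorem contDiff_robinProfile (n : ℕ) {ν : ℝ} (hν : ν ∈ Ioo (0 : ℝ) 1) (γ Z : ℝ) :
    ContDiff ℝ ∞ (robinProfile n ν γ Z) := by
  have h₁ := contDiff_besselEntire (μ := ν) (by linarith [hν.1])
  have h₂ := contDiff_besselEntire (μ := -ν) (by linarith [hν.2])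
  unfold robinProfile
  fun_prop

/-- The difference is `O(Z²)`. Used with `r = 2ν < 2`: the first correction to the `Z^(d/2-ν)`
branch is negligible against `Z^(d/2+ν)`. -/
theorem tendsto_besselEntire_sub {μ : ℝ} (hμ : -1 < μ) {r : ℝ} (hr : r < 2) (q : ℝ) :
    Tendsto (fun Z : ℝ => Z ^ (-r) * (besselEntire μ (q ^ 2 * Z ^ 2) - besselEntire μ 0)) (𝓝[>] 0)
      (𝓝 0) := by
  have hc : ContinuousAt (dslope (besselEntire μ) 0) 0 :=
    continuousAt_dslope_same.2 (hasDerivAt_besselEntire hμ 0).differentiableAt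
  have hs : Tendsto (fun Z : ℝ => q ^ 2 * Z ^ 2) (𝓝[>] 0) (𝓝 0) := by
    have : Continuous fun Z : ℝ => q ^ 2 * Z ^ 2 := by fun_prop
    simpa using (this.tendsto 0).mono_left nhdsWithin_le_nhds
  have hp : Tendsto (fun Z : ℝ => Z ^ (2 - r)) (𝓝[>] 0) (𝓝 0) := by
    have h := (Real.continuousAt_rpow_const 0 (2 - r) (Or.inr (by linarith))).tendsto
    rw [Real.zero_rpow (by linarith)] at h
    exact h.mono_left nhdsWithin_le_nhds
  have := (hp.mul_const (q ^ 2)).mul (hc.tendsto.comp hs)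
  rw [zero_mul, zero_mul] at this
  refine this.congr' ?_
  filter_upwards [self_mem_nhdsWithin] with Z hZ
  have hZ0 : 0 < Z := hZ
  have hd := sub_smul_dslope (besselEntire μ) 0 (q ^ 2 * Z ^ 2)
  rw [← hd, sub_zero, smul_eq_mul, Function.comp_apply, show 2 - r = -r + 2 by ring,
    Real.rpow_add hZ0, Real.rpow_two]
  ring

theorem robinMode_properties (n : ℕ) {ν : ℝ} (hν : ν ∈ Ioo (0 : ℝ) 1) {f α γ : ℝ}
    (hα : α ∈ Ioo 0 π) (hγ : γ ∈ Ioo 0 π) (hcα : Real.cot α = -(f * Aconst n ν))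
    (hcγ : Real.cot γ =
        -(2 ^ (-(2 * ν)) * Real.Gamma (1 - ν) / Real.Gamma (1 + ν) * Real.cot α))
    {q : ℝ} (hq : 0 < q) :
    ContDiffOn ℝ ∞ (robinMode n ν α q) (Ioi 0) ∧
    (∀ Z : ℝ, 0 < Z →
      Z ^ 2 * deriv (deriv (robinMode n ν α q)) Z - n * Z * deriv (robinMode n ν α q) Z
        + (q ^ 2 * Z ^ 2 - (ν ^ 2 - (((n : ℝ) + 1) / 2) ^ 2)) * robinMode n ν α q Z = 0) ∧
    ∃ φ : ℝ, φ ≠ 0 ∧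
      Tendsto (fun Z : ℝ => Z ^ (-(((n : ℝ) + 1) / 2 - ν)) * robinMode n ν α q Z)
        (𝓝[>] 0) (𝓝 (Real.sin γ * φ)) ∧
      Tendsto (fun Z : ℝ => Z ^ (-(((n : ℝ) + 1) / 2 + ν)) *
          (robinMode n ν α q Z - Real.sin γ * φ * Z ^ (((n : ℝ) + 1) / 2 - ν)))
        (𝓝[>] 0) (𝓝 (Real.cos γ * φ)) := by
  have hν1 : -1 < ν := by linarith [hν.1]
  have hν2 : -1 < -ν := by linarith [hν.2]
  have hΓ1 := Gamma_one_sub_pos hν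
  have hΓ2 := Gamma_one_add_pos hν
  set c := modeCoeff n ν f γ q with hc
  set d : ℝ := (n : ℝ) + 1 with hd
  set b₁ := c * (Real.cos γ * Real.Gamma (1 + ν)) with hb₁
  set b₂ := c * (Real.sin γ * Real.Gamma (1 - ν)) with hb₂
  have hV : ∀ Z : ℝ, 0 < Z → robinMode n ν α q Z
      = b₁ * radialSol (d / 2 + ν) ν q Z + b₂ * radialSol (d / 2 + -ν) (-ν) q Z := by
    intro Z hZ
    rw [robinMode_eq n hν hα hγ hcα hcγ hq hZ, robinProfile_eq_radialSol n ν γ q hZ]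
    ring
  have hV' : ∀ Z : ℝ, 0 < Z → HasDerivAt (robinMode n ν α q)
      (b₁ * radialSolDeriv (d / 2 + ν) ν q Z + b₂ * radialSolDeriv (d / 2 + -ν) (-ν) q Z) Z := by
    intro Z hZ
    refine (((hasDerivAt_radialSol _ hν1 q hZ).const_mul b₁).add
      ((hasDerivAt_radialSol _ hν2 q hZ).const_mul b₂)).congr_of_eventuallyEq ?_
    filter_upwards [Ioi_mem_nhds hZ] with W hW
    exact hV W hW
  -- The amplitude `φ` is the normalization `c` itself, because the factors `Γ(1 ± ν)` of the
  -- profile cancel the values `besselEntire (±ν) 0`.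
  refine ⟨?_, fun Z hZ => ?_, c, (modeCoeff_neg n hν f hγ hq).ne, ?_, ?_⟩
  · exact (((contDiffOn_radialSol _ hν1 q).const_smul b₁).add
      ((contDiffOn_radialSol _ hν2 q).const_smul b₂)).congr fun Z hZ => hV Z hZ
  · obtain ⟨D₁, h₁, E₁⟩ := radialSol_equation d hν1 q hZ
    obtain ⟨D₂, h₂, E₂⟩ := radialSol_equation d hν2 q hZ
    have hV'' : HasDerivAt (deriv (robinMode n ν α q)) (b₁ * D₁ + b₂ * D₂) Z := by
      refine ((h₁.const_mul b₁).add (h₂.const_mul b₂)).congr_of_eventuallyEq ?_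
      filter_upwards [Ioi_mem_nhds hZ] with W hW
      exact (hV' W hW).deriv
    rw [hV''.deriv, (hV' Z hZ).deriv, hV Z hZ]
    rw [neg_sq] at E₂
    rw [hd] at E₁ E₂ ⊢
    linear_combination b₁ * E₁ + b₂ * E₂
  · have t₁ : Tendsto (fun Z : ℝ => b₁ * (Z ^ (2 * ν) * besselEntire ν (q ^ 2 * Z ^ 2))
        + b₂ * besselEntire (-ν) (q ^ 2 * Z ^ 2)) (𝓝[>] 0)
        (𝓝 (b₁ * (0 * besselEntire ν 0) + b₂ * besselEntire (-ν) 0)) := by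
      have hs : Tendsto (fun Z : ℝ => q ^ 2 * Z ^ 2) (𝓝[>] 0) (𝓝 0) := by
        have : Continuous fun Z : ℝ => q ^ 2 * Z ^ 2 := by fun_prop
        simpa using (this.tendsto 0).mono_left nhdsWithin_le_nhds
      have hp : Tendsto (fun Z : ℝ => Z ^ (2 * ν)) (𝓝[>] 0) (𝓝 0) := by
        have h := (Real.continuousAt_rpow_const 0 (2 * ν) (Or.inr (by linarith [hν.1]))).tendsto
        rw [Real.zero_rpow (by linarith [hν.1])] at h
        exact h.mono_left nhdsWithin_le_nhds
      exact ((hp.mul (((contDiff_besselEntire hν1).continuous.tendsto 0).comp hs)).const_mul b₁).add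
        ((((contDiff_besselEntire hν2).continuous.tendsto 0).comp hs).const_mul b₂)
    have hval : b₁ * (0 * besselEntire ν 0) + b₂ * besselEntire (-ν) 0 = Real.sin γ * c := by
      rw [besselEntire_zero (-ν), ← sub_eq_add_neg, hb₂]
      field_simp
      ring
    rw [hval] at t₁
    refine t₁.congr' ?_
    filter_upwards [self_mem_nhdsWithin] with Z hZ
    have hZ0 : 0 < Z := hZ
    rw [hV Z hZ0, radialSol, radialSol]
    have e1 : Z ^ (-(d / 2 - ν)) * Z ^ (d / 2 + ν) = Z ^ (2 * ν) := by
      rw [← Real.rpow_add hZ0]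
      ring_nf
    have e2 : Z ^ (-(d / 2 - ν)) * Z ^ (d / 2 + -ν) = 1 := by
      rw [← Real.rpow_add hZ0, show -(d / 2 - ν) + (d / 2 + -ν) = 0 by ring, Real.rpow_zero]
    linear_combination (-(b₁ * besselEntire ν (q ^ 2 * Z ^ 2))) * e1
      - b₂ * besselEntire (-ν) (q ^ 2 * Z ^ 2) * e2
  · have hs : Tendsto (fun Z : ℝ => q ^ 2 * Z ^ 2) (𝓝[>] 0) (𝓝 0) := by
      have : Continuous fun Z : ℝ => q ^ 2 * Z ^ 2 := by fun_prop
      simpa using (this.tendsto 0).mono_left nhdsWithin_le_nhds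
    have t₂ := ((((contDiff_besselEntire hν1).continuous.tendsto 0).comp hs).const_mul b₁).add
      ((tendsto_besselEntire_sub hν2 (r := 2 * ν) (by linarith [hν.2]) q).const_mul b₂)
    have hval : b₁ * besselEntire ν 0 + b₂ * 0 = Real.cos γ * c := by
      rw [besselEntire_zero, hb₁]
      field_simp
      ring
    rw [hval] at t₂
    refine t₂.congr' ?_
    filter_upwards [self_mem_nhdsWithin] with Z hZ
    have hZ0 : 0 < Z := hZ
    rw [hV Z hZ0, radialSol, radialSol, Function.comp_apply]
    have e1 : Z ^ (-(d / 2 + ν)) * Z ^ (d / 2 + ν) = 1 := by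
      rw [← Real.rpow_add hZ0, neg_add_cancel, Real.rpow_zero]
    have e2 : Z ^ (-(d / 2 + ν)) * Z ^ (d / 2 - ν) = Z ^ (-(2 * ν)) := by
      rw [← Real.rpow_add hZ0]
      ring_nf
    have e3 : b₂ * besselEntire (-ν) 0 = Real.sin γ * c := by
      rw [besselEntire_zero (-ν), ← sub_eq_add_neg, hb₂]
      field_simp
    rw [← sub_eq_add_neg]
    linear_combination (-(b₁ * besselEntire ν (q ^ 2 * Z ^ 2))) * e1
      - (b₂ * besselEntire (-ν) (q ^ 2 * Z ^ 2) - Real.sin γ * c) * e2 - Z ^ (-(2 * ν)) * e3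

/-! ### The bulk Wightman function in momentum space -/

/-- The ratio of the mapped boundary Wightman function and the bulk Wightman function. -/
noncomputable def mappingConst (n : ℕ) (ν γ : ℝ) : ℝ :=
  2 * π ^ (((n : ℝ) + 1) / 2) * Real.Gamma (1 - ν)
    / Real.Gamma (((n : ℝ) + 1) / 2 - ν) * Real.sin γ ^ 2

theorem mappingConst_pos {n : ℕ} (hn : 1 ≤ n) {ν : ℝ} (hν : ν ∈ Ioo (0 : ℝ) 1) {γ : ℝ}
    (hγ : γ ∈ Ioo 0 π) : 0 < mappingConst n ν γ := by
  have hn' : (1 : ℝ) ≤ n := by exact_mod_cast hn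
  have h1 := Gamma_one_sub_pos hν
  have h2 : 0 < Real.Gamma (((n : ℝ) + 1) / 2 - ν) :=
    Real.Gamma_pos_of_pos (by linarith [hν.2])
  have h3 := Real.sin_pos_of_pos_of_lt_pi hγ.1 hγ.2
  unfold mappingConst
  positivity

theorem modeCoeff_sq (n : ℕ) {ν : ℝ} (hν : ν ∈ Ioo (0 : ℝ) 1) (f γ : ℝ) {q : ℝ} (hq : 0 < q) :
    modeCoeff n ν f γ q ^ 2 = (q ^ 2) ^ ν * q /
      (((q ^ 2) ^ (2 * ν) + f * Aconst n ν * (2 * Real.cos (π * ν)) * (q ^ 2) ^ ν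
        + (f * Aconst n ν) ^ 2) * (Real.sin γ * 2 ^ (-ν) * Real.Gamma (1 - ν)) ^ 2) := by
  have hD := spectralDenom_pos hν (f * Aconst n ν) (s := q ^ 2) (by positivity)
  have e0 : (q ^ 2) ^ ν = (q ^ ν) ^ 2 := by
    rw [← Real.rpow_two, ← Real.rpow_mul hq.le, ← Real.rpow_two, ← Real.rpow_mul hq.le, mul_comm]
  rw [modeCoeff, neg_sq, div_pow, mul_pow, mul_pow, Real.sq_sqrt hD.le, Real.sq_sqrt hq.le,
    e0]

/-- The denominators coincide, so the ratio is free of `q` and `f`. The constant comes from `Γ(ν)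
Γ(1-ν) sin(πν) = π` and the cancellation of `2^(2ν)` in `A` against `(2^(-ν))²`. -/
theorem spectralDensity_mul_modeCoeff_sq {n : ℕ} (hn : 1 ≤ n) {ν : ℝ} (hν : ν ∈ Ioo (0 : ℝ) 1)
    (f : ℝ) {γ : ℝ} (hγ : γ ∈ Ioo 0 π) {q : ℝ} (hq : 0 < q) :
    spectralDensity n ν f (q ^ 2) * q = mappingConst n ν γ * π * modeCoeff n ν f γ q ^ 2 := by
  have hn' : (1 : ℝ) ≤ n := by exact_mod_cast hn
  have hD := (spectralDenom_pos hν (f * Aconst n ν) (s := q ^ 2) (by positivity)).ne'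
  have hΓ := (Gamma_one_sub_pos hν).ne'
  have hΓd : Real.Gamma (((n : ℝ) + 1) / 2 - ν) ≠ 0 :=
    (Real.Gamma_pos_of_pos (by linarith [hν.2])).ne'
  have hs := (sin_pi_mul_pos hν).ne'
  have hsγ := (Real.sin_pos_of_pos_of_lt_pi hγ.1 hγ.2).ne'
  have hrefl : Real.Gamma ν * Real.Gamma (1 - ν) * Real.sin (π * ν) = π := by
    rw [Real.Gamma_mul_Gamma_one_sub, div_mul_cancel₀ _ hs]
  have h2 : (2 : ℝ) ^ (2 * ν) * (2 ^ (-ν)) ^ 2 = 1 := by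
    rw [← Real.rpow_natCast, ← Real.rpow_mul zero_le_two, ← Real.rpow_add two_pos]
    simp only [Nat.cast_ofNat]
    rw [show 2 * ν + -ν * 2 = 0 by ring, Real.rpow_zero]
  have hA : Aconst n ν * Real.sin (π * ν) * (2 ^ (-ν)) ^ 2 * Real.Gamma (1 - ν)
      = π ^ (((n : ℝ) + 1) / 2) * π / Real.Gamma (((n : ℝ) + 1) / 2 - ν) := by
    rw [Aconst, div_mul_eq_mul_div, div_mul_eq_mul_div, div_mul_eq_mul_div]
    congr 1
    linear_combination (π ^ (((n : ℝ) + 1) / 2) * (2 ^ (2 * ν) * (2 ^ (-ν)) ^ 2)) * hrefl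
      + π ^ (((n : ℝ) + 1) / 2) * π * h2
  rw [modeCoeff_sq n hν f γ hq, spectralDensity, mappingConst]
  have h2' : (2 : ℝ) ^ (-ν) ≠ 0 := by positivity
  set D := (q ^ 2) ^ (2 * ν) + f * Aconst n ν * (2 * Real.cos (π * ν)) * (q ^ 2) ^ ν
    + (f * Aconst n ν) ^ 2
  have key : 2 * π ^ (((n : ℝ) + 1) / 2) * Real.Gamma (1 - ν)
      / Real.Gamma (((n : ℝ) + 1) / 2 - ν) * Real.sin γ ^ 2 * π
      = 2 * (Aconst n ν * Real.sin (π * ν)) * (Real.sin γ * 2 ^ (-ν) * Real.Gamma (1 - ν)) ^ 2 := by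
    linear_combination (-(2 * Real.Gamma (1 - ν) * Real.sin γ ^ 2)) * hA
  rw [key]
  field_simp

/-- The momentum-space integrand of the bulk Wightman function, without the spectral density. -/
noncomputable def bulkMomentum {n : ℕ} (ν γ ε : ℝ) (X₁ X₂ : Bulk n) (p : Mink n) : ℂ :=
  Complex.exp (Complex.I * (minkProd p (X₁.1 - X₂.1) : ℂ)) *
    ((Real.exp (-(ε * p.1)) * (robinProfile n ν γ X₁.2 (negSq p)
      * robinProfile n ν γ X₂.2 (negSq p)) : ℝ) : ℂ) / (2 * π) ^ (n + 1)

theorem continuous_minkProd_right {n : ℕ} (x : Mink n) :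
    Continuous fun p : Mink n => minkProd p x := by
  unfold minkProd
  fun_prop

theorem measurable_bulkMomentum {n : ℕ} {ν : ℝ} (hν : ν ∈ Ioo (0 : ℝ) 1) (γ ε : ℝ)
    (X₁ X₂ : Bulk n) : Measurable (bulkMomentum ν γ ε X₁ X₂) := by
  have h₁ := (contDiff_robinProfile n hν γ X₁.2).continuous.comp (continuous_negSq (n := n))
  have h₂ := (contDiff_robinProfile n hν γ X₂.2).continuous.comp (continuous_negSq (n := n))
  have h₃ := continuous_minkProd_right (X₁.1 - X₂.1)
  simp only [Function.comp_def] at h₁ h₂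
  unfold bulkMomentum
  exact Continuous.measurable (by fun_prop)

theorem one_add_negSq_le {n : ℕ} {p : Mink n} (hp : ‖p.2‖ < p.1) :
    1 + negSq p ≤ (1 + p.1) ^ 2 := by
  have h0 : 0 ≤ p.1 := (norm_nonneg _).trans hp.le
  unfold negSq
  nlinarith [sq_nonneg ‖p.2‖]

theorem robinProfile_mul_le {n : ℕ} {ν γ C Z₁ Z₂ : ℝ} (hC : 0 ≤ C) {p : Mink n}
    (hp : ‖p.2‖ < p.1)
    (h₁ : |robinProfile n ν γ Z₁ (negSq p)| ≤ C * (1 + negSq p))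
    (h₂ : |robinProfile n ν γ Z₂ (negSq p)| ≤ C * (1 + negSq p)) :
    |robinProfile n ν γ Z₁ (negSq p) * robinProfile n ν γ Z₂ (negSq p)|
      ≤ C ^ 2 * (1 + p.1) ^ 4 := by
  have hs := negSq_pos hp
  rw [abs_mul]
  calc _ ≤ (C * (1 + negSq p)) * (C * (1 + negSq p)) :=
        mul_le_mul h₁ h₂ (abs_nonneg _) (by positivity)
    _ ≤ (C * (1 + p.1) ^ 2) * (C * (1 + p.1) ^ 2) := by
        have := one_add_negSq_le hp
        gcongr
    _ = _ := by ring

theorem integrable_bulkMomentum {n : ℕ} (hn : 1 ≤ n) {ν : ℝ} (hν : ν ∈ Ioo (0 : ℝ) 1) (f γ : ℝ)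
    {ε : ℝ} (hε : 0 < ε) {X₁ X₂ : Bulk n} (h₁ : 0 < X₁.2) (h₂ : 0 < X₂.2) :
    Integrable fun p => (wightmanDensity n ν f p : ℂ) * bulkMomentum ν γ ε X₁ X₂ p := by
  obtain ⟨C, hC, hb⟩ := exists_robinProfile_bound n hν γ (a := min X₁.2 X₂.2)
    (b := max X₁.2 X₂.2) (lt_min h₁ h₂)
  refine integrable_wightmanDensity_mul_exp hn hν f (measurable_bulkMomentum hν γ ε X₁ X₂) hε 4
    (sq_nonneg C) fun p hp => (norm_div_two_pi_pow_le _ _).trans ?_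
  rw [norm_mul, norm_exp_I_mul, one_mul, Complex.norm_real, Real.norm_eq_abs, abs_mul,
    abs_of_pos (Real.exp_pos _), mul_comm]
  have hs := (negSq_pos hp).le
  have hm := robinProfile_mul_le hC hp (hb X₁.2 ⟨min_le_left _ _, le_max_left _ _⟩ _ hs)
    (hb X₂.2 ⟨min_le_right _ _, le_max_right _ _⟩ _ hs)
  gcongr

/-- The Jacobian `q / E` supplies the `q` wanted by `spectralDensity_mul_modeCoeff_sq`. The factor
`2π` separating `π / E` from `1 / (2E)` is the extra one in `(2π)^(n+1)`. -/
theorem bulkIntegrand_shell {n : ℕ} (hn : 1 ≤ n) {ν : ℝ} (hν : ν ∈ Ioo (0 : ℝ) 1) {f α γ : ℝ}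
    (hα : α ∈ Ioo 0 π) (hγ : γ ∈ Ioo 0 π) (hcα : Real.cot α = -(f * Aconst n ν))
    (hcγ : Real.cot γ =
        -(2 ^ (-(2 * ν)) * Real.Gamma (1 - ν) / Real.Gamma (1 + ν) * Real.cot α))
    (ε : ℝ) {X₁ X₂ : Bulk n} (h₁ : 0 < X₁.2) (h₂ : 0 < X₂.2)
    {y : EuclideanSpace ℝ (Fin n) × ℝ} (hy : y ∈ shellDomain n) :
    ((spectralDensity n ν f (y.2 ^ 2) * shellJacobian y : ℝ) : ℂ)
        * bulkMomentum ν γ ε X₁ X₂ (shell y)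
      = (mappingConst n ν γ : ℂ) * bulkIntegrand n ν α ε X₁ X₂ y := by
  have hq : 0 < y.2 := hy.2
  have hE := (energy_pos y.1 hq).ne'
  have hphase : Complex.exp (Complex.I * ((⟪y.1, X₁.1.2 - X₂.1.2⟫ : ℝ) : ℂ)
      - Complex.I * (energy y.1 y.2 : ℂ) * (((X₁.1.1 - X₂.1.1 : ℝ) : ℂ) - Complex.I * (ε : ℂ)))
      = Complex.exp (Complex.I * (minkProd (shell y) (X₁.1 - X₂.1) : ℂ))
        * (Real.exp (-(ε * energy y.1 y.2)) : ℂ) := by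
    rw [Complex.ofReal_exp, ← Complex.exp_add, minkProd]
    congr 1
    simp only [shell, Prod.fst_sub, Prod.snd_sub]
    push_cast
    linear_combination (energy y.1 y.2 : ℂ) * ε * Complex.I_sq
  have hreal : spectralDensity n ν f (y.2 ^ 2) * shellJacobian y
      * (robinProfile n ν γ X₁.2 (y.2 ^ 2) * robinProfile n ν γ X₂.2 (y.2 ^ 2))
      = mappingConst n ν γ * (2 * π) * (robinMode n ν α y.2 X₁.2 * robinMode n ν α y.2 X₂.2
        / (2 * energy y.1 y.2)) := by
    rw [robinMode_eq n hν hα hγ hcα hcγ hq h₁, robinMode_eq n hν hα hγ hcα hcγ hq h₂,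
      shellJacobian]
    have := spectralDensity_mul_modeCoeff_sq hn hν f hγ hq
    field_simp
    linear_combination (robinProfile n ν γ X₁.2 (y.2 ^ 2) * robinProfile n ν γ X₂.2 (y.2 ^ 2))
      * this
  have hrealC := congrArg (fun r : ℝ => (r : ℂ)) hreal
  have hπ : (2 * π : ℂ) ≠ 0 := by exact_mod_cast two_pi_pos.ne'
  unfold bulkMomentum bulkIntegrand
  rw [hphase]
  simp only [shell, negSq_energy]
  generalize robinMode n ν α y.2 X₁.2 * robinMode n ν α y.2 X₂.2
        / (2 * energy y.1 y.2) = V at hrealC ⊢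
  generalize robinProfile n ν γ X₁.2 (y.2 ^ 2) * robinProfile n ν γ X₂.2 (y.2 ^ 2) = P
    at hrealC ⊢
  generalize spectralDensity n ν f (y.2 ^ 2) * shellJacobian y = S at hrealC ⊢
  push_cast at hrealC ⊢
  rw [pow_succ, mul_div_assoc', mul_div_assoc', div_eq_div_iff
    (mul_ne_zero (pow_ne_zero n hπ) hπ) (pow_ne_zero n hπ)]
  linear_combination (Complex.exp (Complex.I * (minkProd (energy y.1 y.2, y.1) (X₁.1 - X₂.1) : ℂ))
    * Complex.exp (-(ε * energy y.1 y.2)) * (2 * π : ℂ) ^ n) * hrealC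

theorem bulkWightman_momentum {n : ℕ} (hn : 1 ≤ n) {ν : ℝ} (hν : ν ∈ Ioo (0 : ℝ) 1) {f α γ : ℝ}
    (hα : α ∈ Ioo 0 π) (hγ : γ ∈ Ioo 0 π) (hcα : Real.cot α = -(f * Aconst n ν))
    (hcγ : Real.cot γ =
        -(2 ^ (-(2 * ν)) * Real.Gamma (1 - ν) / Real.Gamma (1 + ν) * Real.cot α))
    {ε : ℝ} (hε : 0 < ε) {X₁ X₂ : Bulk n} (h₁ : 0 < X₁.2) (h₂ : 0 < X₂.2) :
    IntegrableOn (bulkIntegrand n ν α ε X₁ X₂) (univ ×ˢ Ioi (0 : ℝ)) ∧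
    (mappingConst n ν γ : ℂ) * bulkWightman n ν α ε X₁ X₂
      = ∫ p, (wightmanDensity n ν f p : ℂ) * bulkMomentum ν γ ε X₁ X₂ p := by
  have hm := measurable_bulkMomentum hν γ ε X₁ X₂
  have hc : (mappingConst n ν γ : ℂ) ≠ 0 := by exact_mod_cast (mappingConst_pos hn hν hγ).ne'
  have hpt : EqOn (fun y => ((spectralDensity n ν f (y.2 ^ 2) * shellJacobian y : ℝ) : ℂ)
        * bulkMomentum ν γ ε X₁ X₂ (shell y))
      (fun y => (mappingConst n ν γ : ℂ) * bulkIntegrand n ν α ε X₁ X₂ y) (shellDomain n) :=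
    fun y hy => bulkIntegrand_shell hn hν hα hγ hcα hcγ ε h₁ h₂ hy
  constructor
  · have hi := (integrable_wightmanDensity_mul_iff hm).1
      (integrable_bulkMomentum hn hν f γ hε h₁ h₂)
    rw [integrableOn_congr_fun hpt (measurableSet_shellDomain n)] at hi
    exact (integrable_const_mul_iff (isUnit_iff_ne_zero.2 hc) _).1 hi
  · rw [integral_wightmanDensity_mul hm, setIntegral_congr_fun (measurableSet_shellDomain n) hpt,
      integral_const_mul]
    rfl

/-! ### The image of the boundary Wightman function -/

/-- The momentum-space Robin kernel with cutoff, as a Schwartz function. -/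
theorem exists_schwartz_robinKernel {n : ℕ} {ν : ℝ} (hν : ν ∈ Ioo (0 : ℝ) 1) (γ : ℝ)
    {χ : Mink n → ℝ} (hχ : IsCutoff χ) {Λ : ℝ} (hΛ : 0 < Λ) (X : Bulk n) :
    ∃ K : 𝓢(Mink n, ℂ), (∀ x, robinKernel ν γ χ Λ x X = K x) ∧
      ∀ p, minkFourier K p = Complex.exp (Complex.I * (minkProd p X.1 : ℂ)) *
        ((χ (Λ⁻¹ • p) * robinProfile n ν γ X.2 (negSq p) : ℝ) : ℂ) := by
  have hΛ' : Λ⁻¹ ≠ 0 := (inv_pos.2 hΛ).ne'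
  set Φ : Mink n → ℂ := fun p => Complex.exp (Complex.I * (minkProd p X.1 : ℂ)) *
        ((χ (Λ⁻¹ • p) * robinProfile n ν γ X.2 (negSq p) : ℝ) : ℂ) with hΦ
  have hsmooth : ContDiff ℝ ∞ Φ := by
    have h1 : ContDiff ℝ ∞ fun p : Mink n => minkProd p X.1 := by
      unfold minkProd
      exact ((contDiff_fst.mul contDiff_const).neg).add (contDiff_snd.inner ℝ contDiff_const)
    have h2 : ContDiff ℝ ∞ (negSq : Mink n → ℝ) := by
      unfold negSq
      exact (contDiff_fst.pow 2).sub (contDiff_snd.norm_sq ℝ)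
    have h3 : ContDiff ℝ ∞ fun p : Mink n => χ (Λ⁻¹ • p) :=
      hχ.smooth.comp (contDiff_const_smul _)
    have h4 := (contDiff_robinProfile n hν γ X.2).comp h2
    refine ContDiff.mul ?_ (Complex.ofRealCLM.contDiff.comp (h3.mul h4))
    exact (contDiff_const.mul (Complex.ofRealCLM.contDiff.comp h1)).cexp
  -- The polynomial bound on the profile concerns only `-p² ≥ 0`; off the cone the cutoff does all
  -- the work.
  have hcompact : HasCompactSupport Φ := by
    have h1 : HasCompactSupport fun p : Mink n => χ (Λ⁻¹ • p) :=
      hχ.compact.comp_homeomorph (Homeomorph.smulOfNeZero _ hΛ')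
    refine h1.mono fun p hp hc => hp ?_
    have hc' : χ (Λ⁻¹ • p) = 0 := hc
    simp [hΦ, hc']
  refine ⟨minkFourierInvCLM n (hcompact.toSchwartzMap hsmooth), fun x => ?_, fun p => ?_⟩
  · rw [minkFourierInvCLM_apply, robinKernel, ← integral_div]
    congr 1
    ext p
    change _ = Complex.exp (-(Complex.I * (minkProd p x : ℂ))) * Φ p / _
    have : Complex.exp (Complex.I * (minkProd p (X.1 - x) : ℂ))
        = Complex.exp (-(Complex.I * (minkProd p x : ℂ)))
          * Complex.exp (Complex.I * (minkProd p X.1 : ℂ)) := by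
      rw [← Complex.exp_add]
      congr 1
      simp only [minkProd, Prod.fst_sub, Prod.snd_sub, inner_sub_right]
      push_cast
      ring
    rw [this, hΦ]
    ring
  · rw [minkFourier_minkFourierInvCLM]
    rfl

theorem minkProd_sub_right {n : ℕ} (p x y : Mink n) :
    minkProd p (x - y) = minkProd p x - minkProd p y := by
  simp only [minkProd, Prod.fst_sub, Prod.snd_sub, inner_sub_right]
  ring

theorem minkProd_neg_left {n : ℕ} (p x : Mink n) : minkProd (-p) x = -minkProd p x := by
  simp only [minkProd, Prod.fst_neg, Prod.snd_neg, inner_neg_left]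
  ring

theorem negSq_neg {n : ℕ} (p : Mink n) : negSq (-p) = negSq p := by
  simp [negSq]

/-- As `ω₂` depends on `x₁ - x₂`, its plane waves factor into momentum `p` for the first kernel and
`-p` for the second. -/
theorem integral_mul_mul_wightmanReg {n : ℕ} (hn : 1 ≤ n) {ν : ℝ} (hν : ν ∈ Ioo (0 : ℝ) 1)
    (f : ℝ) {ε : ℝ} (hε : 0 < ε) {K₁ K₂ : Mink n → ℂ} (h₁ : Integrable K₁) (h₂ : Integrable K₂) :
    Integrable (fun x : Mink n × Mink n => K₁ x.1 * K₂ x.2 * wightmanReg n ν f ε (x.1 - x.2)) ∧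
    ∫ x : Mink n × Mink n, K₁ x.1 * K₂ x.2 * wightmanReg n ν f ε (x.1 - x.2)
      = ∫ p, (wightmanDensity n ν f p : ℂ) * ((Real.exp (-(ε * p.1)) : ℂ) / (2 * π) ^ (n + 1)) *
        (minkFourier K₁ p * minkFourier K₂ (-p)) := by
  have hint : Integrable (Function.uncurry fun (x : Mink n × Mink n) (p : Mink n) =>
      Complex.exp (Complex.I * (minkProd p (x.1 - x.2) : ℂ)) *
      (K₁ x.1 * K₂ x.2 * ((wightmanDensity n ν f p : ℂ) *
        ((Real.exp (-(ε * p.1)) : ℂ) / (2 * π) ^ (n + 1))))) (volume.prod volume) := by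
    refine ((h₁.mul_prod h₂).mul_prod (integrable_wightmanDensity_damped hn hν f hε)).bdd_mul
      (c := 1) ?_ (.of_forall fun y => (norm_exp_I_mul _).le)
    refine Continuous.aestronglyMeasurable (Complex.continuous_exp.comp
      (continuous_const.mul (Complex.continuous_ofReal.comp ?_)))
    exact continuous_minkProd.comp (continuous_snd.prodMk
      ((continuous_fst.comp continuous_fst).sub (continuous_snd.comp continuous_fst)))
  have hpt : (fun x : Mink n × Mink n => K₁ x.1 * K₂ x.2 * wightmanReg n ν f ε (x.1 - x.2))
      = fun x => ∫ p, Complex.exp (Complex.I * (minkProd p (x.1 - x.2) : ℂ)) *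
      (K₁ x.1 * K₂ x.2 * ((wightmanDensity n ν f p : ℂ) *
        ((Real.exp (-(ε * p.1)) : ℂ) / (2 * π) ^ (n + 1)))) := by
    ext x
    rw [wightmanReg_eq, ← integral_const_mul]
    congr 1
    ext p
    ring
  refine ⟨hpt ▸ hint.integral_prod_left, ?_⟩
  rw [hpt, integral_integral_swap hint]
  congr 1
  ext p
  have hprod := integral_prod_mul (μ := (volume : Measure (Mink n)))
    (ν := (volume : Measure (Mink n)))
    (fun x => Complex.exp (Complex.I * (minkProd p x : ℂ)) * K₁ x)
    (fun x => Complex.exp (Complex.I * (minkProd (-p) x : ℂ)) * K₂ x)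
  rw [minkFourier, minkFourier, ← hprod, ← integral_const_mul, Measure.volume_eq_prod]
  congr 1
  ext x
  have : Complex.exp (Complex.I * (minkProd p (x.1 - x.2) : ℂ))
      = Complex.exp (Complex.I * (minkProd p x.1 : ℂ))
        * Complex.exp (Complex.I * (minkProd (-p) x.2 : ℂ)) := by
    rw [← Complex.exp_add, minkProd_sub_right, minkProd_neg_left]
    congr 1
    push_cast
    ring
  rw [this]
  ring

/-- The profile is even in `p`, so evaluating the second kernel at `-p` only reverses its phase and
the argument of `χ₂`. -/
theorem mapped_integral {n : ℕ} (hn : 1 ≤ n) {ν : ℝ} (hν : ν ∈ Ioo (0 : ℝ) 1) (f γ : ℝ)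
    {ε : ℝ} (hε : 0 < ε) (X₁ X₂ : Bulk n) {χ₁ χ₂ : Mink n → ℝ} (hχ₁ : IsCutoff χ₁)
    (hχ₂ : IsCutoff χ₂) {Λ₁ Λ₂ : ℝ} (hΛ₁ : 0 < Λ₁) (hΛ₂ : 0 < Λ₂) :
    Integrable (mappedIntegrand ν γ f ε χ₁ χ₂ Λ₁ Λ₂ X₁ X₂) ∧
    ∫ x, mappedIntegrand ν γ f ε χ₁ χ₂ Λ₁ Λ₂ X₁ X₂ x
      = ∫ p, ((χ₁ (Λ₁⁻¹ • p) * χ₂ (Λ₂⁻¹ • -p) : ℝ) : ℂ) *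
        ((wightmanDensity n ν f p : ℂ) * bulkMomentum ν γ ε X₁ X₂ p) := by
  obtain ⟨K₁, hK₁, hF₁⟩ := exists_schwartz_robinKernel hν γ hχ₁ hΛ₁ X₁
  obtain ⟨K₂, hK₂, hF₂⟩ := exists_schwartz_robinKernel hν γ hχ₂ hΛ₂ X₂
  have h := integral_mul_mul_wightmanReg hn hν f hε K₁.integrable K₂.integrable
  have hpt : mappedIntegrand ν γ f ε χ₁ χ₂ Λ₁ Λ₂ X₁ X₂
      = fun x : Mink n × Mink n => K₁ x.1 * K₂ x.2 * wightmanReg n ν f ε (x.1 - x.2) := by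
    ext x
    rw [mappedIntegrand, hK₁, hK₂]
  rw [hpt]
  refine ⟨h.1, h.2.trans ?_⟩
  congr 1
  ext p
  rw [hF₁, hF₂, bulkMomentum, negSq_neg, minkProd_sub_right, minkProd_neg_left]
  have : Complex.exp (Complex.I * ((minkProd p X₁.1 - minkProd p X₂.1 : ℝ) : ℂ))
      = Complex.exp (Complex.I * (minkProd p X₁.1 : ℂ))
        * Complex.exp (Complex.I * ((-minkProd p X₂.1 : ℝ) : ℂ)) := by
    rw [← Complex.exp_add]
    congr 1
    push_cast
    ring
  rw [this]
  push_cast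
  ring

/-- The cutoffs are bounded and tend to `1` pointwise, so dominated convergence gives the joint
limit in `(Λ₁, Λ₂)`. -/
theorem tendsto_mapped_integral {n : ℕ} (hn : 1 ≤ n) {ν : ℝ} (hν : ν ∈ Ioo (0 : ℝ) 1) (f γ : ℝ)
    {ε : ℝ} (hε : 0 < ε) {X₁ X₂ : Bulk n} (h₁ : 0 < X₁.2) (h₂ : 0 < X₂.2) {χ₁ χ₂ : Mink n → ℝ}
    (hχ₁ : IsCutoff χ₁) (hχ₂ : IsCutoff χ₂) :
    Tendsto (fun Λ : ℝ × ℝ =>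
      ∫ x : Mink n × Mink n, mappedIntegrand ν γ f ε χ₁ χ₂ Λ.1 Λ.2 X₁ X₂ x) (atTop ×ˢ atTop)
      (𝓝 (∫ p, (wightmanDensity n ν f p : ℂ) * bulkMomentum ν γ ε X₁ X₂ p)) := by
  obtain ⟨C₁, hC₁⟩ := hχ₁.compact.exists_bound_of_continuous hχ₁.smooth.continuous
  obtain ⟨C₂, hC₂⟩ := hχ₂.compact.exists_bound_of_continuous hχ₂.smooth.continuous
  have hi := integrable_bulkMomentum hn hν f γ hε h₁ h₂
  have key : Tendsto (fun Λ : ℝ × ℝ => ∫ p, ((χ₁ (Λ.1⁻¹ • p) * χ₂ (Λ.2⁻¹ • -p) : ℝ) : ℂ) *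
      ((wightmanDensity n ν f p : ℂ) * bulkMomentum ν γ ε X₁ X₂ p)) (atTop ×ˢ atTop)
      (𝓝 (∫ p, (wightmanDensity n ν f p : ℂ) * bulkMomentum ν γ ε X₁ X₂ p)) := by
    refine tendsto_integral_filter_of_dominated_convergence
      (fun p => C₁ * C₂ * ‖(wightmanDensity n ν f p : ℂ) * bulkMomentum ν γ ε X₁ X₂ p‖)
      (.of_forall fun Λ => ?_) (.of_forall fun Λ => .of_forall fun p => ?_)
      (hi.norm.const_mul _) (.of_forall fun p => ?_)
    · refine AEStronglyMeasurable.mul (Continuous.aestronglyMeasurable ?_) hi.aestronglyMeasurable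
      exact Complex.continuous_ofReal.comp ((hχ₁.smooth.continuous.comp (by fun_prop)).mul
        (hχ₂.smooth.continuous.comp (by fun_prop)))
    · rw [norm_mul, Complex.norm_real, norm_mul]
      have hC₁0 : 0 ≤ C₁ := (norm_nonneg _).trans (hC₁ 0)
      gcongr
      · exact hC₁ _
      · exact hC₂ _
    · have t₁ : Tendsto (fun Λ : ℝ × ℝ => χ₁ (Λ.1⁻¹ • p)) (atTop ×ˢ atTop) (𝓝 1) := by
        have h := (tendsto_inv_atTop_zero.comp (tendsto_fst (f := (atTop : Filter ℝ))
          (g := (atTop : Filter ℝ)))).smul_const p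
        rw [zero_smul] at h
        have := (hχ₁.smooth.continuous.tendsto 0).comp h
        rwa [hχ₁.one] at this
      have t₂ : Tendsto (fun Λ : ℝ × ℝ => χ₂ (Λ.2⁻¹ • -p)) (atTop ×ˢ atTop) (𝓝 1) := by
        have h := (tendsto_inv_atTop_zero.comp (tendsto_snd (f := (atTop : Filter ℝ))
          (g := (atTop : Filter ℝ)))).smul_const (-p)
        rw [zero_smul] at h
        have := (hχ₂.smooth.continuous.tendsto 0).comp h
        rwa [hχ₂.one] at this
      have t := ((Complex.continuous_ofReal.tendsto _).comp (t₁.mul t₂)).mul_const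
        ((wightmanDensity n ν f p : ℂ) * bulkMomentum ν γ ε X₁ X₂ p)
      simpa using t
  refine key.congr' ?_
  filter_upwards [tendsto_fst.eventually (eventually_gt_atTop (0 : ℝ)),
    tendsto_snd.eventually (eventually_gt_atTop (0 : ℝ))] with Λ hΛ₁ hΛ₂
  exact (mapped_integral hn hν f γ hε X₁ X₂ hχ₁ hχ₂ hΛ₁ hΛ₂).2.symm

/-! ### Removing the regulator from the bulk Wightman function -/

/-- The `p`-component of the bulk Wightman function, at a pair of bulk points. -/
noncomputable def bulkPlaneWave {n : ℕ} (ν γ : ℝ) (X : Bulk n × Bulk n) (p : Mink n) : ℂ :=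
  Complex.exp (Complex.I * (minkProd p (X.1.1 - X.2.1) : ℂ)) *
    ((robinProfile n ν γ X.1.2 (negSq p) * robinProfile n ν γ X.2.2 (negSq p) : ℝ) : ℂ)

theorem bulkMomentum_eq_bulkPlaneWave {n : ℕ} (ν γ ε : ℝ) (X : Bulk n × Bulk n) (p : Mink n) :
    bulkMomentum ν γ ε X.1 X.2 p
      = bulkPlaneWave ν γ X p * ((Real.exp (-(ε * p.1)) : ℂ) / (2 * π) ^ (n + 1)) := by
  unfold bulkMomentum bulkPlaneWave
  push_cast
  ring

theorem measurable_bulkPlaneWave {n : ℕ} {ν : ℝ} (hν : ν ∈ Ioo (0 : ℝ) 1) (γ : ℝ) :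
    Measurable fun y : (Bulk n × Bulk n) × Mink n => bulkPlaneWave ν γ y.1 y.2 := by
  have hm := measurable_robinProfile n hν γ
  have hs : Measurable fun y : (Bulk n × Bulk n) × Mink n => negSq y.2 :=
    (continuous_negSq (n := n)).measurable.comp measurable_snd
  have hp : Continuous fun y : (Bulk n × Bulk n) × Mink n =>
      minkProd y.2 (y.1.1.1 - y.1.2.1) := by
    unfold minkProd
    exact ((by fun_prop : Continuous fun y : (Bulk n × Bulk n) × Mink n =>
      -(y.2.1 * (y.1.1.1 - y.1.2.1).1))).add ((by fun_prop : Continuous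
        fun y : (Bulk n × Bulk n) × Mink n => y.2.2).inner (by fun_prop))
  refine Measurable.mul (Continuous.measurable (by fun_prop)) (Complex.measurable_ofReal.comp ?_)
  exact (hm.comp ((by fun_prop : Measurable fun y : (Bulk n × Bulk n) × Mink n =>
    y.1.1.2).prodMk hs)).mul (hm.comp ((by fun_prop : Measurable
      fun y : (Bulk n × Bulk n) × Mink n => y.1.2.2).prodMk hs))

/-- Test functions of pairs of points of the Poincaré patch. -/
structure IsBulkTest {n : ℕ} (F : Bulk n × Bulk n → ℂ) : Prop where
  smooth : ContDiff ℝ ∞ F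
  compact : HasCompactSupport F
  subset : tsupport F ⊆ {X | 0 < X.1.2 ∧ 0 < X.2.2}

namespace IsBulkTest

variable {n : ℕ} {F : Bulk n × Bulk n → ℂ}

theorem fderiv_apply (hF : IsBulkTest F) (v : Bulk n × Bulk n) :
    IsBulkTest fun X => fderiv ℝ F X v where
  smooth := (hF.smooth.fderiv_right (m := ∞) (by simp)).clm_apply contDiff_const
  compact := hF.compact.fderiv_apply ℝ v
  subset := (tsupport_fderiv_apply_subset ℝ v).trans hF.subset

/-- Compact support keeps both `Z` coordinates in one interval `[a, b]` with `a > 0`, where the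
profile bound is uniform. -/
theorem exists_bound (hF : IsBulkTest F) {ν : ℝ} (hν : ν ∈ Ioo (0 : ℝ) 1) (γ : ℝ) :
    ∃ C, 0 ≤ C ∧ ∀ X ∈ tsupport F, ∀ p : Mink n, ‖p.2‖ < p.1 →
      ‖bulkPlaneWave ν γ X p‖ ≤ C * (1 + p.1) ^ 4 := by
  rcases (tsupport F).eq_empty_or_nonempty with he | hne
  · exact ⟨0, le_rfl, fun X hX => by simp [he] at hX⟩
  have hK : IsCompact (tsupport F) := hF.compact
  obtain ⟨A, hA, hAm⟩ := hK.exists_isMinOn hne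
    (f := fun X : Bulk n × Bulk n => min X.1.2 X.2.2) (by fun_prop)
  obtain ⟨B, -, hBm⟩ := hK.exists_isMaxOn hne
    (f := fun X : Bulk n × Bulk n => max X.1.2 X.2.2) (by fun_prop)
  obtain ⟨C, hC, hb⟩ := exists_robinProfile_bound n hν γ (a := min A.1.2 A.2.2)
    (b := max B.1.2 B.2.2) (lt_min (hF.subset hA).1 (hF.subset hA).2)
  refine ⟨C ^ 2, sq_nonneg C, fun X hX p hp => ?_⟩
  have h1 : min A.1.2 A.2.2 ≤ min X.1.2 X.2.2 := hAm hX
  have h2 : max X.1.2 X.2.2 ≤ max B.1.2 B.2.2 := hBm hX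
  have hs := (negSq_pos hp).le
  rw [bulkPlaneWave, norm_mul, norm_exp_I_mul, one_mul, Complex.norm_real, Real.norm_eq_abs]
  exact robinProfile_mul_le hC hp
    (hb _ ⟨h1.trans (min_le_left _ _), (le_max_left _ _).trans h2⟩ _ hs)
    (hb _ ⟨h1.trans (min_le_right _ _), (le_max_right _ _).trans h2⟩ _ hs)

theorem norm_mul_bulkPlaneWave_le {ν γ C : ℝ} {p : Mink n}
    (hb : ∀ X ∈ tsupport F, ‖bulkPlaneWave ν γ X p‖ ≤ C) (X : Bulk n × Bulk n) :
    ‖F X * bulkPlaneWave ν γ X p‖ ≤ ‖F X‖ * C := by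
  by_cases hX : X ∈ tsupport F
  · rw [norm_mul]
    exact mul_le_mul_of_nonneg_left (hb X hX) (norm_nonneg _)
  · rw [image_eq_zero_of_notMem_tsupport hX]
    simp

theorem isAddHaarMeasure (n : ℕ) : (volume : Measure (Bulk n × Bulk n)).IsAddHaarMeasure := by
  have := instIsAddHaarMeasureMink n
  have : (volume : Measure (Bulk n)).IsAddHaarMeasure :=
    Measure.prod.instIsAddHaarMeasure volume volume
  exact Measure.prod.instIsAddHaarMeasure volume volume

theorem integrable (hF : IsBulkTest F) : Integrable F := by
  have := isAddHaarMeasure n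
  exact hF.smooth.continuous.integrable_of_hasCompactSupport hF.compact

theorem integrable_mul_bulkPlaneWave (hF : IsBulkTest F) {ν : ℝ} (hν : ν ∈ Ioo (0 : ℝ) 1) (γ : ℝ)
    {p : Mink n} (hp : ‖p.2‖ < p.1) : Integrable fun X => F X * bulkPlaneWave ν γ X p := by
  obtain ⟨C, -, hb⟩ := hF.exists_bound hν γ
  refine Integrable.mono' (hF.integrable.norm.mul_const (C * (1 + p.1) ^ 4)) ?_
    (.of_forall fun X => norm_mul_bulkPlaneWave_le (fun X hX => hb X hX p hp) X)
  exact (hF.smooth.continuous.measurable.mul ((measurable_bulkPlaneWave hν γ).comp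
    (measurable_id.prodMk measurable_const))).aestronglyMeasurable

/-- The direction of the first time coordinate. -/
def timeDir (n : ℕ) : Bulk n × Bulk n := (((1, 0), 0), 0)

/-- A translation in `t₁` only changes the phase. A line derivative suffices, so no regularity in
`Z` is asked at `Z ≤ 0`. -/
theorem hasLineDerivAt_bulkPlaneWave (ν γ : ℝ) (p : Mink n) (X : Bulk n × Bulk n) :
    HasLineDerivAt ℝ (fun X => bulkPlaneWave ν γ X p)
      (-(Complex.I * p.1) * bulkPlaneWave ν γ X p) X (timeDir n) := by
  have h : (fun t : ℝ => bulkPlaneWave ν γ (X + t • timeDir n) p)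
      = fun t : ℝ => Complex.exp (-(Complex.I * p.1) * t) * bulkPlaneWave ν γ X p := by
    ext t
    simp only [bulkPlaneWave, timeDir, minkProd, Prod.fst_add, Prod.snd_add, Prod.smul_fst,
      Prod.smul_snd, Prod.fst_sub, Prod.snd_sub, smul_eq_mul, mul_one, mul_zero, smul_zero,
      add_zero]
    rw [← mul_assoc, ← Complex.exp_add]
    congr 2
    push_cast
    ring
  rw [HasLineDerivAt, h]
  have h1 : HasDerivAt (fun t : ℝ => -(Complex.I * p.1) * (t : ℂ)) (-(Complex.I * p.1)) 0 := by
    simpa using (Complex.ofRealCLM.hasDerivAt (x := (0 : ℝ))).const_mul (-(Complex.I * p.1))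
  simpa using h1.cexp.mul_const (bulkPlaneWave ν γ X p)

theorem integral_fderiv_mul_bulkPlaneWave (hF : IsBulkTest F) {ν : ℝ} (hν : ν ∈ Ioo (0 : ℝ) 1)
    (γ : ℝ) {p : Mink n} (hp : ‖p.2‖ < p.1) :
    ∫ X, fderiv ℝ F X (timeDir n) * bulkPlaneWave ν γ X p
      = Complex.I * p.1 * ∫ X, F X * bulkPlaneWave ν γ X p := by
  have := isAddHaarMeasure n
  have hi := hF.integrable_mul_bulkPlaneWave hν γ hp
  have hi' := (hF.fderiv_apply (timeDir n)).integrable_mul_bulkPlaneWave hν γ hp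
  have h := integral_bilinear_hasLineDerivAt_right_eq_neg_left_of_integrable
    (μ := (volume : Measure (Bulk n × Bulk n))) (B := ContinuousLinearMap.mul ℝ ℂ)
    (f := F) (f' := fun X => fderiv ℝ F X (timeDir n)) (g := fun X => bulkPlaneWave ν γ X p)
    (g' := fun X => -(Complex.I * p.1) * bulkPlaneWave ν γ X p) (v := timeDir n) hi'
    ((hi.const_mul (-(Complex.I * p.1))).congr (.of_forall fun X => by
      simp only [ContinuousLinearMap.mul_apply']
      ring)) hi
    (fun X _ => ((hF.smooth.differentiable (by simp)) X).hasFDerivAt.hasLineDerivAt _)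
    (fun X _ => hasLineDerivAt_bulkPlaneWave ν γ p X)
  simp only [ContinuousLinearMap.mul_apply', mul_left_comm (F _), integral_const_mul] at h
  linear_combination h

/-- Each integration by parts in `t₁` trades a derivative of `F` for a factor `ω`. The induction
step writes `1 + ω` as a sum and uses the hypothesis for `F` and for its time derivative, hence the
quantification over `F`. -/
theorem exists_decay {ν : ℝ} (hν : ν ∈ Ioo (0 : ℝ) 1) (γ : ℝ) (N : ℕ) :
    ∀ {F : Bulk n × Bulk n → ℂ}, IsBulkTest F → ∃ C, ∀ p : Mink n, ‖p.2‖ < p.1 →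
      (1 + p.1) ^ N * ‖∫ X, F X * bulkPlaneWave ν γ X p‖ ≤ C * (1 + p.1) ^ 4 := by
  induction N with
  | zero =>
    intro F hF
    obtain ⟨C, -, hb⟩ := hF.exists_bound hν γ
    refine ⟨(∫ X, ‖F X‖) * C, fun p hp => ?_⟩
    rw [pow_zero, one_mul, mul_assoc, ← integral_mul_const]
    exact norm_integral_le_of_norm_le (hF.integrable.norm.mul_const _)
      (.of_forall fun X => norm_mul_bulkPlaneWave_le (fun X hX => hb X hX p hp) X)
  | succ N ih =>
    intro F hF
    obtain ⟨C, hC⟩ := ih hF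
    obtain ⟨C', hC'⟩ := ih (hF.fderiv_apply (timeDir n))
    refine ⟨C + C', fun p hp => ?_⟩
    have hp0 : 0 ≤ p.1 := (norm_nonneg _).trans hp.le
    have h := hC' p hp
    rw [hF.integral_fderiv_mul_bulkPlaneWave hν γ hp, norm_mul, norm_mul, Complex.norm_I,
      Complex.norm_real, Real.norm_of_nonneg hp0] at h
    linear_combination hC p hp + h

theorem integrable_wightmanDensity_mul_integral (hF : IsBulkTest F) (hn : 1 ≤ n) {ν : ℝ}
    (hν : ν ∈ Ioo (0 : ℝ) 1) (f γ : ℝ) :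
    Integrable fun p => (wightmanDensity n ν f p : ℂ) * ∫ X, F X * bulkPlaneWave ν γ X p := by
  -- `n + 7 = (n + 3) + 4`: four powers offset the growth of the two profiles.
  obtain ⟨C, hC⟩ := exists_decay hν γ (n + 7) hF
  refine integrable_wightmanDensity_mul hn hν f ?_ C fun p hp => ?_
  · exact (StronglyMeasurable.integral_prod_left' (f := fun y : (Bulk n × Bulk n) × Mink n =>
      F y.1 * bulkPlaneWave ν γ y.1 y.2) (((hF.smooth.continuous.measurable.comp
        measurable_fst).mul (measurable_bulkPlaneWave hν γ)).stronglyMeasurable)).measurable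
  · have hp0 : 0 < 1 + p.1 := by linarith [(norm_nonneg _).trans hp.le]
    rw [← div_eq_mul_inv, le_div_iff₀ (by positivity)]
    refine le_of_mul_le_mul_right ?_ (pow_pos hp0 4)
    linear_combination hC p hp

theorem integrable_prod_bulkPlaneWave (hF : IsBulkTest F) (hn : 1 ≤ n) {ν : ℝ}
    (hν : ν ∈ Ioo (0 : ℝ) 1) (f γ : ℝ) {ε : ℝ} (hε : 0 < ε) :
    Integrable fun y : (Bulk n × Bulk n) × Mink n => F y.1 *
      ((wightmanDensity n ν f y.2 : ℂ) * bulkMomentum ν γ ε y.1.1 y.1.2 y.2) := by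
  obtain ⟨C, hC0, hb⟩ := hF.exists_bound hν γ
  have hw : Integrable fun p : Mink n => (wightmanDensity n ν f p : ℂ) *
      ((C * (1 + p.1) ^ 4 * Real.exp (-(ε * p.1)) : ℝ) : ℂ) := by
    refine integrable_wightmanDensity_mul_exp hn hν f (Continuous.measurable (by fun_prop)) hε 4
      hC0 fun p hp => le_of_eq ?_
    have hp0 : 0 ≤ p.1 := (norm_nonneg _).trans hp.le
    rw [Complex.norm_real, Real.norm_of_nonneg (by positivity)]
  refine Integrable.mono' (hF.integrable.norm.mul_prod hw.norm) ?_ (.of_forall fun y => ?_)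
  · simp only [bulkMomentum_eq_bulkPlaneWave]
    have h1 := measurable_bulkPlaneWave (n := n) hν γ
    have h2 := (measurable_wightmanDensity n ν f).comp
      (measurable_snd : Measurable (Prod.snd : (Bulk n × Bulk n) × Mink n → Mink n))
    have h3 : Measurable fun y : (Bulk n × Bulk n) × Mink n =>
        (Real.exp (-(ε * y.2.1)) : ℂ) / (2 * π) ^ (n + 1) :=
      Continuous.measurable (by fun_prop)
    exact ((hF.smooth.continuous.measurable.comp measurable_fst).mul
      ((Complex.measurable_ofReal.comp h2).mul (h1.mul h3))).aestronglyMeasurable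
  · by_cases hp : ‖y.2.2‖ < y.2.1
    · have hp0 : 0 ≤ y.2.1 := (norm_nonneg _).trans hp.le
      have h := norm_mul_bulkPlaneWave_le (fun X hX => hb X hX y.2 hp) y.1
      rw [bulkMomentum_eq_bulkPlaneWave]
      calc _ = ‖(wightmanDensity n ν f y.2 : ℂ)‖ * (‖F y.1 * bulkPlaneWave ν γ y.1 y.2‖
            * ‖(Real.exp (-(ε * y.2.1)) : ℂ) / (2 * π) ^ (n + 1)‖) := by
            simp only [norm_mul]
            ring
        _ ≤ ‖(wightmanDensity n ν f y.2 : ℂ)‖ * (‖F y.1‖ * (C * (1 + y.2.1) ^ 4)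
            * Real.exp (-(ε * y.2.1))) := by
            gcongr
            refine (norm_div_two_pi_pow_le _ _).trans (le_of_eq ?_)
            rw [Complex.norm_real, Real.norm_of_nonneg (Real.exp_pos _).le]
        _ = _ := by
            rw [norm_mul, Complex.norm_real (C * _ * _), Real.norm_of_nonneg (by positivity)]
            ring
    · simp [wightmanDensity, hp]

variable {ν f α γ : ℝ}

theorem mappingConst_mul_bulkWightman_mul (hF : IsBulkTest F) (hn : 1 ≤ n)
    (hν : ν ∈ Ioo (0 : ℝ) 1) (hα : α ∈ Ioo 0 π) (hγ : γ ∈ Ioo 0 π)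
    (hcα : Real.cot α = -(f * Aconst n ν))
    (hcγ : Real.cot γ =
        -(2 ^ (-(2 * ν)) * Real.Gamma (1 - ν) / Real.Gamma (1 + ν) * Real.cot α))
    {ε : ℝ} (hε : 0 < ε) (X : Bulk n × Bulk n) :
    (mappingConst n ν γ : ℂ) * (bulkWightman n ν α ε X.1 X.2 * F X)
      = ∫ p, F X * ((wightmanDensity n ν f p : ℂ) * bulkMomentum ν γ ε X.1 X.2 p) := by
  -- Off the support of `F` the points may have `Z ≤ 0`, where nothing is known about the bulk
  -- function; both sides vanish there.
  by_cases hX : X ∈ tsupport F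
  · have hp := hF.subset hX
    rw [integral_const_mul,
      ← (bulkWightman_momentum hn hν hα hγ hcα hcγ hε hp.1 hp.2).2]
    ring
  · simp [image_eq_zero_of_notMem_tsupport hX]

theorem integrable_bulkWightman_mul (hF : IsBulkTest F) (hn : 1 ≤ n)
    (hν : ν ∈ Ioo (0 : ℝ) 1) (hα : α ∈ Ioo 0 π) (hγ : γ ∈ Ioo 0 π)
    (hcα : Real.cot α = -(f * Aconst n ν))
    (hcγ : Real.cot γ =
        -(2 ^ (-(2 * ν)) * Real.Gamma (1 - ν) / Real.Gamma (1 + ν) * Real.cot α))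
    {ε : ℝ} (hε : 0 < ε) : Integrable fun X => bulkWightman n ν α ε X.1 X.2 * F X := by
  have hc : (mappingConst n ν γ : ℂ) ≠ 0 := by exact_mod_cast (mappingConst_pos hn hν hγ).ne'
  have h := (hF.integrable_prod_bulkPlaneWave hn hν f γ hε).integral_prod_left
  simp only [← hF.mappingConst_mul_bulkWightman_mul hn hν hα hγ hcα hcγ hε] at h
  exact (integrable_const_mul_iff (isUnit_iff_ne_zero.2 hc) _).1 h

theorem integral_bulkWightman_mul (hF : IsBulkTest F) (hn : 1 ≤ n)
    (hν : ν ∈ Ioo (0 : ℝ) 1) (hα : α ∈ Ioo 0 π) (hγ : γ ∈ Ioo 0 π)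
    (hcα : Real.cot α = -(f * Aconst n ν))
    (hcγ : Real.cot γ =
        -(2 ^ (-(2 * ν)) * Real.Gamma (1 - ν) / Real.Gamma (1 + ν) * Real.cot α))
    {ε : ℝ} (hε : 0 < ε) :
    (mappingConst n ν γ : ℂ) * ∫ X, bulkWightman n ν α ε X.1 X.2 * F X
      = ∫ p, (Real.exp (-(ε * p.1)) : ℂ) *
        ((wightmanDensity n ν f p : ℂ) * (∫ X, F X * bulkPlaneWave ν γ X p)
          / (2 * π) ^ (n + 1)) := by
  rw [← integral_const_mul]
  simp only [hF.mappingConst_mul_bulkWightman_mul hn hν hα hγ hcα hcγ hε]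
  rw [integral_integral_swap (hF.integrable_prod_bulkPlaneWave hn hν f γ hε)]
  congr 1
  ext p
  rw [mul_div_right_comm, ← mul_assoc, ← integral_const_mul]
  congr 1
  ext X
  rw [bulkMomentum_eq_bulkPlaneWave]
  ring

/-- After Fubini `ε` survives only in `exp(-εω) ≤ 1`, and `exists_decay` makes the integrand at `ε =
0` integrable. -/
theorem exists_tendsto_integral_bulkWightman_mul (hF : IsBulkTest F) (hn : 1 ≤ n)
    (hν : ν ∈ Ioo (0 : ℝ) 1) (hα : α ∈ Ioo 0 π) (hγ : γ ∈ Ioo 0 π)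
    (hcα : Real.cot α = -(f * Aconst n ν))
    (hcγ : Real.cot γ =
        -(2 ^ (-(2 * ν)) * Real.Gamma (1 - ν) / Real.Gamma (1 + ν) * Real.cot α)) :
    ∃ ℓ : ℂ, Tendsto (fun ε : ℝ => ∫ X, bulkWightman n ν α ε X.1 X.2 * F X) (𝓝[>] 0) (𝓝 ℓ) := by
  have hc : (mappingConst n ν γ : ℂ) ≠ 0 := by exact_mod_cast (mappingConst_pos hn hν hγ).ne'
  have hi := (hF.integrable_wightmanDensity_mul_integral hn hν f γ).div_const
    ((2 * π : ℂ) ^ (n + 1))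
  have key : Tendsto (fun ε : ℝ => ∫ p, (Real.exp (-(ε * p.1)) : ℂ) *
        ((wightmanDensity n ν f p : ℂ) * (∫ X, F X * bulkPlaneWave ν γ X p)
          / (2 * π) ^ (n + 1))) (𝓝[>] 0)
      (𝓝 (∫ p, (wightmanDensity n ν f p : ℂ) * (∫ X, F X * bulkPlaneWave ν γ X p)
          / (2 * π) ^ (n + 1))) := by
    refine tendsto_integral_filter_of_dominated_convergence _
      (.of_forall fun ε => (Continuous.aestronglyMeasurable (by fun_prop)).mul
        hi.aestronglyMeasurable) ?_ hi.norm (.of_forall fun p => ?_)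
    · filter_upwards [self_mem_nhdsWithin] with ε hε
      refine .of_forall fun p => ?_
      by_cases hp : ‖p.2‖ < p.1
      · have hp0 : 0 ≤ p.1 := (norm_nonneg _).trans hp.le
        rw [norm_mul, Complex.norm_real, Real.norm_of_nonneg (Real.exp_pos _).le]
        refine mul_le_of_le_one_left (norm_nonneg _) (Real.exp_le_one_iff.2 ?_)
        exact neg_nonpos.2 (mul_nonneg (le_of_lt hε) hp0)
      · simp [wightmanDensity, hp]
    · have h : Tendsto (fun ε : ℝ => (Real.exp (-(ε * p.1)) : ℂ)) (𝓝[>] 0) (𝓝 1) := by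
        have : Continuous fun ε : ℝ => (Real.exp (-(ε * p.1)) : ℂ) := by fun_prop
        have := (this.tendsto 0).mono_left (nhdsWithin_le_nhds (s := Ioi 0))
        simpa using this
      simpa using h.mul_const _
  refine ⟨(mappingConst n ν γ : ℂ)⁻¹ * _, (key.const_mul (mappingConst n ν γ : ℂ)⁻¹).congr' ?_⟩
  filter_upwards [self_mem_nhdsWithin] with ε hε
  rw [← hF.integral_bulkWightman_mul hn hν hα hγ hcα hcγ hε, inv_mul_cancel_left₀ hc]

end IsBulkTest

end RobinHolography

theorem mainTheorem6 (n : ℕ) (hn : 1 ≤ n) (ν : ℝ) (hν : ν ∈ Ioo (0 : ℝ) 1)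
    (f : ℝ) (hf : 0 ≤ f) :
    -- the Schwinger function at nonzero Euclidean time is well defined, and the boundary Wightman
    -- function at complex times in the lower half-plane is its analytic continuation
    ((∀ τ : ℝ, τ ≠ 0 →
        (∀ k : EuclideanSpace ℝ (Fin n), k ≠ 0 →
          Tendsto (schwingerCutoff n ν f τ k) atTop (𝓝 (schwingerMode n ν f τ k))) ∧
        Integrable (schwingerMode n ν f τ)) ∧
      (∀ (z : ℂ) (x : EuclideanSpace ℝ (Fin n)), z.im < 0 →
        Integrable (wightmanIntegrand n ν f z x)) ∧
      (∀ x : EuclideanSpace ℝ (Fin n),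
        DifferentiableOn ℂ (fun z => wightman n ν f z x) {z : ℂ | z.im < 0}) ∧
      (∀ (τ : ℝ) (x : EuclideanSpace ℝ (Fin n)), τ ≠ 0 →
        schwinger n ν f τ x = wightman n ν f (-(Complex.I * ((|τ| : ℝ) : ℂ))) x)) ∧
    -- its boundary value is a tempered distribution, whose Fourier transform is supported on the
    -- closed future light cone
    (∃ T That : 𝓢'(Mink n, ℂ),
      (∀ h : 𝓢(Mink n, ℂ),
        Tendsto (fun ε : ℝ => ∫ x : Mink n, wightmanReg n ν f ε x * h x) (𝓝[>] 0) (𝓝 (T h))) ∧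
      (∀ h : 𝓢(Mink n, ℂ),
        Integrable (fun p : Mink n => (wightmanDensity n ν f p : ℂ) * minkFourier h p) ∧
        T h = ∫ p : Mink n,
          (wightmanDensity n ν f p : ℂ) * minkFourier h p / (2 * π) ^ (n + 1)) ∧
      (∀ g : 𝓢(Mink n, ℂ),
        Integrable (fun p : Mink n => (wightmanDensity n ν f p : ℂ) * g p) ∧
        That g = ∫ p : Mink n, (wightmanDensity n ν f p : ℂ) * g p / (2 * π) ^ (n + 1)) ∧
      Distribution.dsupport That = {p : Mink n | ‖p.2‖ ≤ p.1}) ∧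
    -- with the Robin parameters identified, the kernel maps the boundary Wightman function to the
    -- bulk Wightman function
    (∀ α ∈ Ioo 0 π, ∀ γ ∈ Ioo 0 π,
      Real.cot α = -(f * Aconst n ν) →
      Real.cot γ =
        -(2 ^ (-(2 * ν)) * Real.Gamma (1 - ν) / Real.Gamma (1 + ν) * Real.cot α) →
      -- the bulk modes solve the radial Klein-Gordon equation and obey the boundary condition
      -- `φ₊ = cos γ φ`, `φ₋ = sin γ φ`
      (∀ q : ℝ, 0 < q →
        ContDiffOn ℝ ∞ (robinMode n ν α q) (Ioi 0) ∧
        (∀ Z : ℝ, 0 < Z →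
          Z ^ 2 * deriv (deriv (robinMode n ν α q)) Z - n * Z * deriv (robinMode n ν α q) Z
            + (q ^ 2 * Z ^ 2 - (ν ^ 2 - (((n : ℝ) + 1) / 2) ^ 2)) * robinMode n ν α q Z = 0) ∧
        ∃ φ : ℝ, φ ≠ 0 ∧
          Tendsto (fun Z : ℝ => Z ^ (-(((n : ℝ) + 1) / 2 - ν)) * robinMode n ν α q Z)
            (𝓝[>] 0) (𝓝 (Real.sin γ * φ)) ∧
          Tendsto (fun Z : ℝ => Z ^ (-(((n : ℝ) + 1) / 2 + ν)) *
              (robinMode n ν α q Z - Real.sin γ * φ * Z ^ (((n : ℝ) + 1) / 2 - ν)))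
            (𝓝[>] 0) (𝓝 (Real.cos γ * φ))) ∧
      -- the image of the boundary Wightman function, at every value of the regulator `ε`
      (∀ ε : ℝ, 0 < ε → ∀ X₁ X₂ : Bulk n, 0 < X₁.2 → 0 < X₂.2 →
        IntegrableOn (bulkIntegrand n ν α ε X₁ X₂) (univ ×ˢ Ioi (0 : ℝ)) ∧
        ∀ χ₁ χ₂ : Mink n → ℝ, IsCutoff χ₁ → IsCutoff χ₂ →
          (∀ Λ₁ Λ₂ : ℝ, 0 < Λ₁ → 0 < Λ₂ →
            Integrable (mappedIntegrand ν γ f ε χ₁ χ₂ Λ₁ Λ₂ X₁ X₂)) ∧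
          Tendsto (fun Λ : ℝ × ℝ =>
              ∫ x : Mink n × Mink n, mappedIntegrand ν γ f ε χ₁ χ₂ Λ.1 Λ.2 X₁ X₂ x)
            (atTop ×ˢ atTop)
            (𝓝 (((2 * π ^ (((n : ℝ) + 1) / 2) * Real.Gamma (1 - ν)
                / Real.Gamma (((n : ℝ) + 1) / 2 - ν) * Real.sin γ ^ 2 : ℝ) : ℂ)
              * bulkWightman n ν α ε X₁ X₂))) ∧
      -- the regulator can be removed in the sense of distributions on pairs of bulk points
      (∀ F : Bulk n × Bulk n → ℂ, ContDiff ℝ ∞ F → HasCompactSupport F →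
        tsupport F ⊆ {X | 0 < X.1.2 ∧ 0 < X.2.2} →
        (∀ ε : ℝ, 0 < ε → Integrable fun X => bulkWightman n ν α ε X.1 X.2 * F X) ∧
        ∃ ℓ : ℂ, Tendsto (fun ε : ℝ => ∫ X, bulkWightman n ν α ε X.1 X.2 * F X)
          (𝓝[>] 0) (𝓝 ℓ))) := by
  refine ⟨⟨fun τ hτ => ⟨fun k hk => ?_, integrable_schwingerMode hn hν hf hτ⟩,
    fun z x hz => integrable_wightmanIntegrand hn hν f hz x,
    differentiableOn_wightman hn hν f,
    fun τ x hτ => (euclidean_shell_fubini hn hν hf hτ x).2⟩,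
    exists_wightman_distribution hn hν f,
    fun α hα γ hγ hcα hcγ => ⟨fun q hq => robinMode_properties n hν hα hγ hcα hcγ hq,
      fun ε hε X₁ X₂ h₁ h₂ => ?_, fun F hF hFc hFs => ?_⟩⟩
  · rw [schwingerMode_eq hn hν hf hτ hk]
    exact tendsto_schwingerCutoff hn hν hf hτ hk
  · have hb := bulkWightman_momentum hn hν hα hγ hcα hcγ hε h₁ h₂
    refine ⟨hb.1, fun χ₁ χ₂ hχ₁ hχ₂ => ⟨fun Λ₁ Λ₂ hΛ₁ hΛ₂ =>
      (mapped_integral hn hν f γ hε X₁ X₂ hχ₁ hχ₂ hΛ₁ hΛ₂).1, ?_⟩⟩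
    have ht := tendsto_mapped_integral hn hν f γ hε h₁ h₂ hχ₁ hχ₂
    rw [← hb.2] at ht
    exact ht
  · have hF' : IsBulkTest F := ⟨hF, hFc, hFs⟩
    exact ⟨fun ε hε => hF'.integrable_bulkWightman_mul hn hν hα hγ hcα hcγ hε,
      hF'.exists_tendsto_integral_bulkWightman_mul hn hν hα hγ hcα hcγ⟩
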